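/- Let $V:[0,1]\to\mathbb R$ be a strictly positive function of class $C^1$. Consider on $[0,1]$ the three problems (B) $\partial_t u+u\,\partial_x u=\partial_{xx}^2u+2\,\partial_xV$, $\ u(t,0)=u(t,1)=0$, $\ u(0,\cdot)=u_0$; (N) $\partial_t\tilde v=\partial_{xx}^2\tilde v-V\tilde v+\big(\int_0^1V(\xi)\tilde v(t,\xi)\,d\xi\big)\tilde v$, $\ \partial_x\tilde v(t,0)=\partial_x\tilde v(t,1)=0$, $\ \tilde v(0,\cdot)=\tilde v_0$; (H) $\partial_t v=\partial_{xx}^2v-Vv$, $\ \partial_xv(t,0)=\partial_xv(t,1)=0$, $\ v(0,\cdot)=v_0$. A solution on $[0,T)$, $0<T\le\infty$, is a continuous curve $[0,T)\to L^2([0,1])$ with the given value at $t=0$ which for $0<t<T$ is represented by a function of class $C^{1,2}$ (once in $t$, twice in $x$) on $(0,T)\times[0,1]$ satisfying the equation and the boundary conditions. Let $\mathcal P_+$ be the set of $v\in L^2([0,1])$ whose first weak derivative is in $L^2([0,1])$ and whose continuous representative is strictly positive on $[0,1]$, and $\mathcal P_1=\{v\in\mathcal P_+:\int_0^1v=1\}$.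 The Cole–Hopf transforms are $$C(v)=-2\,\frac{\partial_xv}{v}\quad(v\in\mathcal P_+),\qquad H(u)=\frac{e^{-\frac12\int_0^xu(s)\,ds}}{\int_0^1e^{-\frac12\int_0^xu(s)\,ds}\,dx}\in\mathcal P_1\quad(u\in L^2([0,1])).$$ Then (H), (N) and (B) generate global flows $\Phi^t_{\mathcal H}$ on $\mathcal P_+$, $\Phi^t_{\mathcal N}$ on $\mathcal P_1$ and $\Phi^t_{\mathcal B}$ on $L^2([0,1])$: each initial datum in the indicated set has a solution on $[0,\infty)$, which stays in that set and coincides on $[0,T)$ with every solution on $[0,T)$ with the same datum. Moreover, for all $t\ge0$: 1. $H\circ\Phi^t_{\mathcal B}=\Phi^t_{\mathcal N}\circ H$ on $L^2([0,1])$, and $C\circ\Phi^t_{\mathcal N}=\Phi^t_{\mathcal B}\circ C$ on $\mathcal P_1$. 2. For $v_0\in\mathcal P_1$ and $g(t)=\int_0^1\Phi^t_{\mathcal H}(v_0)(\xi)\,d\xi$, one has $g(t)>0$ and $\Phi^t_{\mathcal N}(v_0)=\frac1{g(t)}\Phi^t_{\mathcal H}(v_0)$. 3. $C\circ\Phi^t_{\mathcal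 N}=C\circ\Phi^t_{\mathcal H}$ on $\mathcal P_1$, and $C\circ\Phi^t_{\mathcal H}=\Phi^t_{\mathcal B}\circ C$ on $\mathcal P_+$. In particular $\Phi^t_{\mathcal B}(u_0)=C\big(\Phi^t_{\mathcal H}(H(u_0))\big)$ for every $u_0\in L^2([0,1])$. -/

import Mathlib

open Set MeasureTheory

noncomputable section

namespace ColeHopf

/-- Lebesgue measure on `[0,1]`. -/
abbrev muI : Measure ℝ := volume.restrict (Icc (0 : ℝ) 1)

/-- The real Hilbert space `L²([0,1])`. -/
abbrev L2I : Type := Lp ℝ 2 muI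

/-- `w` is the first weak derivative of `v` on `(0,1)`. -/
def HasWeakDeriv (v w : L2I) : Prop :=
  ∀ φ : ℝ → ℝ, ContDiff ℝ ((⊤ : ℕ∞) : WithTop ℕ∞) φ → HasCompactSupport φ →
    tsupport φ ⊆ Ioo (0 : ℝ) 1 →
      ∫ x, v x * deriv φ x ∂muI = - ∫ x, w x * φ x ∂muI

open scoped Classical in
/-- The first weak derivative in `L²([0,1])` (the value `0` is used when there is none). -/
def weakDeriv (v : L2I) : L2I :=
  if h : ∃ w, HasWeakDeriv v w then h.choose else 0

/-- The spatial mean `∫₀¹ v`. -/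
def mean (v : L2I) : ℝ := ∫ x, v x ∂muI

/-- The set `𝒫₊`: square integrable functions with square integrable first weak derivative, whose
continuous representative is strictly positive on the closed interval `[0,1]`. -/
def Pplus : Set L2I :=
  {v | (∃ w, HasWeakDeriv v w) ∧
    ∃ f : ℝ → ℝ, ContinuousOn f (Icc 0 1) ∧ (∀ x ∈ Icc (0 : ℝ) 1, 0 < f x) ∧ v =ᵐ[muI] f}

/-- The set `𝒫₁` of the elements of `𝒫₊` with mean `1`. -/
def Pone : Set L2I := {v | v ∈ Pplus ∧ mean v = 1}

/-- `x ↦ exp (-½ ∫₀ˣ u)`. -/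
def expPrimitive (u : L2I) (x : ℝ) : ℝ :=
  Real.exp (-(1 / 2) * ∫ s in (0 : ℝ)..x, u s)

theorem continuousOn_expPrimitive (u : L2I) : ContinuousOn (expPrimitive u) (Icc 0 1) := by
  have h1 : IntegrableOn (u : ℝ → ℝ) (Icc (0 : ℝ) 1) volume :=
    (Lp.memLp u).integrable (by norm_num)
  have h2 : ContinuousOn (fun x => ∫ s in (0 : ℝ)..x, u s) (Icc 0 1) := by
    have := intervalIntegral.continuousOn_primitive_interval (μ := volume) (f := (u : ℝ → ℝ))
      (a := 0) (b := 1) (by rwa [uIcc_of_le zero_le_one])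
    rwa [uIcc_of_le zero_le_one] at this
  exact Real.continuous_exp.comp_continuousOn (continuousOn_const.mul h2)

theorem memLp_coleHopfH (u : L2I) :
    MemLp (fun x => expPrimitive u x / ∫ y, expPrimitive u y ∂muI) 2 muI := by
  have hc : ContinuousOn (fun x => expPrimitive u x / ∫ y, expPrimitive u y ∂muI) (Icc 0 1) :=
    (continuousOn_expPrimitive u).div_const _
  obtain ⟨K, hK⟩ := isCompact_Icc.exists_bound_of_continuousOn hc
  refine MemLp.of_bound (hc.aestronglyMeasurable measurableSet_Icc) K ?_
  exact (ae_restrict_iff' measurableSet_Icc).2 (Filter.Eventually.of_forall hK)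

/-- The Cole-Hopf transform `H(u) = exp(-½∫₀ˣ u) / ∫₀¹ exp(-½∫₀ˣ u) dx` on `L²([0,1])`. -/
def coleHopfH (u : L2I) : L2I := (memLp_coleHopfH u).toLp _

open scoped Classical in
/-- The Cole-Hopf transform `C(v) = -2 ∂ₓv / v`. It is meant for `v ∈ 𝒫₊`, where the quotient
is square integrable; elsewhere the value is irrelevant. -/
def coleHopfC (v : L2I) : L2I :=
  if h : MemLp (fun x => -2 * (weakDeriv v x / v x)) 2 muI then h.toLp _ else 0

/-- The time interval `[0,T)`, where `T` may be infinite. -/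
def timeSpan (T : EReal) : Set ℝ := {t | 0 ≤ t ∧ (t : EReal) < T}

/-- The open time interval `(0,T)`, where `T` may be infinite. -/
def posTimes (T : EReal) : Set ℝ := {t | 0 < t ∧ (t : EReal) < T}

/-- `w` is of class `C^{1,2}` on `(0,T) × [0,1]`, with `∂ₜw = wt`, `∂ₓw = wx`, `∂ₓₓw = wxx`
(one-sided space derivatives at the end points). -/
structure IsC12 (T : EReal) (w wt wx wxx : ℝ → ℝ → ℝ) : Prop where
  deriv_t : ∀ t ∈ posTimes T, ∀ x ∈ Icc (0 : ℝ) 1, HasDerivAt (fun s => w s x) (wt t x) t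
  deriv_x : ∀ t ∈ posTimes T, ∀ x ∈ Icc (0 : ℝ) 1,
    HasDerivWithinAt (w t) (wx t x) (Icc 0 1) x
  deriv_xx : ∀ t ∈ posTimes T, ∀ x ∈ Icc (0 : ℝ) 1,
    HasDerivWithinAt (wx t) (wxx t x) (Icc 0 1) x
  cont : ContinuousOn (Function.uncurry w) (posTimes T ×ˢ Icc 0 1)
  cont_t : ContinuousOn (Function.uncurry wt) (posTimes T ×ˢ Icc 0 1)
  cont_x : ContinuousOn (Function.uncurry wx) (posTimes T ×ˢ Icc 0 1)
  cont_xx : ContinuousOn (Function.uncurry wxx) (posTimes T ×ˢ Icc 0 1)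

/-- `y` solves, on `[0,T)` and with Cauchy data `v₀`, the linear heat equation
`∂ₜv = ∂ₓₓv - V v`, `∂ₓv(t,0) = ∂ₓv(t,1) = 0`: it is continuous with values in `L²`, and for
positive times it is a classical solution. -/
structure IsHeatSolution (V : ℝ → ℝ) (T : EReal) (v₀ : L2I) (y : ℝ → L2I) : Prop where
  cont : ContinuousOn y (timeSpan T)
  init : y 0 = v₀
  eqn : ∃ w wt wx wxx : ℝ → ℝ → ℝ, IsC12 T w wt wx wxx ∧ ∀ t ∈ posTimes T,
    y t =ᵐ[muI] w t ∧
    (∀ x ∈ Ioo (0 : ℝ) 1, wt t x = wxx t x - V x * w t x) ∧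
    wx t 0 = 0 ∧ wx t 1 = 0

/-- `y` solves, on `[0,T)` and with Cauchy data `v₀`, the nonlinear nonlocal heat equation
`∂ₜv = ∂ₓₓv - V v + (∫₀¹ V(ξ) v(t,ξ) dξ) v`, `∂ₓv(t,0) = ∂ₓv(t,1) = 0`. -/
structure IsNonlinearHeatSolution (V : ℝ → ℝ) (T : EReal) (v₀ : L2I) (y : ℝ → L2I) :
    Prop where
  cont : ContinuousOn y (timeSpan T)
  init : y 0 = v₀
  eqn : ∃ w wt wx wxx : ℝ → ℝ → ℝ, IsC12 T w wt wx wxx ∧ ∀ t ∈ posTimes T,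
    y t =ᵐ[muI] w t ∧
    (∀ x ∈ Ioo (0 : ℝ) 1,
      wt t x = wxx t x - V x * w t x + (∫ ξ in (0 : ℝ)..1, V ξ * w t ξ) * w t x) ∧
    wx t 0 = 0 ∧ wx t 1 = 0

/-- `y` solves, on `[0,T)` and with Cauchy data `u₀`, the forced Burgers equation
`∂ₜu + u ∂ₓu = ∂ₓₓu + 2 ∂ₓV`, `u(t,0) = u(t,1) = 0`. -/
structure IsBurgersSolution (V : ℝ → ℝ) (T : EReal) (u₀ : L2I) (y : ℝ → L2I) : Prop where
  cont : ContinuousOn y (timeSpan T)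
  init : y 0 = u₀
  eqn : ∃ w wt wx wxx : ℝ → ℝ → ℝ, IsC12 T w wt wx wxx ∧ ∀ t ∈ posTimes T,
    y t =ᵐ[muI] w t ∧
    (∀ x ∈ Ioo (0 : ℝ) 1, wt t x + w t x * wx t x = wxx t x + 2 * deriv V x) ∧
    w t 0 = 0 ∧ w t 1 = 0

open scoped Classical in
/-- The flow of an evolution equation, given by its notion of solution `Sol T y₀ y`
("`y` solves the equation on `[0,T)` with Cauchy data `y₀`"): the value at time `t` of a solution
that lives beyond `t` (and `0` if there is none). -/
def flow (Sol : EReal → L2I → (ℝ → L2I) → Prop) (t : ℝ) (y₀ : L2I) : L2I :=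
  if h : ∃ y, ∃ T : EReal, (t : EReal) < T ∧ Sol T y₀ y then h.choose t else 0

/-- The equation generates a global flow on `S`: each `y₀ ∈ S` has a solution on `[0,∞)`, namely
`t ↦ flow Sol t y₀`, it stays in `S`, and every solution on some `[0,T)` with the same Cauchy data
coincides with it there. -/
def IsGlobalFlowOn (Sol : EReal → L2I → (ℝ → L2I) → Prop) (S : Set L2I) : Prop :=
  ∀ y₀ ∈ S, Sol ⊤ y₀ (fun t => flow Sol t y₀) ∧
    (∀ t : ℝ, 0 ≤ t → flow Sol t y₀ ∈ S) ∧
    ∀ T : EReal, 0 < T → ∀ y, Sol T y₀ y → ∀ t ∈ timeSpan T, y t = flow Sol t y₀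

/-- The linear heat flow. -/
def heatFlow (V : ℝ → ℝ) : ℝ → L2I → L2I := flow (IsHeatSolution V)

/-- The nonlinear heat flow. -/
def nonlinearHeatFlow (V : ℝ → ℝ) : ℝ → L2I → L2I := flow (IsNonlinearHeatSolution V)

/-- The Burgers flow. -/
def burgersFlow (V : ℝ → ℝ) : ℝ → L2I → L2I := flow (IsBurgersSolution V)

end ColeHopf

end

/-! Everything reduces to the linear equation (H) with data in $H^1$. An $H^1$ function is handled
as a pair $(c,g)\in\mathbb R\times L^2$ standing for $c+\int_0^x g$ (the map `J`). By du
Bois-Reymond, elements of $\mathcal P_+$ are exactly the pairs whose function is positive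
(`mem_Pplus_iff`).

Existence for (H). On the complexified pairs let $B$ be the Gram operator of the $L^2$ product and
$Q$ the operator of the form $\int f'g'+\int Vfg$. The weak equation is $Bv'=-Qv$. Since $V>0$, $Q$
is coercive, so $w=Q^{1/2}v$ satisfies $Rw'=-w$ with $R=Q^{-1/2}BQ^{-1/2}$ bounded, nonnegative and
injective. It is solved by the continuous functional calculus of $R$ with symbol $e^{-t/r}$, so no
eigenfunctions or unbounded operators occur (`exists_parabolic_curve`). The curve is smooth enough
in time with values in $H^1$ that the weak Neumann problem yields $f_x=\int_0^x(f_t+Vf)$, hence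
$f_{xx}$, $f_{xt}$, $f_{xxx}$ and the boundary conditions (`exists_heatCurve`). Uniqueness is the
$L^2$ energy estimate; positivity is a minimum principle.

For (N), with $g=\int f$ one has $g'=-\int Vf$, so $f/g$ solves (N). Conversely the factor
$a=\exp(-\int_0^t\int_0^1 Vy)$ turns any solution $y$ of (N) into the solution $ay$ of (H), and
$(g-a)'=0$ forces $a=g$ (`IsNonlinearHeatSolution.eq_normalized`).

For (B), $C$ of a positive solution of (H) is a solution. Conversely, integrating (B) once in $x$
shows that $H$ maps every solution of (B) to one of (N) (`IsBurgersSolution.coleHopfH`), so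
uniqueness for (N) together with $C\circ H=\mathrm{id}$ gives uniqueness for (B). The intertwining
relations then follow from uniqueness, the scale invariance of $C$, and $H(C(v))=v/\int v$. -/

noncomputable section

namespace ColeHopf

/-! ### Square integrable functions on the unit interval -/

/-- The Hilbert space `L²([0,1])` over `𝕜`. -/
abbrev L2 (𝕜 : Type*) [RCLike 𝕜] : Type _ := Lp 𝕜 2 muI

/-- Continuous functions on `[0,1]`. -/
abbrev CI (𝕜 : Type*) [RCLike 𝕜] : Type _ := C(Icc (0 : ℝ) 1, 𝕜)

/-- Constant extension of a continuous function on `[0,1]` to the line. -/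
def ext {𝕜 : Type*} [RCLike 𝕜] (a : CI 𝕜) : ℝ → 𝕜 := IccExtend zero_le_one a

section generic

variable {𝕜 : Type*} [RCLike 𝕜]

theorem continuous_ext (a : CI 𝕜) : Continuous (ext a) := a.continuous.Icc_extend'

theorem norm_ext_le (a : CI 𝕜) (x : ℝ) : ‖ext a x‖ ≤ ‖a‖ := a.norm_coe_le_norm _

theorem ext_of_mem (a : CI 𝕜) {x : ℝ} (hx : x ∈ Icc (0 : ℝ) 1) : ext a x = a ⟨x, hx⟩ :=
  IccExtend_of_mem _ _ hx

theorem integrable_L2 (g : L2 𝕜) : Integrable g muI := (Lp.memLp g).integrable (by norm_num)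

theorem intervalIntegrable_L2 (g : L2 𝕜) {a b : ℝ} (ha : a ∈ Icc (0 : ℝ) 1)
    (hb : b ∈ Icc (0 : ℝ) 1) : IntervalIntegrable g volume a b := by
  have h1 : IntegrableOn g (Icc 0 1) volume := integrable_L2 g
  exact (h1.mono_set (uIcc_subset_Icc ha hb)).intervalIntegrable

theorem integral_muI {E : Type*} [NormedAddCommGroup E] [NormedSpace ℝ E] (f : ℝ → E) :
    ∫ x, f x ∂muI = ∫ x in (0 : ℝ)..1, f x := by
  rw [intervalIntegral.integral_of_le zero_le_one, integral_Icc_eq_integral_Ioc]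

theorem ae_muI_of_forall {p : ℝ → Prop} (h : ∀ x ∈ Icc (0 : ℝ) 1, p x) : ∀ᵐ x ∂muI, p x :=
  (ae_restrict_iff' measurableSet_Icc).2 (Filter.Eventually.of_forall h)

theorem memLp_ext_mul (a : CI 𝕜) (g : L2 𝕜) : MemLp (fun x => ext a x * g x) 2 muI :=
  (Lp.memLp g).of_le_mul (c := ‖a‖)
    ((continuous_ext a).aestronglyMeasurable.mul (Lp.aestronglyMeasurable g))
    (Filter.Eventually.of_forall fun x => by
      rw [norm_mul]; exact mul_le_mul_of_nonneg_right (norm_ext_le a x) (norm_nonneg _))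

variable (𝕜) in
/-- Multiplication of square integrable functions by continuous functions. -/
def mulL2 : CI 𝕜 →L[𝕜] L2 𝕜 →L[𝕜] L2 𝕜 :=
  LinearMap.mkContinuous₂
    (LinearMap.mk₂ 𝕜 (fun a g => (memLp_ext_mul a g).toLp _)
      (fun a b g => by
        rw [← MemLp.toLp_add]
        exact MemLp.toLp_congr _ _ (Filter.Eventually.of_forall fun x => add_mul _ _ _))
      (fun c a g => by
        rw [← MemLp.toLp_const_smul]
        exact MemLp.toLp_congr _ _ (Filter.Eventually.of_forall fun x => mul_assoc _ _ _))
      (fun a g h => by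
        rw [← MemLp.toLp_add]
        refine MemLp.toLp_congr _ _ ?_
        filter_upwards [Lp.coeFn_add g h] with x hx
        simp only [hx, Pi.add_apply, mul_add])
      (fun c a g => by
        rw [← MemLp.toLp_const_smul]
        refine MemLp.toLp_congr _ _ ?_
        filter_upwards [Lp.coeFn_smul c g] with x hx
        simp only [hx, Pi.smul_apply, smul_eq_mul]
        ring)) 1
    (fun a g => by
      rw [one_mul]
      refine Lp.norm_le_mul_norm_of_ae_le_mul ?_
      filter_upwards [(memLp_ext_mul a g).coeFn_toLp] with x hx
      simp only [LinearMap.mk₂_apply, hx, norm_mul]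
      exact mul_le_mul_of_nonneg_right (norm_ext_le a x) (norm_nonneg _))

theorem coeFn_mulL2 (a : CI 𝕜) (g : L2 𝕜) : mulL2 𝕜 a g =ᵐ[muI] fun x => ext a x * g x :=
  (memLp_ext_mul a g).coeFn_toLp

theorem norm_mulL2_le (a : CI 𝕜) (g : L2 𝕜) : ‖mulL2 𝕜 a g‖ ≤ ‖a‖ * ‖g‖ := by
  refine Lp.norm_le_mul_norm_of_ae_le_mul ?_
  filter_upwards [coeFn_mulL2 a g] with x hx
  rw [hx, norm_mul]
  exact mul_le_mul_of_nonneg_right (norm_ext_le a x) (norm_nonneg _)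

variable (𝕜) in
/-- The embedding of continuous functions into `L²`. -/
def toL2 : CI 𝕜 →L[𝕜] L2 𝕜 := (mulL2 𝕜).flip (Lp.const 2 muI 1)

theorem coeFn_toL2 (a : CI 𝕜) : toL2 𝕜 a =ᵐ[muI] ext a := by
  filter_upwards [coeFn_mulL2 a (Lp.const 2 muI 1), Lp.coeFn_const (p := 2) (μ := muI) (1 : 𝕜)]
    with x hx h1
  change (mulL2 𝕜 a (Lp.const 2 muI 1)) x = _
  rw [hx, h1]; simp

theorem norm_integral_le_L2 (g : L2 𝕜) : ∫ x, ‖g x‖ ∂muI ≤ ‖g‖ := by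
  have hp : IsProbabilityMeasure muI := ⟨by simp [muI]⟩
  rw [integral_norm_eq_lintegral_enorm (Lp.aestronglyMeasurable g),
    ← eLpNorm_one_eq_lintegral_enorm, Lp.norm_def]
  exact ENNReal.toReal_mono (Lp.eLpNorm_ne_top g)
    (eLpNorm_le_eLpNorm_of_exponent_le (by norm_num) (Lp.aestronglyMeasurable g))

theorem continuous_primitive (g : L2 𝕜) :
    Continuous fun x : Icc (0 : ℝ) 1 => ∫ s in (0 : ℝ)..x, g s := by
  have h1 : IntegrableOn g (Icc (0 : ℝ) 1) volume := integrable_L2 g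
  have := intervalIntegral.continuousOn_primitive_interval (μ := volume) (f := (g : ℝ → 𝕜))
      (a := 0) (b := 1) (by rwa [uIcc_of_le zero_le_one])
  rw [uIcc_of_le zero_le_one] at this
  exact continuousOn_iff_continuous_domRestrict.1 this

variable (𝕜) in
/-- The primitive `x ↦ ∫₀ˣ g` vanishing at the origin. -/
def prim : L2 𝕜 →L[𝕜] CI 𝕜 :=
  LinearMap.mkContinuous
    { toFun := fun g => ⟨_, continuous_primitive g⟩
      map_add' := fun g h => by
        ext x
        have := intervalIntegral.integral_congr_ae_restrict (a := 0) (b := x) (μ := volume)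
          (ae_restrict_of_ae_restrict_of_subset
            (uIoc_subset_uIcc.trans (uIcc_subset_Icc (by simp) x.2)) (Lp.coeFn_add g h))
        simp only [ContinuousMap.coe_mk, ContinuousMap.add_apply]
        rw [this, ← intervalIntegral.integral_add (intervalIntegrable_L2 g (by simp) x.2)
          (intervalIntegrable_L2 h (by simp) x.2)]
        rfl
      map_smul' := fun c g => by
        ext x
        have := intervalIntegral.integral_congr_ae_restrict (a := 0) (b := x) (μ := volume)
          (ae_restrict_of_ae_restrict_of_subset
            (uIoc_subset_uIcc.trans (uIcc_subset_Icc (by simp) x.2)) (Lp.coeFn_smul c g))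
        simp only [ContinuousMap.coe_mk, ContinuousMap.smul_apply, RingHom.id_apply]
        rw [this, ← intervalIntegral.integral_smul]
        rfl } 1
    (fun g => by
      rw [one_mul]
      refine (ContinuousMap.norm_le _ (norm_nonneg _)).2 fun x => ?_
      refine le_trans ?_ (norm_integral_le_L2 g)
      simp only [LinearMap.coe_mk, AddHom.coe_mk, ContinuousMap.coe_mk]
      refine (intervalIntegral.norm_integral_le_integral_norm x.2.1).trans ?_
      rw [integral_muI]
      exact intervalIntegral.integral_mono_interval le_rfl x.2.1 x.2.2
        (Filter.Eventually.of_forall fun _ => norm_nonneg _)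
        (intervalIntegrable_L2 g (by simp) (by simp)).norm)

theorem prim_apply (g : L2 𝕜) (x : Icc (0 : ℝ) 1) : prim 𝕜 g x = ∫ s in (0 : ℝ)..x, g s := rfl

variable (𝕜) in
/-- The function `c + ∫₀ˣ g` with initial value `c` and derivative `g`. -/
def J : 𝕜 × L2 𝕜 →L[𝕜] CI 𝕜 :=
  (ContinuousLinearMap.mk (LinearMap.mk (AddHom.mk (fun c : 𝕜 => ContinuousMap.const _ c)
    (fun _ _ => rfl)) (fun _ _ => rfl)) (ContinuousMap.continuous_const')).coprod (prim 𝕜)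

theorem J_apply (p : 𝕜 × L2 𝕜) (x : Icc (0 : ℝ) 1) :
    J 𝕜 p x = p.1 + ∫ s in (0 : ℝ)..x, p.2 s := by
  simp [J, prim_apply, ContinuousLinearMap.coprod_apply]
  rfl

theorem ext_J (p : 𝕜 × L2 𝕜) {x : ℝ} (hx : x ∈ Icc (0 : ℝ) 1) :
    ext (J 𝕜 p) x = p.1 + ∫ s in (0 : ℝ)..x, p.2 s := by
  rw [ext_of_mem _ hx, J_apply]

end generic

/-! ### Weak derivatives and primitives -/

/-- Integration by parts for the primitive of a square integrable function. -/
theorem integral_primitive_mul_deriv (c : ℝ) (g : L2 ℝ) {F F' : ℝ → ℝ}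
    (hF : ContinuousOn F (Icc 0 1)) (hF' : ContinuousOn F' (Icc 0 1))
    (hd : ∀ x ∈ Ioo (0 : ℝ) 1, HasDerivAt F (F' x) x) :
    ∫ x in (0 : ℝ)..1, (c + ∫ s in (0 : ℝ)..x, g s) * F' x =
      (c + ∫ s in (0 : ℝ)..1, g s) * F 1 - c * F 0 - ∫ x in (0 : ℝ)..1, g x * F x := by
  have hg := intervalIntegrable_L2 g (a := 0) (b := 1) (by simp) (by simp)
  have hF'i : IntervalIntegrable F' volume 0 1 := hF'.intervalIntegrable_of_Icc zero_le_one
  -- `F` is differentiable only in the open interval. Rewritten as a primitive it is absolutely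
  -- continuous on all of $[0,1]$, and so is the other factor, so the product rule with a.e.
  -- derivatives applies.
  have hFint : ∀ x ∈ Icc (0 : ℝ) 1, F x = F 0 + ∫ s in (0 : ℝ)..x, F' s := by
    intro x hx
    have hs : Icc 0 x ⊆ Icc (0 : ℝ) 1 := Icc_subset_Icc_right hx.2
    rw [intervalIntegral.integral_eq_sub_of_hasDerivAt_of_le hx.1 (hF.mono hs)
      (fun y hy => hd y ⟨hy.1, hy.2.trans_le hx.2⟩) ((hF'.mono hs).intervalIntegrable_of_Icc hx.1)]
    ring
  have hac : ∀ (c : ℝ) {h : ℝ → ℝ}, IntervalIntegrable h volume 0 1 →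
      AbsolutelyContinuousOnInterval (fun x => c + ∫ s in (0 : ℝ)..x, h s) 0 1 := fun c h hh =>
    (contDiffOn_const.absolutelyContinuousOnInterval (f := fun _ => c)).fun_add
      (hh.absolutelyContinuousOnInterval_intervalIntegral (by simp))
  have hae : ∀ (c : ℝ) {h : ℝ → ℝ}, IntervalIntegrable h volume 0 1 →
      ∀ᵐ x, x ∈ uIoc (0 : ℝ) 1 → deriv (fun x => c + ∫ s in (0 : ℝ)..x, h s) x = h x := by
    intro c h hh
    filter_upwards [hh.ae_hasDerivAt_integral] with x hx hx1
    exact ((hx (uIoc_subset_uIcc hx1) 0 (by simp)).const_add c).deriv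
  have key := (hac c hg).integral_mul_deriv_eq_deriv_mul (hac (F 0) hF'i)
  have e1 : ∫ x in (0 : ℝ)..1, (c + ∫ s in (0 : ℝ)..x, g s) *
      deriv (fun x => F 0 + ∫ s in (0 : ℝ)..x, F' s) x =
      ∫ x in (0 : ℝ)..1, (c + ∫ s in (0 : ℝ)..x, g s) * F' x := by
    refine intervalIntegral.integral_congr_ae ?_
    filter_upwards [hae (F 0) hF'i] with x hx h1
    rw [hx h1]
  have e2 : ∫ x in (0 : ℝ)..1, deriv (fun x => c + ∫ s in (0 : ℝ)..x, g s) x *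
      (F 0 + ∫ s in (0 : ℝ)..x, F' s) = ∫ x in (0 : ℝ)..1, g x * F x := by
    refine intervalIntegral.integral_congr_ae ?_
    filter_upwards [hae c hg] with x hx h1
    rw [hx h1, hFint x]
    rw [uIoc_of_le zero_le_one] at h1
    exact Ioc_subset_Icc_self h1
  rw [e1, e2, ← hFint 1 (by simp)] at key
  simpa using key

theorem hasWeakDeriv_toL2_J (p : ℝ × L2 ℝ) : HasWeakDeriv (toL2 ℝ (J ℝ p)) p.2 := by
  intro φ hφ hc hs
  have h0 : ∀ x, x ∉ Ioo (0 : ℝ) 1 → φ x = 0 := fun x hx =>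
    image_eq_zero_of_notMem_tsupport fun h => hx (hs h)
  have hφ1 : ContDiff ℝ 1 φ := hφ.of_le (by exact_mod_cast le_top)
  have key := integral_primitive_mul_deriv p.1 p.2 (F := φ) (F' := deriv φ)
    hφ.continuous.continuousOn (hφ1.continuous_deriv le_rfl).continuousOn
    (fun x _ => (hφ1.differentiable (by norm_num) x).hasDerivAt)
  rw [h0 0 (by simp), h0 1 (by simp)] at key
  rw [integral_muI (fun x => p.2 x * φ x)]
  simp only [mul_zero, sub_zero, zero_sub] at key
  rw [← key, ← integral_muI]
  refine integral_congr_ae ?_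
  filter_upwards [coeFn_toL2 (J ℝ p), ae_restrict_mem measurableSet_Icc] with x hx h1
  rw [hx, ext_J p h1]

/-- Fundamental lemma of the calculus of variations on $(0,1)$; the two end points form a null set.
-/
theorem ae_eq_of_forall_integral_mul_eq_zero {h : ℝ → ℝ} (hh : Integrable h muI)
    (H : ∀ φ : ℝ → ℝ, ContDiff ℝ ((⊤ : ℕ∞) : WithTop ℕ∞) φ → HasCompactSupport φ →
      tsupport φ ⊆ Ioo (0 : ℝ) 1 → ∫ x, h x * φ x ∂muI = 0) : h =ᵐ[muI] 0 := by
  have h1 : IntegrableOn h (Ioo 0 1) volume :=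
    IntegrableOn.mono_set (t := Icc 0 1) hh Ioo_subset_Icc_self
  have := isOpen_Ioo.ae_eq_zero_of_integral_contDiff_smul_eq_zero (μ := volume) (U := Ioo (0 : ℝ) 1)
    (f := h) h1.locallyIntegrableOn (fun φ hφ hc hs => by
      rw [← H φ hφ hc hs, integral_Icc_eq_integral_Ioo,
        setIntegral_eq_integral_of_forall_compl_eq_zero]
      · simp [mul_comm]
      · intro x hx
        rw [image_eq_zero_of_notMem_tsupport fun h => hx (hs h), mul_zero])
  have h2 := (ae_restrict_iff' (μ := volume) measurableSet_Ioo).2 this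
  rw [restrict_Ioo_eq_restrict_Icc] at h2
  exact h2

theorem HasWeakDeriv.unique {v w w' : L2I} (h : HasWeakDeriv v w) (h' : HasWeakDeriv v w') :
    w = w' := by
  refine Lp.ext ?_
  have := ae_eq_of_forall_integral_mul_eq_zero ((integrable_L2 w).sub (integrable_L2 w'))
    (fun φ hφ hc hs => by
      obtain ⟨K, hK⟩ := hφ.continuous.bounded_above_of_compact_support hc
      have hi : ∀ w : L2I, Integrable (fun x => w x * φ x) muI := fun w =>
        (integrable_L2 w).mul_bdd hφ.continuous.aestronglyMeasurable
          (Filter.Eventually.of_forall hK)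
      have := (h φ hφ hc hs).symm.trans (h' φ hφ hc hs)
      simp only [Pi.sub_apply, sub_mul]
      rw [integral_sub (hi w) (hi w')]
      linarith)
  filter_upwards [this] with x hx
  simpa [sub_eq_zero] using hx

theorem weakDeriv_eq {v w : L2I} (h : HasWeakDeriv v w) : weakDeriv v = w := by
  have hex : ∃ w, HasWeakDeriv v w := ⟨w, h⟩
  rw [weakDeriv, dif_pos hex]
  exact hex.choose_spec.unique h

/-- A test function with vanishing integral is the derivative of a test function. -/
theorem exists_test_primitive {θ : ℝ → ℝ} (hθ : ContDiff ℝ ((⊤ : ℕ∞) : WithTop ℕ∞) θ)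
    (hc : HasCompactSupport θ) (hs : tsupport θ ⊆ Ioo (0 : ℝ) 1)
    (h0 : ∫ x in (0 : ℝ)..1, θ x = 0) :
    ∃ φ : ℝ → ℝ, ContDiff ℝ ((⊤ : ℕ∞) : WithTop ℕ∞) φ ∧ HasCompactSupport φ ∧
      tsupport φ ⊆ Ioo (0 : ℝ) 1 ∧ deriv φ = θ := by
  -- Inserting $1/2$ keeps the compact set nonempty when `θ` vanishes, so that its extreme points
  -- `a`, `b` exist and lie in $(0,1)$.
  have hK : IsCompact (insert (1 / 2) (tsupport θ)) := IsCompact.insert hc _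
  have hKs : insert (1 / 2) (tsupport θ) ⊆ Ioo (0 : ℝ) 1 := insert_subset (by norm_num) hs
  obtain ⟨a, ha, ha'⟩ := hK.exists_isLeast ⟨_, mem_insert _ _⟩
  obtain ⟨b, hb, hb'⟩ := hK.exists_isGreatest ⟨_, mem_insert _ _⟩
  have hz : ∀ x, x < a ∨ b < x → θ x = 0 := by
    intro x hx
    refine image_eq_zero_of_notMem_tsupport fun h => ?_
    have h1 := ha' (mem_insert_of_mem _ h)
    have h2 := hb' (mem_insert_of_mem _ h)
    rcases hx with hx | hx <;> linarith
  have hd : ∀ x, HasDerivAt (fun x => ∫ s in (0 : ℝ)..x, θ s) (θ x) x := fun x =>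
    intervalIntegral.integral_hasDerivAt_right (hθ.continuous.intervalIntegrable _ _)
      (hθ.continuous.stronglyMeasurableAtFilter _ _) hθ.continuous.continuousAt
  have hd' : deriv (fun x => ∫ s in (0 : ℝ)..x, θ s) = θ := funext fun x => (hd x).deriv
  have hsupp : Function.support (fun x => ∫ s in (0 : ℝ)..x, θ s) ⊆ Icc a b := by
    intro x hx
    by_contra hx'
    refine hx ?_
    have ha0 := (hKs ha).1
    have hb1 := (hKs hb).2
    rw [mem_Icc, not_and_or, not_le, not_le] at hx'
    rcases hx' with hx' | hx'
    · refine intervalIntegral.integral_zero_ae (Filter.Eventually.of_forall fun y hy => ?_)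
      refine hz y (Or.inl (hy.2.trans_lt ?_))
      exact max_lt ha0 hx'
    · have h2 : ∫ s in x..1, θ s = 0 := by
        refine intervalIntegral.integral_zero_ae (Filter.Eventually.of_forall fun y hy => ?_)
        exact hz y (Or.inr ((lt_min hx' hb1).trans hy.1))
      have h3 := intervalIntegral.integral_add_adjacent_intervals
        (hθ.continuous.intervalIntegrable (μ := volume) 0 x)
        (hθ.continuous.intervalIntegrable x 1)
      simp only
      linarith
  have hts : tsupport (fun x => ∫ s in (0 : ℝ)..x, θ s) ⊆ Icc a b :=
    closure_minimal hsupp isClosed_Icc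
  refine ⟨_, ?_, HasCompactSupport.of_support_subset_isCompact isCompact_Icc hsupp,
    hts.trans fun x hx => ⟨(hKs ha).1.trans_le hx.1, hx.2.trans_lt (hKs hb).2⟩, hd'⟩
  rw [contDiff_infty_iff_deriv]
  exact ⟨fun x => (hd x).differentiableAt, by rwa [hd']⟩

/-- The lemma of du Bois-Reymond: a function with vanishing weak derivative is constant. -/
theorem ae_eq_const_of_hasWeakDeriv_zero {v : L2I} (h : HasWeakDeriv v 0) :
    ∃ c : ℝ, v =ᵐ[muI] fun _ => c := by
  have hv : ∀ φ : ℝ → ℝ, ContDiff ℝ ((⊤ : ℕ∞) : WithTop ℕ∞) φ → HasCompactSupport φ →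
      tsupport φ ⊆ Ioo (0 : ℝ) 1 → ∫ x, v x * deriv φ x ∂muI = 0 := by
    intro φ hφ hc hs
    rw [h φ hφ hc hs, integral_congr_ae (g := fun _ => (0 : ℝ)), integral_zero, neg_zero]
    filter_upwards [Lp.coeFn_zero ℝ 2 muI] with x hx
    rw [hx]; simp
  -- `χ` has integral one, so $\psi-(\int\psi)\chi$ has integral zero for each test function `ψ` and
  -- is the derivative of a test function, against which `v` integrates to zero. This identifies the
  -- constant as $\int v\chi$.
  let B : ContDiffBump (1 / 2 : ℝ) := ⟨1 / 8, 1 / 4, by norm_num, by norm_num⟩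
  set χ : ℝ → ℝ := B.normed volume with hχdef
  have hχ : ContDiff ℝ ((⊤ : ℕ∞) : WithTop ℕ∞) χ := B.contDiff_normed
  have hχc : HasCompactSupport χ := B.hasCompactSupport_normed
  have hχs : tsupport χ ⊆ Ioo (0 : ℝ) 1 := by
    rw [hχdef, B.tsupport_normed_eq, Real.closedBall_eq_Icc]
    intro x hx
    simp only [B, mem_Icc, mem_Ioo] at hx ⊢
    constructor <;> linarith [hx.1, hx.2]
  have hint : ∀ ψ : ℝ → ℝ, tsupport ψ ⊆ Ioo (0 : ℝ) 1 →
      ∫ x in (0 : ℝ)..1, ψ x = ∫ x, ψ x := by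
    intro ψ hψ
    rw [← integral_muI, setIntegral_eq_integral_of_forall_compl_eq_zero]
    exact fun x hx => image_eq_zero_of_notMem_tsupport fun h' =>
      hx (Ioo_subset_Icc_self (hψ h'))
  have hχ1 : ∫ x in (0 : ℝ)..1, χ x = 1 := by rw [hint χ hχs]; exact B.integral_normed
  have hi : ∀ {ψ : ℝ → ℝ}, ContDiff ℝ ((⊤ : ℕ∞) : WithTop ℕ∞) ψ → HasCompactSupport ψ →
      Integrable (fun x => v x * ψ x) muI := by
    intro ψ hψ hc
    obtain ⟨K, hK⟩ := hψ.continuous.bounded_above_of_compact_support hc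
    exact (integrable_L2 v).mul_bdd hψ.continuous.aestronglyMeasurable
      (Filter.Eventually.of_forall hK)
  refine ⟨∫ x, v x * χ x ∂muI, ?_⟩
  have := ae_eq_of_forall_integral_mul_eq_zero
    ((integrable_L2 v).sub (integrable_const (∫ x, v x * χ x ∂muI))) (fun ψ hψ hc hs => by
      set m := ∫ x in (0 : ℝ)..1, ψ x with hm
      have hθs : tsupport (ψ - m • χ) ⊆ Ioo (0 : ℝ) 1 :=
        (tsupport_sub _ _).trans (union_subset hs ((tsupport_smul_subset_right (fun _ => m) χ).trans
          hχs))
      have hχmc : HasCompactSupport (m • χ) := hχc.smul_left (f := fun _ => m)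
      obtain ⟨φ, hφ, hφc, hφs, hφd⟩ := exists_test_primitive (θ := ψ - m • χ)
        (hψ.sub (hχ.const_smul m)) (hc.sub hχmc) hθs (by
          simp only [Pi.sub_apply, Pi.smul_apply, smul_eq_mul]
          rw [intervalIntegral.integral_sub (hψ.continuous.intervalIntegrable _ _)
            ((hχ.continuous.intervalIntegrable _ _).const_mul m),
            intervalIntegral.integral_const_mul, hχ1, ← hm]
          ring)
      have h1 := hv φ hφ hφc hφs
      rw [hφd] at h1
      have e1 : ∫ x, v x * (ψ - m • χ) x ∂muI =
          (∫ x, v x * ψ x ∂muI) - m * ∫ x, v x * χ x ∂muI := by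
        rw [← integral_const_mul, ← integral_sub (hi hψ hc) ((hi hχ hχc).const_mul m)]
        congr 1; funext x
        simp only [Pi.sub_apply, Pi.smul_apply, smul_eq_mul]; ring
      have e2 : ∫ x, ((v : ℝ → ℝ) - (fun _ => ∫ x, v x * χ x ∂muI : ℝ → ℝ)) x * ψ x ∂muI =
          (∫ x, v x * ψ x ∂muI) - (∫ x, v x * χ x ∂muI) * m := by
        simp only [Pi.sub_apply, sub_mul]
        have hψi : Integrable ψ muI :=
          (hψ.continuous.integrable_of_hasCompactSupport hc).integrableOn
        rw [integral_sub (hi hψ hc) (hψi.const_mul _), integral_const_mul, integral_muI ψ]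
      rw [e2]
      linarith)
  filter_upwards [this] with x hx
  simpa [sub_eq_zero] using hx

/-- Functions with a square integrable weak derivative are primitives. -/
theorem HasWeakDeriv.exists_eq_toL2_J {v w : L2I} (h : HasWeakDeriv v w) :
    ∃ c : ℝ, v = toL2 ℝ (J ℝ (c, w)) := by
  have h0 : HasWeakDeriv (v - toL2 ℝ (J ℝ (0, w))) 0 := by
    intro φ hφ hc hs
    have hφ1 : ContDiff ℝ 1 φ := hφ.of_le (by exact_mod_cast le_top)
    have hcd := hφ1.continuous_deriv le_rfl
    obtain ⟨K, hK⟩ := hcd.bounded_above_of_compact_support hc.deriv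
    have hi : ∀ w : L2I, Integrable (fun x => w x * deriv φ x) muI := fun w =>
      (integrable_L2 w).mul_bdd hcd.aestronglyMeasurable (Filter.Eventually.of_forall hK)
    have e : ∫ x, (v - toL2 ℝ (J ℝ (0, w)) : L2I) x * deriv φ x ∂muI =
        ∫ x, (v x * deriv φ x - toL2 ℝ (J ℝ (0, w)) x * deriv φ x) ∂muI := by
      refine integral_congr_ae ?_
      filter_upwards [Lp.coeFn_sub v (toL2 ℝ (J ℝ (0, w)))] with x hx
      rw [hx, Pi.sub_apply, sub_mul]
    have e0 : ∫ x, (0 : L2I) x * φ x ∂muI = 0 := by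
      rw [integral_congr_ae (g := fun _ => (0 : ℝ)), integral_zero]
      filter_upwards [Lp.coeFn_zero ℝ 2 muI] with x hx
      rw [hx]; simp
    rw [e, e0, integral_sub (hi _) (hi _), h φ hφ hc hs,
      hasWeakDeriv_toL2_J (0, w) φ hφ hc hs]
    simp
  obtain ⟨c, hc⟩ := ae_eq_const_of_hasWeakDeriv_zero h0
  refine ⟨c, Lp.ext ?_⟩
  filter_upwards [hc, Lp.coeFn_sub v (toL2 ℝ (J ℝ (0, w))), coeFn_toL2 (J ℝ (0, w)),
    coeFn_toL2 (J ℝ (c, w)), ae_restrict_mem measurableSet_Icc] with x h1 h2 h3 h4 hx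
  rw [h2, Pi.sub_apply, h3, ext_J _ hx] at h1
  rw [h4, ext_J _ hx]
  simp only at h1 ⊢
  linarith

/-! ### Abstract parabolic equations in Hilbert space -/

/-- The symbol `r⁻ᵏ exp (-t / r)`, extended by zero to `r ≤ 0`. -/
def heatSymbol (k : ℕ) (t r : ℝ) : ℝ := r⁻¹ ^ k * expNegInvGlue (r / t)

theorem heatSymbol_of_pos (k : ℕ) {t r : ℝ} (ht : 0 < t) (hr : 0 < r) :
    heatSymbol k t r = r⁻¹ ^ k * Real.exp (-(t * r⁻¹)) := by
  rw [heatSymbol, expNegInvGlue, if_neg (not_le.2 (div_pos hr ht)), inv_div, div_eq_mul_inv]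

theorem heatSymbol_zero_right (k : ℕ) (t : ℝ) : heatSymbol k t 0 = 0 := by
  simp [heatSymbol, expNegInvGlue]

/-- A negative power of $r$ times $e^{-t/r}$ tends to $0$ as $r\to0^+$. Continuity at $r=0$ matters
because $0$ may lie in the spectrum of $R$. -/
theorem continuous_heatSymbol (k : ℕ) {t : ℝ} (ht : 0 < t) : Continuous (heatSymbol k t) := by
  have h := ((expNegInvGlue.continuous_polynomial_eval_inv_mul (Polynomial.X ^ k)).comp
    (continuous_id.div_const t)).const_mul (t⁻¹ ^ k)
  refine h.congr fun r => ?_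
  simp only [Function.comp_apply, Polynomial.eval_pow, Polynomial.eval_X, heatSymbol, id]
  rw [← mul_assoc, ← mul_pow]
  congr 2
  field_simp

theorem mul_heatSymbol_succ (k : ℕ) (t r : ℝ) :
    r * heatSymbol (k + 1) t r = heatSymbol k t r := by
  rcases eq_or_ne r 0 with rfl | hr
  · simp [heatSymbol_zero_right]
  · rw [heatSymbol, heatSymbol, pow_succ]; field_simp

/-- With $q=1/r$ this is the second order Taylor remainder of $e^{-\tau q}$. It costs $q^2$,
absorbed by raising the index by two, and $e^{|\tau|q}\le e^{sq/2}$, absorbed by half of the decay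
$e^{-sq}$. The bound is uniform in $r$ once the symbol on the right is bounded. -/
theorem heatSymbol_taylor (k : ℕ) {s τ r : ℝ} (hs : 0 < s) (hτ : |τ| ≤ s / 2) (hr : 0 ≤ r) :
    |heatSymbol k (s + τ) r - heatSymbol k s r + τ * heatSymbol (k + 1) s r| ≤
      τ ^ 2 * heatSymbol (k + 2) (s / 2) r := by
  rcases hr.eq_or_lt with rfl | hr
  · simp [heatSymbol_zero_right]
  have hsτ : 0 < s + τ := by have := (abs_le.1 hτ).1; linarith
  rw [heatSymbol_of_pos k hsτ hr, heatSymbol_of_pos k hs hr, heatSymbol_of_pos _ hs hr,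
    heatSymbol_of_pos _ (half_pos hs) hr]
  set q := r⁻¹
  have hq : 0 < q := inv_pos.2 hr
  have h1 : |Real.exp (-(τ * q)) - 1 + τ * q| ≤ (τ * q) ^ 2 * Real.exp (s / 2 * q) := by
    have := Complex.norm_exp_sub_sum_le_norm_mul_exp ((-(τ * q) : ℝ) : ℂ) 2
    rw [Finset.sum_range_succ, Finset.sum_range_one] at this
    have e : Complex.exp ((-(τ * q) : ℝ) : ℂ) - (((-(τ * q) : ℝ) : ℂ) ^ 0 / (Nat.factorial 0 : ℂ) +
        ((-(τ * q) : ℝ) : ℂ) ^ 1 / (Nat.factorial 1 : ℂ)) =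
        ((Real.exp (-(τ * q)) - 1 + τ * q : ℝ) : ℂ) := by
      push_cast; simp; ring
    rw [e, Complex.norm_real, Complex.norm_real, Real.norm_eq_abs, Real.norm_eq_abs, abs_neg,
      sq_abs] at this
    refine this.trans (mul_le_mul_of_nonneg_left (Real.exp_le_exp.2 ?_) (sq_nonneg _))
    rw [abs_mul, abs_of_pos hq]
    exact mul_le_mul_of_nonneg_right hτ hq.le
  have e1 : Real.exp (-((s + τ) * q)) = Real.exp (-(s * q)) * Real.exp (-(τ * q)) := by
    rw [← Real.exp_add]; ring_nf
  have e2 : Real.exp (-(s / 2 * q)) = Real.exp (-(s * q)) * Real.exp (s / 2 * q) := by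
    rw [← Real.exp_add]; ring_nf
  rw [e1, e2]
  have e3 : q ^ k * (Real.exp (-(s * q)) * Real.exp (-(τ * q))) - q ^ k * Real.exp (-(s * q)) +
      τ * (q ^ (k + 1) * Real.exp (-(s * q))) =
      (q ^ k * Real.exp (-(s * q))) * (Real.exp (-(τ * q)) - 1 + τ * q) := by ring
  rw [e3, abs_mul, abs_of_pos (by positivity)]
  calc _ ≤ (q ^ k * Real.exp (-(s * q))) * ((τ * q) ^ 2 * Real.exp (s / 2 * q)) :=
        mul_le_mul_of_nonneg_left h1 (by positivity)
    _ = _ := by ring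

/-- From $1-e^{-x}\le x$ at $x=t/r$. The factor $r$ makes the rate uniform, which controls the
semigroup at time zero on the range of $R$. -/
theorem abs_heatSymbol_sub_one_mul_le {t r : ℝ} (ht : 0 < t) (hr : 0 ≤ r) :
    |heatSymbol 0 t r * r - r| ≤ t := by
  rcases hr.eq_or_lt with rfl | hr
  · simpa using ht.le
  rw [heatSymbol_of_pos _ ht hr]
  have h1 : Real.exp (-(t * r⁻¹)) ≤ 1 := Real.exp_le_one_iff.2 (by
    have := mul_pos ht (inv_pos.2 hr); linarith)
  have h2 := Real.add_one_le_exp (-(t * r⁻¹))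
  have e : r⁻¹ ^ 0 * Real.exp (-(t * r⁻¹)) * r - r = -(r * (1 - Real.exp (-(t * r⁻¹)))) := by ring
  rw [e, abs_neg, abs_of_nonneg (mul_nonneg hr.le (by linarith))]
  calc r * (1 - Real.exp (-(t * r⁻¹))) ≤ r * (t * r⁻¹) :=
        mul_le_mul_of_nonneg_left (by linarith) hr.le
    _ = t := by field_simp

theorem abs_heatSymbol_zero_le_one {t r : ℝ} (ht : 0 < t) (hr : 0 ≤ r) :
    |heatSymbol 0 t r| ≤ 1 := by
  rcases hr.eq_or_lt with rfl | hr
  · simp [heatSymbol_zero_right]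
  rw [heatSymbol_of_pos _ ht hr, pow_zero, one_mul, Real.abs_exp]
  exact Real.exp_le_one_iff.2 (by have := mul_pos ht (inv_pos.2 hr); linarith)

theorem hasDerivAt_clm_comp {E F : Type*} [NormedAddCommGroup E] [NormedSpace ℂ E]
    [NormedAddCommGroup F] [NormedSpace ℂ F] (L : E →L[ℂ] F) {u : ℝ → E} {u' : E} {t : ℝ}
    (h : HasDerivAt u u' t) : HasDerivAt (fun s => L (u s)) (L u') t :=
  (L.restrictScalars ℝ).hasFDerivAt.comp_hasDerivAt t h

/-! ### The semigroup generated by the inverse of a bounded nonnegative operator -/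

section Hilbert

variable {X : Type*} [NormedAddCommGroup X] [InnerProductSpace ℂ X] [CompleteSpace X]

/-- The operator `Aᵏ exp (-t A)`, where `A = R⁻¹`. -/
def heatOp (R : X →L[ℂ] X) (k : ℕ) (t : ℝ) : X →L[ℂ] X := cfc (heatSymbol k t) R

variable {R : X →L[ℂ] X}

theorem mul_heatOp_succ (hR : 0 ≤ R) (k : ℕ) {t : ℝ} (ht : 0 < t) :
    R * heatOp R (k + 1) t = heatOp R k t := by
  have hs : IsSelfAdjoint R := hR.isSelfAdjoint
  have h1 := cfc_mul (fun r : ℝ => r) (heatSymbol (k + 1) t) R continuousOn_id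
    (continuous_heatSymbol _ ht).continuousOn
  rw [cfc_id' ℝ R] at h1
  rw [heatOp, heatOp, ← h1]
  exact congrArg (cfc · R) (funext fun r => mul_heatSymbol_succ k t r)

/-- The functional calculus is bounded by the supremum over the spectrum, so `heatSymbol_taylor`
gives an $O(\tau^2)$ remainder in operator norm. -/
theorem hasDerivAt_heatOp (hR : 0 ≤ R) (k : ℕ) {s : ℝ} (hs : 0 < s) :
    HasDerivAt (heatOp R k) (-heatOp R (k + 1) s) s := by
  have hsa : IsSelfAdjoint R := hR.isSelfAdjoint
  have hc : IsCompact (spectrum ℝ R) := ContinuousFunctionalCalculus.isCompact_spectrum R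
  obtain ⟨K, hK⟩ := hc.exists_bound_of_continuousOn
    (continuous_heatSymbol (k + 2) (half_pos hs)).continuousOn
  rw [hasDerivAt_iff_isLittleO_nhds_zero]
  have hbig : (fun τ : ℝ => heatOp R k (s + τ) - heatOp R k s - τ • -heatOp R (k + 1) s)
      =O[nhds 0] fun τ : ℝ => τ ^ 2 := by
    refine Asymptotics.IsBigO.of_bound |K| ?_
    have : ∀ᶠ τ : ℝ in nhds 0, |τ| < s / 2 := by
      have := Metric.ball_mem_nhds (0 : ℝ) (half_pos hs)
      filter_upwards [this] with τ hτ
      simpa using hτ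
    filter_upwards [this] with τ hτ
    have hsτ : 0 < s + τ := by have := (abs_le.1 hτ.le).1; linarith
    have c0 := (continuous_heatSymbol k hsτ).continuousOn (s := spectrum ℝ R)
    have c1 := (continuous_heatSymbol k hs).continuousOn (s := spectrum ℝ R)
    have c2 := (continuous_heatSymbol (k + 1) hs).continuousOn (s := spectrum ℝ R)
    have e : heatOp R k (s + τ) - heatOp R k s - τ • -heatOp R (k + 1) s =
        cfc (fun r => heatSymbol k (s + τ) r - heatSymbol k s r +
          τ * heatSymbol (k + 1) s r) R := by
      rw [cfc_add (a := R) (fun r => heatSymbol k (s + τ) r - heatSymbol k s r)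
        (fun r => τ * heatSymbol (k + 1) s r) (c0.sub c1) (continuousOn_const.mul c2),
        cfc_sub _ _ R c0 c1,
        cfc_const_mul _ _ R c2, smul_neg, sub_neg_eq_add]
      rfl
    rw [e]
    refine norm_cfc_le (by positivity) fun r hr => ?_
    have hr0 : 0 ≤ r := spectrum_nonneg_of_nonneg hR hr
    refine (heatSymbol_taylor k hs hτ.le hr0).trans ?_
    rw [norm_pow, Real.norm_eq_abs, sq_abs, mul_comm]
    refine mul_le_mul_of_nonneg_right ?_ (sq_nonneg _)
    exact ((le_abs_self _).trans (hK r hr)).trans (le_abs_self K)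
  refine hbig.trans_isLittleO ?_
  simpa using (Asymptotics.isLittleO_pow_pow (𝕜 := ℝ) (m := 1) (n := 2) (by norm_num))

theorem norm_heatOp_zero_le (hR : 0 ≤ R) {t : ℝ} (ht : 0 < t) : ‖heatOp R 0 t‖ ≤ 1 :=
  norm_cfc_le zero_le_one fun _ hr =>
    abs_heatSymbol_zero_le_one ht (spectrum_nonneg_of_nonneg hR hr)

theorem norm_heatOp_mul_sub_le (hR : 0 ≤ R) {t : ℝ} (ht : 0 < t) :
    ‖heatOp R 0 t * R - R‖ ≤ t := by
  have hsa : IsSelfAdjoint R := hR.isSelfAdjoint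
  have c1 := (continuous_heatSymbol 0 ht).continuousOn (s := spectrum ℝ R)
  have h1 := cfc_mul (heatSymbol 0 t) (fun r : ℝ => r) R c1 continuousOn_id
  have h2 := cfc_sub (fun r => heatSymbol 0 t r * r) (fun r : ℝ => r) R
    (c1.mul continuousOn_id) continuousOn_id
  rw [h1, cfc_id' ℝ R] at h2
  rw [heatOp, ← h2]
  exact norm_cfc_le ht.le fun r hr =>
    abs_heatSymbol_sub_one_mul_le ht (spectrum_nonneg_of_nonneg hR hr)

theorem dense_range_of_injective (hR : 0 ≤ R) (hinj : Function.Injective R) : DenseRange R := by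
  have hsa : IsSelfAdjoint R := hR.isSelfAdjoint
  have h := R.orthogonal_range
  rw [hsa.adjoint_eq, LinearMap.ker_eq_bot.2 hinj] at h
  have := (Submodule.dense_iff_topologicalClosure_eq_top).2
    ((Submodule.topologicalClosure_eq_top_iff).2 h)
  exact this

/-- The operators are contractions and converge at rate $t\|z\|$ on vectors $Rz$, which are dense
because $R$ is self-adjoint and injective. -/
theorem tendsto_heatOp_zero (hR : 0 ≤ R) (hinj : Function.Injective R) (w : X) :
    Filter.Tendsto (fun t => heatOp R 0 t w) (nhdsWithin 0 (Ioi 0)) (nhds w) := by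
  rw [Metric.tendsto_nhds]
  intro ε hε
  obtain ⟨z, hz⟩ := (dense_range_of_injective hR hinj).exists_dist_lt w (ε := ε / 3) (by linarith)
  have h1 : ∀ᶠ t : ℝ in nhdsWithin 0 (Ioi 0), t * ‖z‖ < ε / 3 := by
    have : Filter.Tendsto (fun t : ℝ => t * ‖z‖) (nhdsWithin 0 (Ioi 0)) (nhds (0 * ‖z‖)) :=
      (Filter.Tendsto.mul_const _ Filter.tendsto_id).mono_left nhdsWithin_le_nhds
    exact this.eventually_lt_const (by linarith)
  filter_upwards [h1, self_mem_nhdsWithin] with t ht ht0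
  have ht0 : 0 < t := ht0
  have a1 : dist (heatOp R 0 t w) (heatOp R 0 t (R z)) < ε / 3 := by
    rw [dist_eq_norm, ← map_sub]
    refine ((heatOp R 0 t).le_of_opNorm_le (norm_heatOp_zero_le hR ht0) _).trans_lt ?_
    rwa [one_mul, ← dist_eq_norm]
  have a2 : dist (heatOp R 0 t (R z)) (R z) < ε / 3 := by
    rw [dist_eq_norm]
    exact ((heatOp R 0 t * R - R).le_of_opNorm_le (norm_heatOp_mul_sub_le hR ht0) z).trans_lt ht
  rw [dist_comm] at hz
  have := dist_triangle4 (heatOp R 0 t w) (heatOp R 0 t (R z)) (R z) w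
  linarith

/-- With $A=R^{-1}$ the curves are $e^{-tA}w_0$, $-Ae^{-tA}w_0$ and $A^2e^{-tA}w_0$. The second time
derivative is kept since the Burgers equation needs $f_{xt}$ to be classical. -/
theorem exists_heat_curve (hR : 0 ≤ R) (hinj : Function.Injective R) (w₀ : X) :
    ∃ w w1 w2 : ℝ → X, ContinuousOn w (Ici 0) ∧ w 0 = w₀ ∧ ∀ t, 0 < t →
      HasDerivAt w (w1 t) t ∧ HasDerivAt w1 (w2 t) t ∧ ContinuousAt w2 t ∧
      R (w1 t) = -w t ∧ R (w2 t) = -w1 t := by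
  have hd : ∀ k, ∀ t, 0 < t →
      HasDerivAt (fun s => heatOp R k s w₀) (-heatOp R (k + 1) t w₀) t := fun k t ht =>
    hasDerivAt_clm_comp (ContinuousLinearMap.apply ℂ X w₀) (hasDerivAt_heatOp hR k ht)
  -- At $t=0$ division by zero makes the symbol vanish, so `heatOp R 0 0` is $0$ and not the
  -- identity; the initial value has to be put in by hand.
  have heq : ∀ t, 0 < t → (fun s => if s = 0 then w₀ else heatOp R 0 s w₀) =ᶠ[nhds t]
      fun s => heatOp R 0 s w₀ := fun t ht => by
    filter_upwards [lt_mem_nhds ht] with s hs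
    rw [if_neg hs.ne']
  refine ⟨fun t => if t = 0 then w₀ else heatOp R 0 t w₀, fun t => -heatOp R 1 t w₀,
    fun t => heatOp R 2 t w₀, ?_, if_pos rfl, fun t ht => ⟨?_, ?_, (hd 2 t ht).continuousAt,
    ?_, ?_⟩⟩
  · intro t ht
    rcases (mem_Ici.1 ht).eq_or_lt with rfl | ht
    · have h : Filter.Tendsto (fun t => if t = 0 then w₀ else heatOp R 0 t w₀)
          (nhdsWithin 0 (Ioi 0)) (nhds w₀) := by
        refine (tendsto_heatOp_zero hR hinj w₀).congr' ?_
        filter_upwards [self_mem_nhdsWithin] with t ht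
        rw [if_neg (ne_of_gt ht)]
      rw [← continuousWithinAt_Ioi_iff_Ici]
      rw [ContinuousWithinAt, if_pos rfl]
      exact h
    · exact ((hd 0 t ht).continuousAt.congr (heq t ht).symm).continuousWithinAt
  · exact (hd 0 t ht).congr_of_eventuallyEq (heq t ht)
  · exact (hd 1 t ht).neg.congr_deriv (neg_neg _)
  · simp only
    rw [map_neg, if_neg ht.ne', ← mul_heatOp_succ hR 0 ht]; rfl
  · rw [neg_neg, ← mul_heatOp_succ hR 1 ht]; rfl

/-- Solvability of the abstract parabolic equation `B v' = -Q v`. -/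
theorem exists_parabolic_curve {B Q : X →L[ℂ] X} (hB : 0 ≤ B) (hinj : Function.Injective B)
    (hQ : IsStrictlyPositive Q) (v₀ : X) :
    ∃ v v1 v2 : ℝ → X, ContinuousOn v (Ici 0) ∧ v 0 = v₀ ∧ ∀ t, 0 < t →
      HasDerivAt v (v1 t) t ∧ HasDerivAt v1 (v2 t) t ∧ ContinuousAt v2 t ∧
      B (v1 t) = -Q (v t) ∧ B (v2 t) = -Q (v1 t) := by
  -- The substitution $w=Q^{1/2}v$ turns $Bv'=-Qv$ into $Rw'=-w$ with $R=NBN$, $N=Q^{-1/2}$.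
  set N : X →L[ℂ] X := Q ^ (-(1 / 2) : ℝ) with hN
  set M : X →L[ℂ] X := Q ^ (1 / 2 : ℝ) with hM
  have hNM : N * M = 1 := CFC.rpow_neg_mul_rpow (1 / 2) hQ
  have hMN : M * N = 1 := CFC.rpow_mul_rpow_neg (1 / 2) hQ
  have hNQN : N * Q * N = 1 := CFC.conjugate_rpow_neg_one_half Q hQ
  have hNsa : IsSelfAdjoint N := (CFC.rpow_nonneg (a := Q)).isSelfAdjoint
  have hNinj : Function.Injective N := Function.LeftInverse.injective (g := M) fun x => by
    rw [← mul_apply_eq_comp, hMN]; rfl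
  have hR : 0 ≤ N * B * N := by
    have := star_right_conjugate_nonneg hB N
    rwa [hNsa.star_eq] at this
  have hRinj : Function.Injective (N * B * N) := hNinj.comp (hinj.comp hNinj)
  obtain ⟨w, w1, w2, hc, h0, hw⟩ := exists_heat_curve hR hRinj (M v₀)
  have hrel : ∀ x y, (N * B * N) x = -y → B (N x) = -Q (N y) := fun x y h => by
    apply hNinj
    have h2 : N (Q (N y)) = y := by
      have := congrArg (fun T : X →L[ℂ] X => T y) hNQN
      simpa using this
    rw [map_neg, h2]
    exact h
  refine ⟨fun t => N (w t), fun t => N (w1 t), fun t => N (w2 t),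
    N.continuous.comp_continuousOn hc, ?_, fun t ht => ?_⟩
  · simp only [h0]
    rw [← mul_apply_eq_comp, hNM]; rfl
  · obtain ⟨d1, d2, c2, e1, e2⟩ := hw t ht
    have key : ∀ {u : ℝ → X} {u'}, HasDerivAt u u' t → HasDerivAt (fun s => N (u s)) (N u') t :=
      fun h =>
        hasDerivAt_clm_comp N h
    exact ⟨key d1, key d2, N.continuous.continuousAt.comp c2, hrel _ _ e1, hrel _ _ e2⟩

end Hilbert

/-! ### The weak Neumann problem -/

section generic

variable {𝕜 : Type*} [RCLike 𝕜]

theorem toL2_injective : Function.Injective (toL2 𝕜) := by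
  refine (injective_iff_map_eq_zero _).2 fun a ha => ?_
  have h : ext a =ᵐ[muI] fun _ => 0 := by
    filter_upwards [coeFn_toL2 a, Lp.coeFn_zero 𝕜 2 muI] with x h1 h2
    rw [← h1, ha, h2]; rfl
  have h' := MeasureTheory.Measure.eqOn_Icc_of_ae_eq volume zero_ne_one h
    (continuous_ext a).continuousOn continuousOn_const
  ext x
  rw [← ext_of_mem a x.2]
  exact h' x.2

/-- Evaluation at $0$ kills the constant, and Lebesgue differentiation then kills the density. -/
theorem J_injective : Function.Injective (J 𝕜) := by
  refine (injective_iff_map_eq_zero _).2 fun p hp => ?_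
  have h : ∀ x ∈ Icc (0 : ℝ) 1, p.1 + ∫ s in (0 : ℝ)..x, p.2 s = 0 := fun x hx => by
    rw [← J_apply p ⟨x, hx⟩, hp]; rfl
  have h1 : p.1 = 0 := by simpa using h 0 (by simp)
  have h2 : p.2 = 0 := by
    refine Lp.ext ?_
    have ha := (intervalIntegrable_L2 p.2 (a := 0) (b := 1) (by simp) (by simp)).ae_hasDerivAt_integral
    have hb : ∀ᵐ x : ℝ ∂muI, x ∈ Ioo (0 : ℝ) 1 := by
      rw [muI, ← restrict_Ioo_eq_restrict_Icc]
      exact ae_restrict_mem measurableSet_Ioo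
    filter_upwards [ae_restrict_of_ae ha, hb, Lp.coeFn_zero 𝕜 2 muI] with x hx h1x h0
    rw [h0]
    have hd := hx (by rw [uIcc_of_le zero_le_one]; exact Ioo_subset_Icc_self h1x) 0 (by simp)
    refine hd.unique ((hasDerivAt_const x (0 : 𝕜)).congr_of_eventuallyEq ?_)
    filter_upwards [Icc_mem_nhds h1x.1 h1x.2] with y hy
    simpa [h1] using h y hy
  exact Prod.ext h1 h2

theorem mulL2_mulL2 (a b : CI 𝕜) (g : L2 𝕜) : mulL2 𝕜 a (mulL2 𝕜 b g) = mulL2 𝕜 (a * b) g := by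
  refine Lp.ext ?_
  filter_upwards [coeFn_mulL2 a (mulL2 𝕜 b g), coeFn_mulL2 b g, coeFn_mulL2 (a * b) g]
    with x h1 h2 h3
  rw [h1, h2, h3, ← mul_assoc]; rfl

theorem mulL2_one (g : L2 𝕜) : mulL2 𝕜 1 g = g := by
  refine Lp.ext ?_
  filter_upwards [coeFn_mulL2 1 g] with x h1
  rw [h1]; exact one_mul _

theorem norm_const_L2 (c : 𝕜) : ‖Lp.const 2 muI c‖ = ‖c‖ := by
  have hp : IsProbabilityMeasure muI := ⟨by simp [muI]⟩
  have := Lp.norm_const (E := 𝕜) (p := 2) (μ := muI) (c := c) (by simp)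
  rw [this]
  simp

theorem norm_toL2_le (a : CI 𝕜) : ‖toL2 𝕜 a‖ ≤ ‖a‖ := by
  refine (norm_mulL2_le a _).trans ?_
  rw [norm_const_L2, norm_one, mul_one]

theorem norm_toL2_const (c : 𝕜) : ‖toL2 𝕜 (ContinuousMap.const _ c)‖ = ‖c‖ := by
  have : toL2 𝕜 (ContinuousMap.const _ c) = Lp.const 2 muI c := by
    refine Lp.ext ?_
    filter_upwards [coeFn_toL2 (ContinuousMap.const (Icc (0 : ℝ) 1) c),
      Lp.coeFn_const (p := 2) (μ := muI) c] with x h1 h2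
    rw [h1, h2]; rfl
  rw [this, norm_const_L2]

theorem norm_prim_le (g : L2 𝕜) : ‖prim 𝕜 g‖ ≤ ‖g‖ :=
  ((prim 𝕜).le_of_opNorm_le (LinearMap.mkContinuous_norm_le _ zero_le_one _) g).trans_eq
    (one_mul _)

/-- The constant is the function minus the primitive of its derivative. This recovers the full norm
of a pair from the $L^2$ norms of $f$ and $f'$, hence the coercivity of the form. -/
theorem norm_fst_le (p : 𝕜 × L2 𝕜) : ‖p.1‖ ≤ ‖toL2 𝕜 (J 𝕜 p)‖ + ‖p.2‖ := by
  have e : ContinuousMap.const (Icc (0 : ℝ) 1) p.1 = J 𝕜 p - prim 𝕜 p.2 := by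
    ext x
    simp [J_apply, prim_apply]
  rw [← norm_toL2_const p.1, e, map_sub]
  exact (norm_sub_le _ _).trans
    (add_le_add le_rfl ((norm_toL2_le _).trans (norm_prim_le _)))

end generic

/-- The pairs `(c, g)`, standing for `c + ∫₀ˣ g`, as a Hilbert space. -/
abbrev Pairs : Type := WithLp 2 (ℂ × L2 ℂ)

/-- The pair underlying an element of `Pairs`. -/
def ofPairs : Pairs →L[ℂ] ℂ × L2 ℂ :=
  (WithLp.prodContinuousLinearEquiv 2 ℂ ℂ (L2 ℂ)).toContinuousLinearMap

/-- The real part of a pair. -/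
def rePairs : Pairs →L[ℝ] ℝ × L2 ℝ :=
  ((Complex.reCLM.comp (ContinuousLinearMap.fst ℝ ℂ (L2 ℂ))).prod
    ((Complex.reCLM.compLpL 2 muI).comp (ContinuousLinearMap.snd ℝ ℂ (L2 ℂ)))).comp
    (ofPairs.restrictScalars ℝ)

/-- A real pair as a complex one. -/
def realPair (p : ℝ × L2 ℝ) : Pairs :=
  WithLp.toLp 2 ((p.1 : ℂ), Complex.ofRealCLM.compLp p.2)

theorem ofPairs_realPair (p : ℝ × L2 ℝ) :
    ofPairs (realPair p) = ((p.1 : ℂ), Complex.ofRealCLM.compLp p.2) := rfl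

theorem rePairs_fst (x : Pairs) : (rePairs x).1 = (ofPairs x).1.re := rfl

theorem coeFn_rePairs_snd (x : Pairs) :
    (rePairs x).2 =ᵐ[muI] fun y => ((ofPairs x).2 y).re :=
  Complex.reCLM.coeFn_compLpL _

theorem coeFn_realPair_snd (p : ℝ × L2 ℝ) :
    (ofPairs (realPair p)).2 =ᵐ[muI] fun y => (p.2 y : ℂ) :=
  Complex.ofRealCLM.coeFn_compLp _

theorem rePairs_realPair (p : ℝ × L2 ℝ) : rePairs (realPair p) = p := by
  refine Prod.ext rfl (Lp.ext ?_)
  filter_upwards [coeFn_rePairs_snd (realPair p), coeFn_realPair_snd p] with x h1 h2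
  rw [h1, h2, Complex.ofReal_re]

theorem intervalIntegral_congr_L2 {E : Type*} [NormedAddCommGroup E] [NormedSpace ℝ E]
    {f g : ℝ → E} (h : f =ᵐ[muI] g) {x : ℝ} (hx : x ∈ Icc (0 : ℝ) 1) :
    ∫ s in (0 : ℝ)..x, f s = ∫ s in (0 : ℝ)..x, g s :=
  intervalIntegral.integral_congr_ae_restrict (ae_restrict_of_ae_restrict_of_subset
    (uIoc_subset_uIcc.trans (uIcc_subset_Icc (by simp) hx)) h)

theorem re_ext_J (x : Pairs) {y : ℝ} (hy : y ∈ Icc (0 : ℝ) 1) :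
    (ext (J ℂ (ofPairs x)) y).re = ext (J ℝ (rePairs x)) y := by
  rw [ext_J _ hy, ext_J _ hy, Complex.add_re, rePairs_fst,
    intervalIntegral_congr_L2 (coeFn_rePairs_snd x) hy]
  congr 1
  have := Complex.reCLM.intervalIntegral_comp_comm
    (intervalIntegrable_L2 (ofPairs x).2 (a := 0) (by simp) hy)
  exact this.symm

theorem ext_J_realPair (p : ℝ × L2 ℝ) {y : ℝ} (hy : y ∈ Icc (0 : ℝ) 1) :
    ext (J ℂ (ofPairs (realPair p))) y = ((ext (J ℝ p) y : ℝ) : ℂ) := by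
  rw [ext_J _ hy, ext_J _ hy, intervalIntegral_congr_L2 (coeFn_realPair_snd p) hy,
    intervalIntegral.integral_ofReal]
  simp [ofPairs_realPair]

theorem re_inner_eq {f g : L2 ℂ} {φ γ : ℝ → ℝ} (hf : f =ᵐ[muI] fun y => (φ y : ℂ))
    (hg : ∀ᵐ y ∂muI, (g y).re = γ y) : (inner ℂ f g).re = ∫ y, φ y * γ y ∂muI := by
  rw [L2.inner_def]
  have h := integral_re (𝕜 := ℂ) (L2.integrable_inner (𝕜 := ℂ) f g)
  refine Eq.trans h.symm (integral_congr_ae ?_)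
  filter_upwards [hf, hg] with y h1 h2
  rw [h1, ← h2]
  simp [mul_comm]

/-- A real continuous function as a complex one. -/
def ofRealCI (m : CI ℝ) : CI ℂ := ⟨fun x => (m x : ℂ), Complex.continuous_ofReal.comp m.continuous⟩

/-- Multiplication of the function represented by a pair with a real continuous function. -/
def mulPairs (m : CI ℝ) : Pairs →L[ℂ] L2 ℂ :=
  (mulL2 ℂ (ofRealCI m)).comp ((toL2 ℂ).comp ((J ℂ).comp ofPairs))

theorem coeFn_mulPairs (m : CI ℝ) (x : Pairs) :
    mulPairs m x =ᵐ[muI] fun y => ((ext m y : ℝ) : ℂ) * ext (J ℂ (ofPairs x)) y := by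
  filter_upwards [coeFn_mulL2 (ofRealCI m)
    (toL2 ℂ (J ℂ (ofPairs x))), coeFn_toL2 (J ℂ (ofPairs x))] with y h1 h2
  change (mulL2 ℂ _ (toL2 ℂ (J ℂ (ofPairs x)))) y = _
  rw [h1, h2]; rfl

theorem re_inner_mulPairs (m : CI ℝ) (φ : ℝ × L2 ℝ) (x : Pairs) :
    (inner ℂ (mulPairs m (realPair φ)) (mulPairs m x)).re =
      ∫ y, ext (J ℝ φ) y * (ext m y ^ 2 * ext (J ℝ (rePairs x)) y) ∂muI := by
  have h1 : mulPairs m (realPair φ) =ᵐ[muI] fun y => ((ext m y * ext (J ℝ φ) y : ℝ) : ℂ) := by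
    filter_upwards [coeFn_mulPairs m (realPair φ), ae_restrict_mem measurableSet_Icc] with y h hy
    rw [h, ext_J_realPair φ hy, Complex.ofReal_mul]
  have h2 : ∀ᵐ y ∂muI, (mulPairs m x y).re = ext m y * ext (J ℝ (rePairs x)) y := by
    filter_upwards [coeFn_mulPairs m x, ae_restrict_mem measurableSet_Icc] with y h hy
    rw [h, Complex.re_ofReal_mul, re_ext_J x hy]
  rw [re_inner_eq h1 h2]
  congr 1; funext y; ring

/-- The gram operator of `mulPairs m`. -/
def gramPairs (m : CI ℝ) : Pairs →L[ℂ] Pairs := (mulPairs m).adjoint ∘L mulPairs m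

/-- The derivative of the function represented by a pair. -/
def sndPairs : Pairs →L[ℂ] L2 ℂ := (ContinuousLinearMap.snd ℂ ℂ (L2 ℂ)).comp ofPairs

/-- The operator of the form `∫ f' g' + ∫ m² f g`. -/
def formPairs (m : CI ℝ) : Pairs →L[ℂ] Pairs :=
  sndPairs.adjoint ∘L sndPairs + gramPairs m

theorem gramPairs_nonneg (m : CI ℝ) : 0 ≤ gramPairs m :=
  (ContinuousLinearMap.nonneg_iff_isPositive _).2
    (ContinuousLinearMap.isPositive_adjoint_comp_self _)

theorem inner_formPairs (m : CI ℝ) (x y : Pairs) :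
    inner ℂ x (formPairs m y) = inner ℂ (sndPairs x) (sndPairs y) +
      inner ℂ (mulPairs m x) (mulPairs m y) := by
  simp [formPairs, gramPairs, ContinuousLinearMap.adjoint_inner_right]

theorem inner_gramPairs (m : CI ℝ) (x y : Pairs) :
    inner ℂ x (gramPairs m y) = inner ℂ (mulPairs m x) (mulPairs m y) := by
  simp [gramPairs, ContinuousLinearMap.adjoint_inner_right]

/-- The quadratic form of the operator is $\|f\|_{L^2}^2$, and a pair is determined by its function.
-/
theorem gramPairs_one_injective : Function.Injective (gramPairs 1) := by
  refine (injective_iff_map_eq_zero _).2 fun x hx => ?_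
  have h := inner_gramPairs 1 x x
  rw [hx, inner_zero_right, eq_comm, inner_self_eq_zero] at h
  have h1 : ofRealCI 1 = (1 : CI ℂ) := by
    ext; simp [ofRealCI]
  simp only [mulPairs, h1, ContinuousLinearMap.comp_apply, mulL2_one] at h
  have h2 := toL2_injective (h.trans (map_zero _).symm)
  have h3 : ofPairs x = 0 := J_injective (h2.trans (map_zero _).symm)
  exact (WithLp.prodContinuousLinearEquiv 2 ℂ ℂ (L2 ℂ)).injective (h3.trans (map_zero _).symm)

theorem norm_sq_pairs (x : Pairs) : ‖x‖ ^ 2 = ‖(ofPairs x).1‖ ^ 2 + ‖(ofPairs x).2‖ ^ 2 :=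
  WithLp.prod_norm_sq_eq_of_L2 x

/-- A coercive operator is invertible (Lax–Milgram), and an invertible nonnegative operator is
strictly positive. -/
theorem isStrictlyPositive_formPairs {m : CI ℝ} (hm : ∀ x, 0 < m x) :
    IsStrictlyPositive (formPairs m) := by
  have hnn : 0 ≤ formPairs m := add_nonneg ((ContinuousLinearMap.nonneg_iff_isPositive _).2
    (ContinuousLinearMap.isPositive_adjoint_comp_self _)) (gramPairs_nonneg m)
  refine IsUnit.isStrictlyPositive ?_ hnn
  let n : CI ℂ := ⟨fun x => ((m x)⁻¹ : ℝ), Complex.continuous_ofReal.comp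
    (m.continuous.inv₀ fun x => (hm x).ne')⟩
  have hn : n * ofRealCI m = 1 := by
    ext x
    have := (hm x).ne'
    simp [n, ofRealCI, this]
  -- Writing $n=1/m$, $M=\|mf\|$ and $g=\|f'\|$, the constant obeys
  -- $c^2\le(\|n\|M+g)^2\le2\|n\|^2M^2+2g^2$. Adding $g^2$ gives $c^2+g^2\le(2\|n\|^2+3)(g^2+M^2)$.
  have hK : 0 < 2 * ‖n‖ ^ 2 + 3 := by positivity
  refine ContinuousLinearMap.isUnit_of_forall_le_norm_inner_map _
    (c := ⟨(2 * ‖n‖ ^ 2 + 3)⁻¹, by positivity⟩) (NNReal.coe_pos.1 (inv_pos.2 hK)) fun x => ?_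
  have h1 : toL2 ℂ (J ℂ (ofPairs x)) = mulL2 ℂ n (mulPairs m x) := by
    simp only [mulPairs, ContinuousLinearMap.comp_apply, mulL2_mulL2, hn, mulL2_one]
  have h2 := norm_fst_le (ofPairs x)
  rw [h1] at h2
  have h3 := norm_mulL2_le n (mulPairs m x)
  have h4 : ‖inner ℂ (formPairs m x) x‖ = ‖sndPairs x‖ ^ 2 + ‖mulPairs m x‖ ^ 2 := by
    rw [norm_inner_symm, inner_formPairs, inner_self_eq_norm_sq_to_K, inner_self_eq_norm_sq_to_K]
    simp only [Complex.coe_algebraMap]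
    rw [← Complex.ofReal_pow, ← Complex.ofReal_pow, ← Complex.ofReal_add, Complex.norm_real,
      Real.norm_of_nonneg (by positivity)]
  have h5 : ‖sndPairs x‖ = ‖(ofPairs x).2‖ := rfl
  rw [h4, norm_sq_pairs, h5]
  change _ * (2 * ‖n‖ ^ 2 + 3)⁻¹ ≤ _
  rw [← div_eq_mul_inv, div_le_iff₀ hK]
  set c := ‖(ofPairs x).1‖
  set g := ‖(ofPairs x).2‖
  set M := ‖mulPairs m x‖
  have h6 : c ≤ ‖n‖ * M + g := h2.trans (by linarith)
  have h7 : c ^ 2 ≤ (‖n‖ * M + g) ^ 2 := pow_le_pow_left₀ (norm_nonneg _) h6 2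
  nlinarith [sq_nonneg (‖n‖ * M - g), sq_nonneg (‖n‖ * g), sq_nonneg M]

/-- `-∂ₓₓ f + V f = -f₁` in the weak sense, with Neumann boundary conditions, for the functions
represented by `p` and `p₁`. -/
def WeakNeumann (V : ℝ → ℝ) (p p₁ : ℝ × L2 ℝ) : Prop :=
  ∀ φ : ℝ × L2 ℝ, ∫ y, ext (J ℝ φ) y * ext (J ℝ p₁) y ∂muI =
    -(∫ y, φ.2 y * p.2 y ∂muI + ∫ y, ext (J ℝ φ) y * (V y * ext (J ℝ p) y) ∂muI)

/-- The abstract equation with $B$ the $L^2$ Gram operator and $Q$ the form with weight $m=\sqrt V$.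
Pairing with a real test pair and taking real parts returns from the complex Hilbert space, where
the functional calculus lives, to real functions. -/
theorem exists_weak_heat_curve {V : ℝ → ℝ} (hV : ContinuousOn V (Icc 0 1))
    (hpos : ∀ x ∈ Icc (0 : ℝ) 1, 0 < V x) (p₀ : ℝ × L2 ℝ) :
    ∃ p p1 p2 : ℝ → ℝ × L2 ℝ, ContinuousOn p (Ici 0) ∧ p 0 = p₀ ∧ ∀ t, 0 < t →
      HasDerivAt p (p1 t) t ∧ HasDerivAt p1 (p2 t) t ∧ ContinuousAt p2 t ∧
      WeakNeumann V (p t) (p1 t) ∧ WeakNeumann V (p1 t) (p2 t) := by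
  let m : CI ℝ := ⟨fun x => Real.sqrt (V x), Real.continuous_sqrt.comp
    (continuousOn_iff_continuous_domRestrict.1 hV)⟩
  have hm : ∀ x, 0 < m x := fun x => Real.sqrt_pos.2 (hpos x x.2)
  have hm2 : ∀ y ∈ Icc (0 : ℝ) 1, ext m y ^ 2 = V y := fun y hy => by
    rw [ext_of_mem m hy]; exact Real.sq_sqrt (hpos y hy).le
  have hone : ∀ y, ext (1 : CI ℝ) y = 1 := fun y => rfl
  obtain ⟨v, v1, v2, hc, h0, hv⟩ := exists_parabolic_curve (gramPairs_nonneg 1)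
    gramPairs_one_injective (isStrictlyPositive_formPairs hm) (realPair p₀)
  have hweak : ∀ x x1 : Pairs, gramPairs 1 x1 = -formPairs m x →
      WeakNeumann V (rePairs x) (rePairs x1) := by
    intro x x1 h φ
    have h1 := congrArg (fun z => (inner ℂ (realPair φ) z).re) h
    simp only [inner_neg_right, inner_formPairs, inner_gramPairs, Complex.neg_re,
      Complex.add_re, re_inner_mulPairs, hone, one_pow, one_mul] at h1
    rw [h1, show sndPairs (realPair φ) = (ofPairs (realPair φ)).2 from rfl,
      show sndPairs x = (ofPairs x).2 from rfl, re_inner_eq (coeFn_realPair_snd φ) (Filter.EventuallyEq.symm (coeFn_rePairs_snd x))]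
    congr 2
    refine integral_congr_ae (ae_muI_of_forall fun y hy => ?_)
    simp only [hm2 y hy]
  refine ⟨fun t => rePairs (v t), fun t => rePairs (v1 t), fun t => rePairs (v2 t),
    rePairs.continuous.comp_continuousOn hc, ?_, fun t ht => ?_⟩
  · simp only [h0, rePairs_realPair]
  · obtain ⟨d1, d2, c2, e1, e2⟩ := hv t ht
    exact ⟨rePairs.hasFDerivAt.comp_hasDerivAt t d1, rePairs.hasFDerivAt.comp_hasDerivAt t d2,
      rePairs.continuous.continuousAt.comp c2, hweak _ _ e1, hweak _ _ e2⟩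

/-- Regularity for the weak Neumann problem: the derivative is `∫₀ˣ (f₁ + V f)`, and it vanishes
at the end points. -/
theorem WeakNeumann.regularity {V : ℝ → ℝ} (hV : ContinuousOn V (Icc 0 1)) {p p₁ : ℝ × L2 ℝ}
    (h : WeakNeumann V p p₁) :
    ∫ s in (0 : ℝ)..1, (ext (J ℝ p₁) s + V s * ext (J ℝ p) s) = 0 ∧
    p.2 =ᵐ[muI] fun x => ∫ s in (0 : ℝ)..x, (ext (J ℝ p₁) s + V s * ext (J ℝ p) s) := by
  set q : ℝ → ℝ := fun s => ext (J ℝ p₁) s + V s * ext (J ℝ p) s with hq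
  have hqc : ContinuousOn q (Icc 0 1) :=
    (continuous_ext _).continuousOn.add (hV.mul (continuous_ext _).continuousOn)
  have hqi : ∀ x ∈ Icc (0 : ℝ) 1, IntervalIntegrable q volume 0 x := fun x hx =>
    (hqc.mono (Icc_subset_Icc_right hx.2)).intervalIntegrable_of_Icc hx.1
  set F : ℝ → ℝ := fun x => ∫ s in (0 : ℝ)..x, q s with hF
  have hFc : ContinuousOn F (Icc 0 1) := by
    have := intervalIntegral.continuousOn_primitive_interval (μ := volume) (f := q)
      (a := 0) (b := 1) (by rw [uIcc_of_le zero_le_one]; exact hqc.integrableOn_Icc)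
    rwa [uIcc_of_le zero_le_one] at this
  have hFd : ∀ x ∈ Ioo (0 : ℝ) 1, HasDerivAt F (q x) x := fun x hx =>
    intervalIntegral.integral_hasDerivAt_right (hqi x (Ioo_subset_Icc_self hx))
      ((hqc.mono Ioo_subset_Icc_self).stronglyMeasurableAtFilter isOpen_Ioo x hx)
      ((hqc.continuousAt (Icc_mem_nhds hx.1 hx.2)))
  -- Integrating $\int\varphi\,(f_1+Vf)$ by parts against its primitive `F` leaves only $\varphi'$
  -- and the boundary term at $1$.
  have key : ∀ φ : ℝ × L2 ℝ, (φ.1 + ∫ s in (0 : ℝ)..1, φ.2 s) * F 1 -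
      ∫ x in (0 : ℝ)..1, φ.2 x * F x = - ∫ y, φ.2 y * p.2 y ∂muI := by
    intro φ
    have h1 := integral_primitive_mul_deriv φ.1 φ.2 hFc hqc hFd
    have hF0 : F 0 = 0 := by simp [hF]
    rw [hF0, mul_zero, sub_zero] at h1
    rw [← h1, ← integral_muI]
    have h2 : ∫ x, (φ.1 + ∫ s in (0 : ℝ)..x, φ.2 s) * q x ∂muI =
        ∫ y, ext (J ℝ φ) y * ext (J ℝ p₁) y ∂muI +
          ∫ y, ext (J ℝ φ) y * (V y * ext (J ℝ p) y) ∂muI := by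
      rw [← integral_add]
      · refine integral_congr_ae (ae_muI_of_forall fun y hy => ?_)
        simp only [hq, ext_J φ hy]; ring
      · exact ((continuous_ext _).mul (continuous_ext _)).continuousOn.integrableOn_Icc
      · exact ((continuous_ext _).continuousOn.mul
          (hV.mul (continuous_ext _).continuousOn)).integrableOn_Icc
    rw [h2, h φ]; ring
  -- Test functions are not required to vanish at the end points; the constant test function gives
  -- the natural boundary condition $F(1)=0$.
  have hF1 : F 1 = 0 := by
    have h0 := Lp.coeFn_zero ℝ 2 muI
    have e1 : ∫ s in (0 : ℝ)..1, (0 : L2 ℝ) s = 0 := by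
      rw [intervalIntegral_congr_L2 h0 (by simp)]; simp
    have e2 : ∫ x in (0 : ℝ)..1, (0 : L2 ℝ) x * F x = 0 := by
      rw [intervalIntegral_congr_L2 (g := fun _ => (0 : ℝ)) _ (by simp)]
      · simp
      · filter_upwards [h0] with x hx
        rw [hx]; simp
    have e3 : ∫ x, (0 : L2 ℝ) x * p.2 x ∂muI = 0 := by
      rw [integral_congr_ae (g := fun _ => (0 : ℝ)), integral_zero]
      filter_upwards [h0] with x hx
      rw [hx]; simp
    have := key (1, 0)
    simp only [e1, e2, e3] at this
    linarith
  refine ⟨hF1, ?_⟩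
  let FI : CI ℝ := ⟨fun x => F x, continuousOn_iff_continuous_domRestrict.1 hFc⟩
  have hFI : ∀ y ∈ Icc (0 : ℝ) 1, ext FI y = F y := fun y hy => ext_of_mem FI hy
  -- Testing with the primitive of `p.2 - F` itself makes this difference orthogonal to itself.
  have hz : p.2 - toL2 ℝ FI = 0 := by
    rw [← inner_self_eq_zero (𝕜 := ℝ), inner_sub_right, sub_eq_zero]
    have hk := key (0, p.2 - toL2 ℝ FI)
    rw [hF1, mul_zero, zero_sub, neg_inj] at hk
    simp only at hk
    rw [L2.inner_def, L2.inner_def]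
    refine Eq.trans ?_ (hk.symm.trans ?_)
    · exact integral_congr_ae (Filter.Eventually.of_forall fun y => mul_comm _ _)
    · rw [← integral_muI]
      refine integral_congr_ae ?_
      filter_upwards [coeFn_toL2 FI, ae_restrict_mem measurableSet_Icc] with y h1 h2
      rw [h1, hFI y h2]
      exact mul_comm _ _
  rw [sub_eq_zero.1 hz]
  filter_upwards [coeFn_toL2 FI, ae_restrict_mem measurableSet_Icc] with y h1 h2
  rw [h1, hFI y h2]

/-! ### Parametric integrals and classical solutions of the heat equation -/

theorem posTimes_top : posTimes ⊤ = Ioi 0 := by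
  ext t; simp [posTimes, EReal.coe_lt_top]

theorem timeSpan_top : timeSpan ⊤ = Ici 0 := by
  ext t; simp [timeSpan, EReal.coe_lt_top]

theorem isOpen_posTimes (T : EReal) : IsOpen (posTimes T) :=
  (isOpen_Ioi (a := (0 : ℝ))).inter (isOpen_Iio.preimage continuous_coe_real_ereal)

theorem posTimes_subset_timeSpan (T : EReal) : posTimes T ⊆ timeSpan T := fun _ h => ⟨h.1.le, h.2⟩

theorem continuousOn_slice {S : Set ℝ} {w : ℝ → ℝ → ℝ}
    (hw : ContinuousOn (Function.uncurry w) (S ×ˢ Icc 0 1)) {t : ℝ} (ht : t ∈ S) :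
    ContinuousOn (w t) (Icc 0 1) :=
  hw.comp (f := fun x => (t, x)) (by fun_prop) fun _ hx => ⟨ht, hx⟩

theorem continuousOn_parametric_primitive {S : Set ℝ} {w : ℝ → ℝ → ℝ}
    (hw : ContinuousOn (Function.uncurry w) (S ×ˢ Icc 0 1)) :
    ContinuousOn (Function.uncurry fun t x => ∫ s in (0 : ℝ)..x, w t s) (S ×ˢ Icc 0 1) := by
  -- Clamping the space variable to $[0,1]$ gives an integrand that is continuous everywhere and
  -- unchanged on the range of integration.
  let g : S × ℝ → ℝ → ℝ := fun q s => w q.1 (projIcc 0 1 zero_le_one s)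
  have hg : Continuous (Function.uncurry g) := by
    have h1 : Continuous fun z : (S × ℝ) × ℝ =>
        ((z.1.1 : ℝ), (projIcc (0 : ℝ) 1 zero_le_one z.2 : ℝ)) := by fun_prop
    exact hw.comp_continuous h1 fun z => ⟨z.1.1.2, (projIcc (0 : ℝ) 1 zero_le_one z.2).2⟩
  have hc := intervalIntegral.continuous_parametric_intervalIntegral_of_continuous (μ := volume)
    (f := g) (a₀ := 0) hg (s := fun q => q.2) continuous_snd
  rw [continuousOn_iff_continuous_domRestrict]
  have h2 : Continuous fun z : S ×ˢ Icc (0 : ℝ) 1 => ((⟨z.1.1, z.2.1⟩, z.1.2) : S × ℝ) := by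
    fun_prop
  refine (hc.comp h2).congr fun z => ?_
  refine intervalIntegral.integral_congr fun s hs => ?_
  have hs' : s ∈ Icc (0 : ℝ) 1 := uIcc_subset_Icc (by simp) z.2.2 hs
  simp only [projIcc_of_mem zero_le_one hs']

theorem continuousOn_parametric_integral {S : Set ℝ} {w : ℝ → ℝ → ℝ}
    (hw : ContinuousOn (Function.uncurry w) (S ×ˢ Icc 0 1)) :
    ContinuousOn (fun t => ∫ s in (0 : ℝ)..1, w t s) S :=
  (continuousOn_parametric_primitive hw).comp (f := fun t => (t, (1 : ℝ))) (by fun_prop)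
    fun _ ht => ⟨ht, by simp⟩

/-- Differentiation under the integral sign. -/
theorem hasDerivAt_parametric_integral {S : Set ℝ} (hS : IsOpen S) {w wt : ℝ → ℝ → ℝ}
    (hd : ∀ t ∈ S, ∀ x ∈ Icc (0 : ℝ) 1, HasDerivAt (fun s => w s x) (wt t x) t)
    (hw : ∀ t ∈ S, ContinuousOn (w t) (Icc 0 1))
    (hwt : ContinuousOn (Function.uncurry wt) (S ×ˢ Icc 0 1)) {t : ℝ} (ht : t ∈ S) {y : ℝ}
    (hy : y ∈ Icc (0 : ℝ) 1) :
    HasDerivAt (fun s => ∫ x in (0 : ℝ)..y, w s x) (∫ x in (0 : ℝ)..y, wt t x) t := by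
  obtain ⟨ε, hε, hεS⟩ := Metric.nhds_basis_closedBall.mem_iff.1 (hS.mem_nhds ht)
  have hK : IsCompact (Metric.closedBall t ε ×ˢ Icc (0 : ℝ) 1) :=
    (isCompact_closedBall t ε).prod isCompact_Icc
  obtain ⟨K, hK⟩ := hK.exists_bound_of_continuousOn
    (hwt.mono (prod_mono hεS subset_rfl))
  have hsub : uIoc 0 y ⊆ Icc (0 : ℝ) 1 := uIoc_subset_uIcc.trans (uIcc_subset_Icc (by simp) hy)
  have hsub' : uIcc 0 y ⊆ Icc (0 : ℝ) 1 := uIcc_subset_Icc (by simp) hy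
  refine (intervalIntegral.hasDerivAt_integral_of_dominated_loc_of_deriv_le (μ := volume)
    (s := Metric.closedBall t ε) (bound := fun _ => K) (F := w) (F' := wt)
    (Metric.closedBall_mem_nhds t hε) ?_ ?_ ?_ ?_ ?_ ?_).2
  · filter_upwards [hS.mem_nhds ht] with s hs
    exact ((hw s hs).mono hsub).aestronglyMeasurable measurableSet_uIoc
  · exact ((hw t ht).mono hsub').intervalIntegrable
  · exact ((continuousOn_slice hwt ht).mono hsub).aestronglyMeasurable measurableSet_uIoc
  · exact Filter.Eventually.of_forall fun x hx s hs => hK (s, x) ⟨hs, hsub hx⟩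
  · exact intervalIntegrable_const
  · exact Filter.Eventually.of_forall fun x hx s hs => hd s (hεS hs) x (hsub hx)

theorem hasDerivWithinAt_primitive {q : ℝ → ℝ} (hq : ContinuousOn q (Icc 0 1)) {x : ℝ}
    (hx : x ∈ Icc (0 : ℝ) 1) :
    HasDerivWithinAt (fun x => ∫ s in (0 : ℝ)..x, q s) (q x) (Icc 0 1) x := by
  let a : CI ℝ := ⟨fun x => q x, continuousOn_iff_continuous_domRestrict.1 hq⟩
  have ha : ∀ y ∈ Icc (0 : ℝ) 1, ext a y = q y := fun y hy => ext_of_mem a hy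
  have h1 : HasDerivAt (fun x => ∫ s in (0 : ℝ)..x, ext a s) (ext a x) x :=
    intervalIntegral.integral_hasDerivAt_right ((continuous_ext a).intervalIntegrable _ _)
      ((continuous_ext a).stronglyMeasurableAtFilter _ _) (continuous_ext a).continuousAt
  rw [← ha x hx]
  refine h1.hasDerivWithinAt.congr (fun y hy => ?_) ?_
  · exact intervalIntegral.integral_congr fun s hs => (ha s (uIcc_subset_Icc (by simp) hy hs)).symm
  · exact intervalIntegral.integral_congr fun s hs => (ha s (uIcc_subset_Icc (by simp) hx hs)).symm

theorem integral_deriv_eq_sub {F q : ℝ → ℝ} (hd : ∀ x ∈ Icc (0 : ℝ) 1,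
    HasDerivWithinAt F (q x) (Icc 0 1) x) (hq : ContinuousOn q (Icc 0 1)) {x : ℝ}
    (hx : x ∈ Icc (0 : ℝ) 1) : ∫ s in (0 : ℝ)..x, q s = F x - F 0 := by
  have hs : Icc 0 x ⊆ Icc (0 : ℝ) 1 := Icc_subset_Icc_right hx.2
  refine intervalIntegral.integral_eq_sub_of_hasDerivAt_of_le hx.1
    (fun y hy => ((hd y (hs hy)).continuousWithinAt).mono hs) (fun y hy => ?_)
    ((hq.mono hs).intervalIntegrable_of_Icc hx.1)
  have hy' : y ∈ Ioo (0 : ℝ) 1 := ⟨hy.1, hy.2.trans_le hx.2⟩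
  exact (hd y (Ioo_subset_Icc_self hy')).hasDerivAt (Icc_mem_nhds hy'.1 hy'.2)

theorem continuous_ext_uncurry : Continuous fun q : CI ℝ × ℝ => ext q.1 q.2 := by
  have : Continuous fun q : CI ℝ × ℝ => q.1 (projIcc (0 : ℝ) 1 zero_le_one q.2) := by fun_prop
  exact this

/-- A curve `p` of pairs, standing for `f t x = c(t) + ∫₀ˣ g(t)`, which is a classical solution of
the heat equation with potential `V` for positive times, together with its space derivative. -/
structure HeatCurve (V : ℝ → ℝ) (p : ℝ → ℝ × L2 ℝ) (f ft fx fxt : ℝ → ℝ → ℝ) : Prop where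
  cont : ContinuousOn p (Ici 0)
  eq_ext : ∀ t, f t = ext (J ℝ (p t))
  ae_eq : ∀ t, 0 < t → (p t).2 =ᵐ[muI] fx t
  isC12 : IsC12 ⊤ f ft fx fun t x => ft t x + V x * f t x
  isC12_deriv : IsC12 ⊤ fx fxt (fun t x => ft t x + V x * f t x) fun t x =>
    fxt t x + (derivWithin V (Icc 0 1) x * f t x + V x * fx t x)
  bdry : ∀ t, 0 < t → fx t 0 = 0 ∧ fx t 1 = 0

/-- Time derivatives in $H^1$ are also pointwise ones, since evaluation of `J` is continuous and
linear. Regularity gives $f_x=G=\int_0^x(f_t+Vf)$, so $f_{xx}=f_t+Vf$. Differentiating $G$ in time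
gives $\int_0^x(f_{tt}+Vf_t)$, which by regularity for $f_t$ is also $f_{tx}$. Hence
$f_{xxx}=f_{tx}+V'f+Vf_x$, which is where $V\in C^1$ enters. -/
theorem exists_heatCurve {V : ℝ → ℝ} (hV : ContDiffOn ℝ 1 V (Icc 0 1))
    (hpos : ∀ x ∈ Icc (0 : ℝ) 1, 0 < V x) (p₀ : ℝ × L2 ℝ) :
    ∃ p f ft fx fxt, HeatCurve V p f ft fx fxt ∧ p 0 = p₀ := by
  obtain ⟨p, p1, p2, hc, h0, hp⟩ := exists_weak_heat_curve hV.continuousOn hpos p₀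
  have hVc : ContinuousOn (fun z : ℝ × ℝ => V z.2) (Ioi 0 ×ˢ Icc 0 1) :=
    hV.continuousOn.comp continuousOn_snd fun z hz => hz.2
  have hV' : ContinuousOn (derivWithin V (Icc 0 1)) (Icc 0 1) :=
    hV.continuousOn_derivWithin (uniqueDiffOn_Icc zero_lt_one) le_rfl
  have hVd : ∀ x ∈ Icc (0 : ℝ) 1, HasDerivWithinAt V (derivWithin V (Icc 0 1) x) (Icc 0 1) x :=
    fun x hx => (hV.differentiableOn (by norm_num) x hx).hasDerivWithinAt
  set f : ℝ → ℝ → ℝ := fun t => ext (J ℝ (p t)) with hf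
  set f1 : ℝ → ℝ → ℝ := fun t => ext (J ℝ (p1 t)) with hf1
  set f2 : ℝ → ℝ → ℝ := fun t => ext (J ℝ (p2 t)) with hf2
  set G : ℝ → ℝ → ℝ := fun t x => ∫ s in (0 : ℝ)..x, (f1 t s + V s * f t s) with hG
  set G1 : ℝ → ℝ → ℝ := fun t x => ∫ s in (0 : ℝ)..x, (f2 t s + V s * f1 t s) with hG1
  have hpc : ContinuousOn p (Ioi 0) := fun t ht => (hp t ht).1.continuousAt.continuousWithinAt
  have hp1c : ContinuousOn p1 (Ioi 0) := fun t ht => (hp t ht).2.1.continuousAt.continuousWithinAt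
  have hp2c : ContinuousOn p2 (Ioi 0) := fun t ht => (hp t ht).2.2.1.continuousWithinAt
  have hext : ∀ {u : ℝ → ℝ × L2 ℝ}, ContinuousOn u (Ioi 0) →
      ContinuousOn (Function.uncurry fun t => ext (J ℝ (u t))) (Ioi 0 ×ˢ Icc 0 1) := fun hu =>
    continuous_ext_uncurry.comp_continuousOn
      (((J ℝ).continuous.comp_continuousOn (hu.comp continuousOn_fst fun z hz => hz.1)).prodMk
        continuousOn_snd)
  have hfc := hext hpc
  have hf1c := hext hp1c
  have hf2c := hext hp2c
  have hq : ContinuousOn (Function.uncurry fun t x => f1 t x + V x * f t x) (Ioi 0 ×ˢ Icc 0 1) :=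
    hf1c.add (hVc.mul hfc)
  have hq1 : ContinuousOn (Function.uncurry fun t x => f2 t x + V x * f1 t x)
      (Ioi 0 ×ˢ Icc 0 1) := hf2c.add (hVc.mul hf1c)
  have hGc := continuousOn_parametric_primitive hq
  have hG1c := continuousOn_parametric_primitive hq1
  have hdt : ∀ {u : ℝ → ℝ × L2 ℝ} {u' : ℝ × L2 ℝ} {t : ℝ}, HasDerivAt u u' t →
      ∀ x ∈ Icc (0 : ℝ) 1, HasDerivAt (fun s => ext (J ℝ (u s)) x) (ext (J ℝ u') x) t := by
    intro u u' t hu x hx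
    have := ((ContinuousMap.evalCLM ℝ (⟨x, hx⟩ : Icc (0 : ℝ) 1)).comp
      (J ℝ)).hasFDerivAt.comp_hasDerivAt t hu
    simp only [ext_of_mem _ hx]
    exact this
  have hdx : ∀ {q : ℝ × L2 ℝ} {F : ℝ → ℝ}, ContinuousOn F (Icc 0 1) → q.2 =ᵐ[muI] F →
      ∀ x ∈ Icc (0 : ℝ) 1, HasDerivWithinAt (ext (J ℝ q)) (F x) (Icc 0 1) x := by
    intro q F hF hqF x hx
    refine ((hasDerivWithinAt_primitive hF hx).const_add q.1).congr (fun y hy => ?_) ?_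
    · rw [ext_J q hy, intervalIntegral_congr_L2 hqF hy]
    · rw [ext_J q hx, intervalIntegral_congr_L2 hqF hx]
  have hfx : ∀ t, 0 < t → ∀ x ∈ Icc (0 : ℝ) 1, HasDerivWithinAt (f t) (G t x) (Icc 0 1) x :=
    fun t ht => hdx (continuousOn_slice hGc ht) ((hp t ht).2.2.2.1.regularity hV.continuousOn).2
  have hf1x : ∀ t, 0 < t → ∀ x ∈ Icc (0 : ℝ) 1, HasDerivWithinAt (f1 t) (G1 t x) (Icc 0 1) x :=
    fun t ht => hdx (continuousOn_slice hG1c ht) ((hp t ht).2.2.2.2.regularity hV.continuousOn).2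
  have hGx : ∀ t, 0 < t → ∀ x ∈ Icc (0 : ℝ) 1,
      HasDerivWithinAt (G t) (f1 t x + V x * f t x) (Icc 0 1) x := fun t ht x hx =>
    hasDerivWithinAt_primitive (continuousOn_slice hq ht) hx
  have hGt : ∀ t ∈ Ioi (0 : ℝ), ∀ x ∈ Icc (0 : ℝ) 1,
      HasDerivAt (fun s => G s x) (G1 t x) t := fun t ht x hx =>
    hasDerivAt_parametric_integral isOpen_Ioi
      (w := fun t x => f1 t x + V x * f t x) (wt := fun t x => f2 t x + V x * f1 t x)
      (fun s hs y hy => (hdt (hp s hs).2.1 y hy).add ((hdt (hp s hs).1 y hy).const_mul (V y)))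
      (fun s hs => continuousOn_slice hq hs) hq1 ht hx
  refine ⟨p, f, f1, G, G1, ⟨hc, fun t => rfl, fun t ht =>
    ((hp t ht).2.2.2.1.regularity hV.continuousOn).2, ?_, ?_, fun t ht => ⟨by simp [hG],
    ((hp t ht).2.2.2.1.regularity hV.continuousOn).1⟩⟩, h0⟩
  · constructor <;> rw [posTimes_top]
    · exact fun t ht x hx => hdt (hp t ht).1 x hx
    · exact hfx
    · exact hGx
    · exact hfc
    · exact hf1c
    · exact hGc
    · exact hq
  · constructor <;> rw [posTimes_top]
    · exact hGt
    · exact hGx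
    · exact fun t ht x hx => (hf1x t ht x hx).add ((hVd x hx).mul (hfx t ht x hx))
    · exact hGc
    · exact hG1c
    · exact hq
    · exact hG1c.add (((hV'.comp continuousOn_snd fun z hz => hz.2).mul hfc).add (hVc.mul hGc))

/-! ### Energy estimates: uniqueness and positivity -/

theorem le_of_energy {e e' : ℝ → ℝ} {t : ℝ} (ht : 0 ≤ t) (hc : ContinuousOn e (Icc 0 t))
    (hd : ∀ s ∈ Ioo 0 t, HasDerivAt e (e' s) s) (hn : ∀ s ∈ Ioo 0 t, e' s ≤ 0) : e t ≤ e 0 := by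
  have := antitoneOn_of_deriv_nonpos (convex_Icc 0 t) hc
    (fun s hs => by
      rw [interior_Icc] at hs
      exact (hd s hs).differentiableAt.differentiableWithinAt)
    (fun s hs => by
      rw [interior_Icc] at hs
      rw [(hd s hs).deriv]; exact hn s hs)
  exact this (by simp [ht]) (by simp [ht]) ht

/-- Integration by parts with Neumann boundary conditions. -/
theorem integral_mul_deriv_neumann {h h' q q' : ℝ → ℝ}
    (hh : ∀ x ∈ Icc (0 : ℝ) 1, HasDerivWithinAt h (h' x) (Icc 0 1) x)
    (hh' : ContinuousOn h' (Icc 0 1))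
    (hq : ∀ x ∈ Icc (0 : ℝ) 1, HasDerivWithinAt q (q' x) (Icc 0 1) x)
    (hq' : ContinuousOn q' (Icc 0 1)) (h0 : q 0 = 0) (h1 : q 1 = 0) :
    ∫ x in (0 : ℝ)..1, h x * q' x = -∫ x in (0 : ℝ)..1, h' x * q x := by
  have hd : ∀ {F F' : ℝ → ℝ}, (∀ x ∈ Icc (0 : ℝ) 1, HasDerivWithinAt F (F' x) (Icc 0 1) x) →
      ∀ x ∈ Ioo (min (0 : ℝ) 1) (max 0 1), HasDerivAt F (F' x) x := by
    intro F F' hF x hx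
    rw [min_eq_left zero_le_one, max_eq_right zero_le_one] at hx
    exact (hF x (Ioo_subset_Icc_self hx)).hasDerivAt (Icc_mem_nhds hx.1 hx.2)
  have hc : ∀ {F F' : ℝ → ℝ}, (∀ x ∈ Icc (0 : ℝ) 1, HasDerivWithinAt F (F' x) (Icc 0 1) x) →
      ContinuousOn F (uIcc 0 1) := by
    intro F F' hF
    rw [uIcc_of_le zero_le_one]
    exact fun x hx => (hF x hx).continuousWithinAt
  rw [intervalIntegral.integral_mul_deriv_eq_deriv_mul_of_hasDerivAt (hc hh) (hc hq) (hd hh)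
    (hd hq) (hh'.intervalIntegrable_of_Icc zero_le_one)
    (hq'.intervalIntegrable_of_Icc zero_le_one), h0, h1]
  ring

theorem norm_sq_eq_integral {y : L2I} {w : ℝ → ℝ} (h : y =ᵐ[muI] w) :
    ‖y‖ ^ 2 = ∫ x in (0 : ℝ)..1, w x ^ 2 := by
  rw [← real_inner_self_eq_norm_sq, L2.inner_def, ← integral_muI]
  refine integral_congr_ae ?_
  filter_upwards [h] with x hx
  rw [hx]
  exact (sq (w x)).symm

theorem Icc_subset_timeSpan {T : EReal} {t : ℝ} (ht : t ∈ timeSpan T) : Icc 0 t ⊆ timeSpan T :=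
  fun _ hs => ⟨hs.1, (EReal.coe_le_coe_iff.2 hs.2).trans_lt ht.2⟩

theorem Ioo_subset_posTimes {T : EReal} {t : ℝ} (ht : t ∈ timeSpan T) : Ioo 0 t ⊆ posTimes T :=
  fun _ hs => ⟨hs.1, (EReal.coe_le_coe_iff.2 hs.2.le).trans_lt ht.2⟩

theorem integral_congr_Ioo {f g : ℝ → ℝ} (h : ∀ x ∈ Ioo (0 : ℝ) 1, f x = g x) :
    ∫ x in (0 : ℝ)..1, f x = ∫ x in (0 : ℝ)..1, g x := by
  rw [← integral_muI, ← integral_muI, muI, ← restrict_Ioo_eq_restrict_Icc]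
  exact setIntegral_congr_fun measurableSet_Ioo h

theorem IsC12.cont_slice {T : EReal} {w wt wx wxx : ℝ → ℝ → ℝ} (h : IsC12 T w wt wx wxx) {t : ℝ}
    (ht : t ∈ posTimes T) : ContinuousOn (w t) (Icc 0 1) ∧ ContinuousOn (wt t) (Icc 0 1) ∧
      ContinuousOn (wx t) (Icc 0 1) ∧ ContinuousOn (wxx t) (Icc 0 1) :=
  ⟨continuousOn_slice h.cont ht, continuousOn_slice h.cont_t ht, continuousOn_slice h.cont_x ht,
    continuousOn_slice h.cont_xx ht⟩

variable {V : ℝ → ℝ}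

/-- Energy estimate: $\frac{d}{dt}\|y\|^2=-2\int w_x^2-2\int Vw^2\le0$ for positive times, and
continuity in $L^2$ reaches the zero datum. -/
theorem IsHeatSolution.eq_zero (hV : ContinuousOn V (Icc 0 1))
    (hpos : ∀ x ∈ Icc (0 : ℝ) 1, 0 < V x) {T : EReal} {y : ℝ → L2I}
    (h : IsHeatSolution V T 0 y) {t : ℝ} (ht : t ∈ timeSpan T) : y t = 0 := by
  obtain ⟨w, wt, wx, wxx, hC, hw⟩ := h.eqn
  have hd : ∀ s ∈ posTimes T, HasDerivAt (fun s => ‖y s‖ ^ 2)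
      (∫ x in (0 : ℝ)..1, 2 * w s x * wt s x) s := by
    intro s hs
    have h1 := hasDerivAt_parametric_integral (isOpen_posTimes T) (w := fun t x => w t x ^ 2)
      (wt := fun t x => 2 * w t x * wt t x)
      (fun t ht x hx => ((hC.deriv_t t ht x hx).pow 2).congr_deriv (by simp))
      (fun t ht => (hC.cont_slice ht).1.pow 2)
      (((continuousOn_const (c := (2 : ℝ))).mul hC.cont).mul hC.cont_t) hs (y := 1) (by simp)
    refine h1.congr_of_eventuallyEq ?_
    filter_upwards [(isOpen_posTimes T).mem_nhds hs] with r hr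
    exact norm_sq_eq_integral (hw r hr).1
  have hle := le_of_energy (e := fun s => ‖y s‖ ^ 2) ht.1
    ((h.cont.mono (Icc_subset_timeSpan ht)).norm.pow 2)
    (fun s hs => hd s (Ioo_subset_posTimes ht hs)) (fun s hs => by
      have hs' := Ioo_subset_posTimes ht hs
      obtain ⟨-, heq, b0, b1⟩ := hw s hs'
      obtain ⟨c0, -, c2, c3⟩ := hC.cont_slice hs'
      have e1 : ∫ x in (0 : ℝ)..1, 2 * w s x * wt s x =
          ∫ x in (0 : ℝ)..1, (w s x * wxx s x * 2 - 2 * V x * w s x ^ 2) :=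
        integral_congr_Ioo fun x hx => by rw [heq x hx]; ring
      have i1 : IntervalIntegrable (fun x => w s x * wxx s x * 2) volume 0 1 :=
        ((c0.mul c3).mul continuousOn_const).intervalIntegrable_of_Icc zero_le_one
      have i2 : IntervalIntegrable (fun x => 2 * V x * w s x ^ 2) volume 0 1 :=
        ((continuousOn_const.mul hV).mul (c0.pow 2)).intervalIntegrable_of_Icc zero_le_one
      have e2 := integral_mul_deriv_neumann (hC.deriv_x s hs') c2 (hC.deriv_xx s hs') c3 b0 b1
      rw [e1, intervalIntegral.integral_sub i1 i2, intervalIntegral.integral_mul_const, e2]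
      have n1 : 0 ≤ ∫ x in (0 : ℝ)..1, wx s x * wx s x :=
        intervalIntegral.integral_nonneg zero_le_one fun x _ => mul_self_nonneg _
      have n2 : 0 ≤ ∫ x in (0 : ℝ)..1, 2 * V x * w s x ^ 2 :=
        intervalIntegral.integral_nonneg zero_le_one fun x hx =>
          mul_nonneg (mul_nonneg zero_le_two (hpos x hx).le) (sq_nonneg _)
      linarith)
  simp only [h.init, norm_zero] at hle
  have : ‖y t‖ = 0 := by
    have := sq_nonneg ‖y t‖
    exact pow_eq_zero_iff (two_ne_zero) |>.1 (le_antisymm (by simpa using hle) this)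
  exact norm_eq_zero.1 this

theorem IsHeatSolution.sub {T : EReal} {v₀ v₁ : L2I} {y z : ℝ → L2I}
    (hy : IsHeatSolution V T v₀ y) (hz : IsHeatSolution V T v₁ z) :
    IsHeatSolution V T (v₀ - v₁) fun t => y t - z t := by
  obtain ⟨w, wt, wx, wxx, hC, hw⟩ := hy.eqn
  obtain ⟨w', wt', wx', wxx', hC', hw'⟩ := hz.eqn
  refine ⟨hy.cont.sub hz.cont, by rw [hy.init, hz.init], fun t x => w t x - w' t x,
    fun t x => wt t x - wt' t x, fun t x => wx t x - wx' t x, fun t x => wxx t x - wxx' t x,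
    ⟨fun t ht x hx => (hC.deriv_t t ht x hx).sub (hC'.deriv_t t ht x hx),
      fun t ht x hx => (hC.deriv_x t ht x hx).sub (hC'.deriv_x t ht x hx),
      fun t ht x hx => (hC.deriv_xx t ht x hx).sub (hC'.deriv_xx t ht x hx),
      hC.cont.sub hC'.cont, hC.cont_t.sub hC'.cont_t, hC.cont_x.sub hC'.cont_x,
      hC.cont_xx.sub hC'.cont_xx⟩, fun t ht => ?_⟩
  obtain ⟨h1, h2, h3, h4⟩ := hw t ht
  obtain ⟨k1, k2, k3, k4⟩ := hw' t ht
  refine ⟨?_, fun x hx => ?_, by simp [h3, k3], by simp [h4, k4]⟩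
  · filter_upwards [Lp.coeFn_sub (y t) (z t), h1, k1] with x e e1 e2
    rw [e, Pi.sub_apply, e1, e2]
  · simp only [h2 x hx, k2 x hx]; ring

/-- Multiplying a solution of the heat equation by a function of time. -/
theorem IsC12.time_mul {T : EReal} {w wt wx wxx : ℝ → ℝ → ℝ} (h : IsC12 T w wt wx wxx)
    {a a' : ℝ → ℝ} (ha : ∀ t ∈ posTimes T, HasDerivAt a (a' t) t)
    (ha' : ContinuousOn a' (posTimes T)) :
    IsC12 T (fun t x => a t * w t x) (fun t x => a' t * w t x + a t * wt t x)
      (fun t x => a t * wx t x) fun t x => a t * wxx t x := by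
  have hc : ContinuousOn (fun z : ℝ × ℝ => a z.1) (posTimes T ×ˢ Icc 0 1) :=
    ContinuousOn.comp (g := a) (fun t ht => (ha t ht).continuousAt.continuousWithinAt)
      continuousOn_fst fun z hz => hz.1
  have hc' : ContinuousOn (fun z : ℝ × ℝ => a' z.1) (posTimes T ×ˢ Icc 0 1) :=
    ha'.comp continuousOn_fst fun z hz => hz.1
  exact ⟨fun t ht x hx => (ha t ht).mul (h.deriv_t t ht x hx),
    fun t ht x hx => (h.deriv_x t ht x hx).const_mul _,
    fun t ht x hx => (h.deriv_xx t ht x hx).const_mul _, hc.mul h.cont,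
    (hc'.mul h.cont).add (hc.mul h.cont_t), hc.mul h.cont_x, hc.mul h.cont_xx⟩

theorem IsHeatSolution.const_smul {T : EReal} {v₀ : L2I} {y : ℝ → L2I}
    (hy : IsHeatSolution V T v₀ y) (c : ℝ) : IsHeatSolution V T (c • v₀) fun t => c • y t := by
  obtain ⟨w, wt, wx, wxx, hC, hw⟩ := hy.eqn
  refine ⟨hy.cont.const_smul c, by rw [hy.init], _, _, _, _,
    hC.time_mul (a := fun _ => c) (a' := fun _ => 0) (fun t _ => hasDerivAt_const t c)
      continuousOn_const, fun t ht => ?_⟩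
  obtain ⟨h1, h2, h3, h4⟩ := hw t ht
  refine ⟨?_, fun x hx => ?_, by simp [h3], by simp [h4]⟩
  · filter_upwards [Lp.coeFn_smul c (y t), h1] with x e e1
    rw [e, Pi.smul_apply, e1, smul_eq_mul]
  · rw [h2 x hx]; ring

theorem timeSpan_mono {T T' : EReal} (h : T ≤ T') : timeSpan T ⊆ timeSpan T' :=
  fun _ ht => ⟨ht.1, ht.2.trans_le h⟩

theorem posTimes_mono {T T' : EReal} (h : T ≤ T') : posTimes T ⊆ posTimes T' :=
  fun _ ht => ⟨ht.1, ht.2.trans_le h⟩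

theorem IsC12.mono {T T' : EReal} (hT : T ≤ T') {w wt wx wxx : ℝ → ℝ → ℝ}
    (h : IsC12 T' w wt wx wxx) : IsC12 T w wt wx wxx := by
  have hs := posTimes_mono hT
  have hs' : posTimes T ×ˢ Icc (0 : ℝ) 1 ⊆ posTimes T' ×ˢ Icc (0 : ℝ) 1 :=
    prod_mono hs subset_rfl
  exact ⟨fun t ht => h.deriv_t t (hs ht), fun t ht => h.deriv_x t (hs ht),
    fun t ht => h.deriv_xx t (hs ht), h.cont.mono hs', h.cont_t.mono hs', h.cont_x.mono hs',
    h.cont_xx.mono hs'⟩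

theorem IsHeatSolution.mono {T T' : EReal} (hT : T ≤ T') {v₀ : L2I} {y : ℝ → L2I}
    (h : IsHeatSolution V T' v₀ y) : IsHeatSolution V T v₀ y := by
  obtain ⟨w, wt, wx, wxx, hC, hw⟩ := h.eqn
  exact ⟨h.cont.mono (timeSpan_mono hT), h.init, w, wt, wx, wxx, hC.mono hT,
    fun t ht => hw t (posTimes_mono hT ht)⟩

theorem IsHeatSolution.unique (hV : ContinuousOn V (Icc 0 1))
    (hpos : ∀ x ∈ Icc (0 : ℝ) 1, 0 < V x) {T : EReal} {v₀ : L2I} {y z : ℝ → L2I}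
    (hy : IsHeatSolution V T v₀ y) (hz : IsHeatSolution V T v₀ z) {t : ℝ}
    (ht : t ∈ timeSpan T) : y t = z t := by
  have h := hy.sub hz
  rw [sub_self] at h
  exact sub_eq_zero.1 (h.eq_zero hV hpos ht)

/-- Exponents at least two remove the corner of the positive part at $0$. -/
theorem hasDerivAt_max_zero_pow (n : ℕ) (z : ℝ) :
    HasDerivAt (fun z : ℝ => max z 0 ^ (n + 2)) ((n + 2) * max z 0 ^ (n + 1)) z := by
  rcases lt_trichotomy z 0 with hz | rfl | hz
  · rw [max_eq_right hz.le]
    refine ((hasDerivAt_const z (0 : ℝ)).congr_of_eventuallyEq ?_).congr_deriv (by simp)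
    filter_upwards [gt_mem_nhds hz] with y hy
    rw [max_eq_right hy.le]; simp
  · rw [hasDerivAt_iff_isLittleO_nhds_zero]
    have hO : (fun h : ℝ => max (0 + h) 0 ^ (n + 2) - max (0 : ℝ) 0 ^ (n + 2) -
        h • ((n + 2) * max (0 : ℝ) 0 ^ (n + 1))) =O[nhds 0] fun h => h ^ (n + 2) := by
      refine Asymptotics.IsBigO.of_bound 1 (Filter.Eventually.of_forall fun h => ?_)
      simp only [zero_add, max_self, one_mul]
      rw [zero_pow (by simp), zero_pow (by simp), mul_zero, smul_zero, sub_zero, sub_zero, norm_pow,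
        norm_pow]
      refine pow_le_pow_left₀ (norm_nonneg _) ?_ _
      rw [Real.norm_of_nonneg (le_max_right _ _), Real.norm_eq_abs]
      exact max_le (le_abs_self h) (abs_nonneg h)
    refine hO.trans_isLittleO ?_
    simpa using (Asymptotics.isLittleO_pow_pow (𝕜 := ℝ) (m := 1) (n := n + 2) (by omega))
  · rw [max_eq_left hz.le]
    refine ((hasDerivAt_pow (n + 2) z).congr_of_eventuallyEq ?_).congr_deriv (by push_cast; rfl)
    filter_upwards [lt_mem_nhds hz] with y hy
    rw [max_eq_left hy.le]

theorem eq_zero_of_integral_nonpos {F : ℝ → ℝ} (hF : ContinuousOn F (Icc 0 1))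
    (hnn : ∀ x ∈ Icc (0 : ℝ) 1, 0 ≤ F x) (h : ∫ x in (0 : ℝ)..1, F x ≤ 0) :
    ∀ x ∈ Icc (0 : ℝ) 1, F x = 0 := by
  by_contra! hne
  obtain ⟨x, hx, hFx⟩ := hne
  have := intervalIntegral.integral_pos zero_lt_one hF
    (fun y hy => hnn y (Ioc_subset_Icc_self hy)) ⟨x, hx, (hnn x hx).lt_of_ne' hFx⟩
  linarith

/-! ### Minimum principle and positivity -/

variable {p : ℝ → ℝ × L2 ℝ} {f ft fx fxt : ℝ → ℝ → ℝ}

theorem HeatCurve.continuousOn_uncurry (h : HeatCurve V p f ft fx fxt) :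
    ContinuousOn (Function.uncurry f) (Ici 0 ×ˢ Icc 0 1) := by
  have : Function.uncurry f = fun z : ℝ × ℝ => ext (J ℝ (p z.1)) z.2 := by
    funext z; rw [Function.uncurry, h.eq_ext]
  rw [this]
  exact continuous_ext_uncurry.comp_continuousOn
    (((J ℝ).continuous.comp_continuousOn (h.cont.comp continuousOn_fst fun z hz => hz.1)).prodMk
      continuousOn_snd)

/-- The minimum principle. -/
theorem HeatCurve.lower_bound (h : HeatCurve V p f ft fx fxt) (hV : ContinuousOn V (Icc 0 1))
    (hpos : ∀ x ∈ Icc (0 : ℝ) 1, 0 < V x) {M m : ℝ} (hM : ∀ x ∈ Icc (0 : ℝ) 1, V x ≤ M)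
    (hm : 0 ≤ m) (h0 : ∀ x ∈ Icc (0 : ℝ) 1, m ≤ f 0 x) {t : ℝ} (ht : 0 ≤ t) :
    ∀ x ∈ Icc (0 : ℝ) 1, m * Real.exp (-(M * t)) ≤ f t x := by
  -- The barrier is constant in space and is a subsolution: $k'=-Mk\le-Vk$. The aim is $z=k-f\le0$.
  set k : ℝ → ℝ := fun t => m * Real.exp (-(M * t)) with hk
  have hkc : Continuous k := by fun_prop
  have hkd : ∀ t, HasDerivAt k (-M * k t) t := fun t => by
    have h1 : HasDerivAt (fun t : ℝ => -(M * t)) (-M) t :=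
      ((hasDerivAt_id t).const_mul M).neg.congr_deriv (by simp)
    exact (h1.exp.const_mul m).congr_deriv (by simp only [hk]; ring)
  have hknn : ∀ t, 0 ≤ k t := fun t => mul_nonneg hm (Real.exp_pos _).le
  set z : ℝ → ℝ → ℝ := fun t x => k t - f t x with hz
  have hzc : ContinuousOn (Function.uncurry z) (Ici 0 ×ˢ Icc 0 1) :=
    (hkc.comp continuous_fst).continuousOn.sub h.continuousOn_uncurry
  have hsub : Ioi (0 : ℝ) ×ˢ Icc (0 : ℝ) 1 ⊆ Ici 0 ×ˢ Icc 0 1 :=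
    prod_mono Ioi_subset_Ici_self subset_rfl
  have hmax : ∀ n : ℕ, Continuous fun z : ℝ => max z 0 ^ n := fun n => by fun_prop
  have hC := h.isC12
  -- The energy is $\int(z^+)^3$. The cube is chosen because its time derivative carries the weight
  -- $(z^+)^2$, which is still $C^1$ in $x$ and can be integrated by parts against $f_{xx}$.
  have hd : ∀ s ∈ Ioo 0 t, HasDerivAt (fun s => ∫ x in (0 : ℝ)..1, max (z s x) 0 ^ (1 + 2))
      (∫ x in (0 : ℝ)..1, (((1 : ℕ) : ℝ) + 2) * max (z s x) 0 ^ (1 + 1) *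
        (-M * k s - ft s x)) s := by
    intro s hs
    refine hasDerivAt_parametric_integral isOpen_Ioi (S := Ioi 0)
      (w := fun t x => max (z t x) 0 ^ (1 + 2))
      (wt := fun t x => (((1 : ℕ) : ℝ) + 2) * max (z t x) 0 ^ (1 + 1) * (-M * k t - ft t x))
      (fun t ht x hx => ?_) (fun t ht => ?_) ?_ hs.1 (by simp)
    · exact (hasDerivAt_max_zero_pow 1 (z t x)).comp t
        ((hkd t).sub (hC.deriv_t t (by rwa [posTimes_top]) x hx))
    · exact (hmax _).comp_continuousOn (continuousOn_slice (hzc.mono hsub) ht)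
    · refine (continuousOn_const.mul ((hmax _).comp_continuousOn (hzc.mono hsub))).mul
        ((continuousOn_const.mul (hkc.comp continuous_fst).continuousOn).sub ?_)
      rw [← posTimes_top]
      exact hC.cont_t
  have hle := le_of_energy ht ((continuousOn_parametric_integral (S := Ici 0)
    (w := fun s x => max (z s x) 0 ^ (1 + 2)) ((hmax (1 + 2)).comp_continuousOn hzc)).mono
    Icc_subset_Ici_self) hd (fun s hs => by
      have hs' : s ∈ posTimes ⊤ := by rw [posTimes_top]; exact hs.1
      obtain ⟨c0, c1, c2, c3⟩ := hC.cont_slice hs'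
      have czs : ContinuousOn (z s) (Icc 0 1) := continuousOn_const.sub c0
      have hzx : ∀ x ∈ Icc (0 : ℝ) 1, HasDerivWithinAt (fun x => max (z s x) 0 ^ (0 + 2))
          ((((0 : ℕ) : ℝ) + 2) * max (z s x) 0 ^ (0 + 1) * (0 - fx s x)) (Icc 0 1) x :=
        fun x hx => (hasDerivAt_max_zero_pow 0 (z s x)).comp_hasDerivWithinAt x
          ((hasDerivWithinAt_const x _ (k s)).sub (hC.deriv_x s hs' x hx))
      have e2 := integral_mul_deriv_neumann hzx
        ((continuousOn_const.mul ((hmax _).comp_continuousOn czs)).mul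
          (continuousOn_const.sub c2)) (hC.deriv_xx s hs') c3 (h.bdry s hs.1).1
          (h.bdry s hs.1).2
      have i1 : IntervalIntegrable (fun x => max (z s x) 0 ^ (0 + 2) *
          (ft s x + V x * f s x)) volume 0 1 :=
        (((hmax _).comp_continuousOn czs).mul c3).intervalIntegrable_of_Icc zero_le_one
      have i2 : IntervalIntegrable (fun x => max (z s x) 0 ^ (0 + 2) *
          ((M - V x) * k s + V x * z s x)) volume 0 1 :=
        (((hmax _).comp_continuousOn czs).mul (((continuousOn_const.sub hV).mul
          continuousOn_const).add (hV.mul czs))).intervalIntegrable_of_Icc zero_le_one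
      -- Since $f=k-z$, one has $-Mk-f_t=-(f_t+Vf)-\big((M-V)k+Vz\big)$, where $f_t+Vf$ plays the
      -- role of $f_{xx}$ and the last bracket is nonnegative where $z\ge0$.
      have e1 : ∫ x in (0 : ℝ)..1, (((1 : ℕ) : ℝ) + 2) * max (z s x) 0 ^ (1 + 1) *
          (-M * k s - ft s x) = -3 * (∫ x in (0 : ℝ)..1, max (z s x) 0 ^ (0 + 2) *
          (ft s x + V x * f s x)) - 3 * ∫ x in (0 : ℝ)..1, max (z s x) 0 ^ (0 + 2) *
          ((M - V x) * k s + V x * z s x) := by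
        rw [← intervalIntegral.integral_const_mul, ← intervalIntegral.integral_const_mul,
          ← intervalIntegral.integral_sub (i1.const_mul _) (i2.const_mul _)]
        congr 1; funext x
        simp only [hz]; push_cast; ring
      rw [e1, e2]
      have n1 : 0 ≤ -∫ x in (0 : ℝ)..1, (((0 : ℕ) : ℝ) + 2) * max (z s x) 0 ^ (0 + 1) *
          (0 - fx s x) * fx s x := by
        rw [← intervalIntegral.integral_neg]
        refine intervalIntegral.integral_nonneg zero_le_one fun x _ => ?_
        have := mul_nonneg (le_max_right (z s x) 0) (mul_self_nonneg (fx s x))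
        push_cast
        rw [zero_add, pow_one]
        linarith
      have n2 : 0 ≤ ∫ x in (0 : ℝ)..1, max (z s x) 0 ^ (0 + 2) *
          ((M - V x) * k s + V x * z s x) := by
        refine intervalIntegral.integral_nonneg zero_le_one fun x hx => ?_
        rcases le_total (z s x) 0 with hzn | hzp
        · rw [max_eq_right hzn]; simp
        · exact mul_nonneg (pow_nonneg (le_max_right _ _) _) (add_nonneg
            (mul_nonneg (sub_nonneg.2 (hM x hx)) (hknn s)) (mul_nonneg (hpos x hx).le hzp))
      linarith)
  have e0 : ∫ x in (0 : ℝ)..1, max (z 0 x) 0 ^ (1 + 2) = 0 := by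
    rw [intervalIntegral.integral_congr (g := fun _ => (0 : ℝ))]
    · simp
    · intro x hx
      rw [uIcc_of_le zero_le_one] at hx
      have : z 0 x ≤ 0 := by simp only [hz, hk]; simpa using h0 x hx
      simp only [max_eq_right this]; simp
  rw [e0] at hle
  have hzt : ContinuousOn (z t) (Icc 0 1) := continuousOn_slice hzc ht
  intro x hx
  have := eq_zero_of_integral_nonpos ((hmax _).comp_continuousOn hzt)
    (fun x _ => pow_nonneg (le_max_right _ _) _) hle x hx
  have h3 : max (z t x) 0 = 0 := pow_eq_zero_iff (by norm_num) |>.1 this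
  have h4 : z t x ≤ 0 := max_eq_right_iff.1 h3
  simpa [hz] using h4

theorem HeatCurve.pos (h : HeatCurve V p f ft fx fxt) (hV : ContinuousOn V (Icc 0 1))
    (hpos : ∀ x ∈ Icc (0 : ℝ) 1, 0 < V x) (h0 : ∀ x ∈ Icc (0 : ℝ) 1, 0 < f 0 x) {t : ℝ}
    (ht : 0 ≤ t) : ∀ x ∈ Icc (0 : ℝ) 1, 0 < f t x := by
  have hne : (Icc (0 : ℝ) 1).Nonempty := ⟨0, by simp⟩
  obtain ⟨M, hM⟩ := isCompact_Icc.exists_isMaxOn hne hV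
  obtain ⟨m, hm⟩ := isCompact_Icc.exists_isMinOn hne
    (continuousOn_slice h.continuousOn_uncurry (t := 0) (by simp))
  have hm2 : ∀ x ∈ Icc (0 : ℝ) 1, f 0 m ≤ f 0 x := hm.2
  have hM2 : ∀ x ∈ Icc (0 : ℝ) 1, V x ≤ V M := hM.2
  intro x hx
  refine lt_of_lt_of_le ?_ (h.lower_bound hV hpos hM2 (h0 m hm.1).le hm2 ht x hx)
  exact mul_pos (h0 m hm.1) (Real.exp_pos _)

theorem HeatCurve.isHeatSolution (h : HeatCurve V p f ft fx fxt) :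
    IsHeatSolution V ⊤ (toL2 ℝ (J ℝ (p 0))) fun t => toL2 ℝ (J ℝ (p t)) := by
  refine ⟨?_, rfl, f, ft, fx, _, h.isC12, fun t ht => ⟨?_, fun x _ => by ring, ?_⟩⟩
  · rw [timeSpan_top]
    exact ((toL2 ℝ).continuous.comp (J ℝ).continuous).comp_continuousOn h.cont
  · rw [h.eq_ext]; exact coeFn_toL2 _
  · exact h.bdry t ht.1

/-! ### The Cole-Hopf transforms -/

/-- The pair `p` represents a strictly positive function. -/
def PosPair (p : ℝ × L2 ℝ) : Prop := ∀ x, 0 < J ℝ p x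

theorem PosPair.ext_pos {p : ℝ × L2 ℝ} (hp : PosPair p) (x : ℝ) : 0 < ext (J ℝ p) x := hp _

theorem PosPair.fst_pos {p : ℝ × L2 ℝ} (hp : PosPair p) : 0 < p.1 := by
  have := hp ⟨0, by simp⟩
  rwa [J_apply, intervalIntegral.integral_same, add_zero] at this

theorem isOpen_posPair : IsOpen {p | PosPair p} := by
  have h := (ContinuousMap.isOpen_setOfPred_mapsTo (X := Icc (0 : ℝ) 1) (Y := ℝ) isCompact_univ
    isOpen_Ioi (U := Ioi 0)).preimage (J ℝ).continuous
  convert h using 1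
  ext p
  exact ⟨fun hp x _ => hp x, fun hp x => hp (mem_univ x)⟩

theorem PosPair.smul {p : ℝ × L2 ℝ} (hp : PosPair p) {c : ℝ} (hc : 0 < c) : PosPair (c • p) :=
  fun x => by
    rw [map_smul]
    exact mul_pos hc (hp x)

/-- A function with a weak derivative is a primitive, and continuous representatives on $[0,1]$ are
unique, so positivity of one is positivity of the pair. -/
theorem mem_Pplus_iff {v : L2I} : v ∈ Pplus ↔ ∃ p, PosPair p ∧ v = toL2 ℝ (J ℝ p) := by
  constructor
  · rintro ⟨⟨w, hw⟩, f, hf, hpos, hvf⟩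
    obtain ⟨c, rfl⟩ := hw.exists_eq_toL2_J
    refine ⟨(c, w), fun x => ?_, rfl⟩
    have h := MeasureTheory.Measure.eqOn_Icc_of_ae_eq volume zero_ne_one
      ((coeFn_toL2 (J ℝ (c, w))).symm.trans hvf) (continuous_ext _).continuousOn hf
    rw [← ext_of_mem _ x.2, h x.2]
    exact hpos x x.2
  · rintro ⟨p, hp, rfl⟩
    exact ⟨⟨p.2, hasWeakDeriv_toL2_J p⟩, ext (J ℝ p), (continuous_ext _).continuousOn,
      fun x _ => hp.ext_pos x, coeFn_toL2 _⟩

/-- The mean as a continuous linear functional. -/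
def meanL : L2I →L[ℝ] ℝ := innerSL ℝ (Lp.const 2 muI (1 : ℝ))

theorem mean_eq_meanL (v : L2I) : mean v = meanL v := by
  rw [mean, meanL, innerSL_apply_apply, L2.inner_def]
  refine integral_congr_ae ?_
  filter_upwards [Lp.coeFn_const (p := 2) (μ := muI) (1 : ℝ)] with x hx
  rw [hx]; simp

theorem mean_toL2 (a : CI ℝ) : mean (toL2 ℝ a) = ∫ x in (0 : ℝ)..1, ext a x := by
  rw [mean, ← integral_muI]
  exact integral_congr_ae (coeFn_toL2 a)

theorem mean_smul (c : ℝ) (v : L2I) : mean (c • v) = c * mean v := by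
  rw [mean_eq_meanL, mean_eq_meanL, map_smul, smul_eq_mul]

theorem mean_toL2_pos {a : CI ℝ} (ha : ∀ x, 0 < a x) : 0 < mean (toL2 ℝ a) := by
  rw [mean_toL2]
  exact intervalIntegral.intervalIntegral_pos_of_pos ((continuous_ext a).intervalIntegrable _ _)
    (fun x => ha _) zero_lt_one

theorem mean_pos {v : L2I} (hv : v ∈ Pplus) : 0 < mean v := by
  obtain ⟨p, hp, rfl⟩ := mem_Pplus_iff.1 hv
  exact mean_toL2_pos hp

theorem smul_mem_Pplus {v : L2I} (hv : v ∈ Pplus) {c : ℝ} (hc : 0 < c) : c • v ∈ Pplus := by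
  obtain ⟨p, hp, rfl⟩ := mem_Pplus_iff.1 hv
  exact mem_Pplus_iff.2 ⟨c • p, hp.smul hc, by rw [map_smul, map_smul]⟩

theorem inv_mean_smul_mem_Pone {v : L2I} (hv : v ∈ Pplus) : (1 / mean v) • v ∈ Pone := by
  have h := mean_pos hv
  exact ⟨smul_mem_Pplus hv (one_div_pos.2 h), by rw [mean_smul]; field_simp⟩

theorem isUnit_of_pos {a : CI ℝ} (ha : ∀ x, 0 < a x) : IsUnit a :=
  ContinuousMap.isUnit_iff_forall_ne_zero a |>.2 fun x => (ha x).ne'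

theorem inverse_apply {a : CI ℝ} (ha : ∀ x, 0 < a x) (x : Icc (0 : ℝ) 1) :
    Ring.inverse a x = (a x)⁻¹ := by
  have h := congrArg (fun b : CI ℝ => b x) (Ring.inverse_mul_cancel a (isUnit_of_pos ha))
  exact eq_inv_of_mul_eq_one_left h

/-- The map `(c, g) ↦ -2 g / (c + ∫₀ˣ g)`. -/
def pairC (p : ℝ × L2 ℝ) : L2I := mulL2 ℝ (Ring.inverse (J ℝ p)) ((-2 : ℝ) • p.2)

theorem coeFn_pairC {p : ℝ × L2 ℝ} (hp : PosPair p) :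
    pairC p =ᵐ[muI] fun x => -2 * (p.2 x / ext (J ℝ p) x) := by
  filter_upwards [coeFn_mulL2 (Ring.inverse (J ℝ p)) ((-2 : ℝ) • p.2),
    Lp.coeFn_smul (-2 : ℝ) p.2] with x h1 h2
  rw [pairC, h1, h2, Pi.smul_apply, smul_eq_mul]
  have : ext (Ring.inverse (J ℝ p)) x = (ext (J ℝ p) x)⁻¹ := inverse_apply hp _
  rw [this, div_eq_mul_inv]; ring

theorem coleHopfC_toL2_J {p : ℝ × L2 ℝ} (hp : PosPair p) :
    coleHopfC (toL2 ℝ (J ℝ p)) = pairC p := by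
  have h : (fun x => -2 * (weakDeriv (toL2 ℝ (J ℝ p)) x / toL2 ℝ (J ℝ p) x)) =ᵐ[muI] pairC p := by
    filter_upwards [coeFn_pairC hp, coeFn_toL2 (J ℝ p)] with x h1 h2
    rw [h1, h2, weakDeriv_eq (hasWeakDeriv_toL2_J p)]
  have hm : MemLp (fun x => -2 * (weakDeriv (toL2 ℝ (J ℝ p)) x / toL2 ℝ (J ℝ p) x)) 2 muI :=
    (memLp_congr_ae h).2 (Lp.memLp _)
  rw [coleHopfC, dif_pos hm]
  exact Lp.ext (hm.coeFn_toLp.trans h)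

/-- Inversion is continuous at units of the Banach algebra $C([0,1])$ and multiplication into $L^2$
is bounded. This gives the continuity in $L^2$, down to $t=0$, of the Burgers solution built from a
heat curve. -/
theorem continuousAt_pairC {p : ℝ × L2 ℝ} (hp : PosPair p) : ContinuousAt pairC p := by
  obtain ⟨u, hu⟩ := isUnit_of_pos hp
  have h1 : ContinuousAt (fun p => Ring.inverse (J ℝ p)) p := by
    have := NormedRing.inverse_continuousAt u
    rw [hu] at this
    exact ContinuousAt.comp (g := Ring.inverse) this (J ℝ).continuous.continuousAt
  have h2 : ContinuousAt (fun p : ℝ × L2 ℝ => (-2 : ℝ) • p.2) p := by fun_prop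
  have h3 : ContinuousAt (fun p : ℝ × L2 ℝ => mulL2 ℝ (Ring.inverse (J ℝ p))) p :=
    (mulL2 ℝ).continuous.continuousAt.comp h1
  exact h3.clm_apply h2

theorem pairC_smul {p : ℝ × L2 ℝ} (hp : PosPair p) {c : ℝ} (hc : 0 < c) :
    pairC (c • p) = pairC p := by
  refine Lp.ext ?_
  filter_upwards [coeFn_pairC hp, coeFn_pairC (hp.smul hc), Lp.coeFn_smul c p.2] with x h1 h2 h3
  have e : ext (J ℝ (c • p)) x = c * ext (J ℝ p) x := by rw [map_smul]; rfl
  have h4 := (hp.ext_pos x).ne'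
  rw [h1, h2, e, Prod.smul_snd, h3, Pi.smul_apply, smul_eq_mul]
  field_simp

theorem coleHopfC_smul {v : L2I} (hv : v ∈ Pplus) {c : ℝ} (hc : 0 < c) :
    coleHopfC (c • v) = coleHopfC v := by
  obtain ⟨p, hp, rfl⟩ := mem_Pplus_iff.1 hv
  rw [← map_smul, ← map_smul, coleHopfC_toL2_J hp, coleHopfC_toL2_J (hp.smul hc),
    pairC_smul hp hc]

/-- The function `exp (-½ ∫₀ˣ u)` as a continuous function. -/
def expPrim (u : L2I) : CI ℝ :=
  (⟨Real.exp, Real.continuous_exp⟩ : C(ℝ, ℝ)).comp ((-(1 / 2) : ℝ) • prim ℝ u)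

theorem continuous_expPrim : Continuous expPrim :=
  (ContinuousMap.continuous_postcomp _).comp ((prim ℝ).continuous.const_smul (-(1 / 2) : ℝ))

theorem expPrim_apply (u : L2I) (x : Icc (0 : ℝ) 1) : expPrim u x = expPrimitive u x := rfl

theorem expPrim_pos (u : L2I) (x : Icc (0 : ℝ) 1) : 0 < expPrim u x := Real.exp_pos _

theorem ext_expPrim (u : L2I) {x : ℝ} (hx : x ∈ Icc (0 : ℝ) 1) :
    ext (expPrim u) x = expPrimitive u x := by
  rw [ext_of_mem _ hx, expPrim_apply]

theorem coleHopfH_eq (u : L2I) :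
    coleHopfH u = (1 / mean (toL2 ℝ (expPrim u))) • toL2 ℝ (expPrim u) := by
  have hm : mean (toL2 ℝ (expPrim u)) = ∫ y, expPrimitive u y ∂muI := by
    rw [mean_toL2, ← integral_muI]
    exact integral_congr_ae (ae_muI_of_forall fun x hx => ext_expPrim u hx)
  refine Lp.ext ?_
  filter_upwards [(memLp_coleHopfH u).coeFn_toLp, coeFn_toL2 (expPrim u),
    Lp.coeFn_smul (1 / mean (toL2 ℝ (expPrim u))) (toL2 ℝ (expPrim u)),
    ae_restrict_mem measurableSet_Icc] with x h1 h2 h3 hx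
  rw [coleHopfH, h1, h3, Pi.smul_apply, h2, ext_expPrim u hx, hm, smul_eq_mul]
  ring

theorem continuous_coleHopfH : Continuous coleHopfH := by
  have h1 : Continuous fun u => toL2 ℝ (expPrim u) := (toL2 ℝ).continuous.comp continuous_expPrim
  have h2 : Continuous fun u => mean (toL2 ℝ (expPrim u)) := by
    simp only [mean_eq_meanL]
    exact meanL.continuous.comp h1
  rw [show coleHopfH = _ from funext coleHopfH_eq]
  exact (continuous_const.div h2 fun u => (mean_toL2_pos (expPrim_pos u)).ne').smul h1

/-- A function orthogonal to all continuous functions is orthogonal to test functions, hence zero.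
Density reduces the Cole–Hopf identities to continuous data, where they are chain rules. -/
theorem denseRange_toL2 : DenseRange (toL2 ℝ) := by
  have h : (LinearMap.range (toL2 ℝ : CI ℝ →ₗ[ℝ] L2 ℝ)).topologicalClosure = ⊤ := by
    rw [Submodule.topologicalClosure_eq_top_iff, Submodule.eq_bot_iff]
    intro g hg
    refine Lp.ext (Filter.EventuallyEq.trans ?_ (Lp.coeFn_zero ℝ 2 muI).symm)
    refine ae_eq_of_forall_integral_mul_eq_zero (integrable_L2 g) fun φ hφ _ _ => ?_
    let a : CI ℝ := ⟨fun x => φ x, hφ.continuous.comp continuous_subtype_val⟩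
    have h1 : inner ℝ (toL2 ℝ a) g = 0 := (Submodule.mem_orthogonal _ _).1 hg _ ⟨a, rfl⟩
    rw [L2.inner_def] at h1
    rw [← h1]
    refine integral_congr_ae ?_
    filter_upwards [coeFn_toL2 a, ae_restrict_mem measurableSet_Icc] with x e hx
    rw [e, ext_of_mem a hx]
    exact rfl
  exact (Submodule.dense_iff_topologicalClosure_eq_top).2 h

theorem prim_toL2 (a : CI ℝ) (x : Icc (0 : ℝ) 1) :
    prim ℝ (toL2 ℝ a) x = ∫ s in (0 : ℝ)..x, ext a s := by
  rw [prim_apply, intervalIntegral_congr_L2 (coeFn_toL2 a) x.2]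

theorem mulL2_toL2 (a b : CI ℝ) : mulL2 ℝ a (toL2 ℝ b) = toL2 ℝ (a * b) :=
  mulL2_mulL2 a b _

/-- `exp (-½ ∫₀ˣ u)` is the primitive of `-½ u exp (-½ ∫₀ˣ u)`. -/
theorem J_expPrim (u : L2I) :
    J ℝ (1, mulL2 ℝ (expPrim u) ((-(1 / 2) : ℝ) • u)) = expPrim u := by
  -- Both sides are continuous in $u\in L^2$ with values in $C([0,1])$, so it is enough to take $u$
  -- continuous.
  have hc : Continuous fun u : L2I => J ℝ (1, mulL2 ℝ (expPrim u) ((-(1 / 2) : ℝ) • u)) :=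
    (J ℝ).continuous.comp (continuous_const.prodMk
      (((mulL2 ℝ).continuous.comp continuous_expPrim).clm_apply (continuous_const_smul _)))
  refine congrFun (denseRange_toL2.equalizer hc continuous_expPrim (funext fun a => ?_)) u
  ext x
  have hd : ∀ y ∈ Icc (0 : ℝ) 1, HasDerivWithinAt
      (fun y => Real.exp (-(1 / 2) * ∫ s in (0 : ℝ)..y, ext a s))
      (Real.exp (-(1 / 2) * ∫ s in (0 : ℝ)..y, ext a s) * (-(1 / 2) * ext a y)) (Icc 0 1) y :=
    fun y hy => ((hasDerivWithinAt_primitive (continuous_ext a).continuousOn hy).const_mul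
      (-(1 / 2))).exp
  have hi := integral_deriv_eq_sub hd ((continuousOn_of_forall_continuousAt fun y hy => by
    have : Continuous fun y => ∫ s in (0 : ℝ)..y, ext a s :=
      intervalIntegral.continuous_primitive (fun _ _ => (continuous_ext a).intervalIntegrable _ _) 0
    have h2 := continuous_ext a
    fun_prop)) x.2
  simp only [Function.comp_apply, ← map_smul, mulL2_toL2]
  rw [J_apply, intervalIntegral_congr_L2 (coeFn_toL2 _) x.2]
  have e : ∀ s ∈ uIcc (0 : ℝ) x, ext (expPrim (toL2 ℝ a) * (-(1 / 2) : ℝ) • a) s =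
      Real.exp (-(1 / 2) * ∫ r in (0 : ℝ)..s, ext a r) * (-(1 / 2) * ext a s) := by
    intro s hs
    have hs' : s ∈ Icc (0 : ℝ) 1 := uIcc_subset_Icc (by simp) x.2 hs
    rw [ext_of_mem _ hs', ContinuousMap.mul_apply, expPrim_apply, expPrimitive,
      ← prim_apply (toL2 ℝ a) ⟨s, hs'⟩, prim_toL2, ext_of_mem a hs']
    rfl
  rw [intervalIntegral.integral_congr e, hi, expPrim_apply, expPrimitive,
    ← prim_apply (toL2 ℝ a) x, prim_toL2]
  simp

theorem posPair_expPrim (u : L2I) : PosPair (1, mulL2 ℝ (expPrim u) ((-(1 / 2) : ℝ) • u)) :=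
  fun x => by rw [J_expPrim]; exact expPrim_pos u x

theorem toL2_expPrim_mem (u : L2I) : toL2 ℝ (expPrim u) ∈ Pplus :=
  mem_Pplus_iff.2 ⟨_, posPair_expPrim u, by rw [J_expPrim]⟩

theorem coleHopfH_mem (u : L2I) : coleHopfH u ∈ Pone := by
  rw [coleHopfH_eq]
  exact inv_mean_smul_mem_Pone (toL2_expPrim_mem u)

/-- Scale invariance of $C$ removes the normalization. The remaining exponential $E$ has derivative
$-\frac12uE$ by `J_expPrim`, and $-2\cdot(-\frac12uE)/E=u$. -/
theorem coleHopfC_coleHopfH (u : L2I) : coleHopfC (coleHopfH u) = u := by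
  rw [coleHopfH_eq, coleHopfC_smul (toL2_expPrim_mem u)
    (one_div_pos.2 (mean_pos (toL2_expPrim_mem u)))]
  have h := coleHopfC_toL2_J (posPair_expPrim u)
  rw [J_expPrim] at h
  rw [h, pairC, J_expPrim]
  simp only
  rw [← map_smul, mulL2_mulL2, Ring.inverse_mul_cancel _ (isUnit_of_pos (expPrim_pos u)),
    mulL2_one, smul_smul]
  norm_num

/-- Formally $-\frac12\int_0^xC(f)=\log f(x)-\log f(0)$. This is literal when the derivative of $f$
is continuous, and both sides are continuous at positive pairs. -/
theorem expPrim_pairC {p : ℝ × L2 ℝ} (hp : PosPair p) :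
    expPrim (pairC p) = (p.1)⁻¹ • J ℝ p := by
  set D : Set (ℝ × L2 ℝ) := range (Prod.map id (toL2 ℝ) : ℝ × CI ℝ → ℝ × L2 ℝ) with hD
  have hdense : Dense D := (Function.surjective_id.denseRange.prodMap denseRange_toL2)
  have hne : (nhdsWithin p D).NeBot := mem_closure_iff_nhdsWithin_neBot.1 (hdense p)
  have h1 : Filter.Tendsto (fun p => expPrim (pairC p)) (nhdsWithin p D)
      (nhds (expPrim (pairC p))) :=
    ((continuous_expPrim.continuousAt.comp (continuousAt_pairC hp))).mono_left nhdsWithin_le_nhds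
  have h2 : Filter.Tendsto (fun p => (p.1)⁻¹ • J ℝ p) (nhdsWithin p D)
      (nhds ((p.1)⁻¹ • J ℝ p)) := by
    have : ContinuousAt (fun p : ℝ × L2 ℝ => (p.1)⁻¹ • J ℝ p) p :=
      (continuousAt_fst.inv₀ hp.fst_pos.ne').smul (J ℝ).continuous.continuousAt
    exact this.mono_left nhdsWithin_le_nhds
  refine tendsto_nhds_unique_of_eventuallyEq h1 h2 ?_
  -- Positivity is an open condition, so the approximating pairs near `p` are positive as well.
  filter_upwards [self_mem_nhdsWithin, mem_nhdsWithin_of_mem_nhds (isOpen_posPair.mem_nhds hp)]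
    with q hq hqp
  obtain ⟨⟨c, a⟩, rfl⟩ := hq
  have hqp : PosPair (c, toL2 ℝ a) := hqp
  ext x
  simp only [Prod.map_apply, id]
  have hJ : ∀ y ∈ Icc (0 : ℝ) 1, ext (J ℝ (c, toL2 ℝ a)) y = c + ∫ s in (0 : ℝ)..y, ext a s := by
    intro y hy
    rw [ext_J _ hy, intervalIntegral_congr_L2 (coeFn_toL2 a) hy]
  have hd : ∀ y ∈ Icc (0 : ℝ) 1, HasDerivWithinAt
      (fun y => Real.log (ext (J ℝ (c, toL2 ℝ a)) y))
      (ext a y / ext (J ℝ (c, toL2 ℝ a)) y) (Icc 0 1) y := fun y hy =>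
    HasDerivWithinAt.log (((hasDerivWithinAt_primitive (continuous_ext a).continuousOn
      hy).const_add c).congr hJ (hJ y hy)) (hqp.ext_pos y).ne'
  have hi := integral_deriv_eq_sub hd (((continuous_ext a).div (continuous_ext _)
    fun y => (hqp.ext_pos y).ne').continuousOn) x.2
  have h0 : ext (J ℝ (c, toL2 ℝ a)) 0 = c := by rw [hJ 0 (by simp)]; simp
  have e : ∫ s in (0 : ℝ)..x, pairC (c, toL2 ℝ a) s =
      ∫ s in (0 : ℝ)..x, -2 * (ext a s / ext (J ℝ (c, toL2 ℝ a)) s) := by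
    refine intervalIntegral_congr_L2 ?_ x.2
    filter_upwards [coeFn_pairC hqp, coeFn_toL2 a] with s k1 k2
    rw [k1, k2]
  rw [expPrim_apply, expPrimitive, e, intervalIntegral.integral_const_mul, hi, h0, ← mul_assoc]
  have hc : 0 < c := hqp.fst_pos
  norm_num only
  rw [one_mul, Real.exp_sub, Real.exp_log (hqp.ext_pos _), Real.exp_log hc, ext_of_mem _ x.2,
    ContinuousMap.smul_apply, smul_eq_mul, div_eq_inv_mul]

theorem coleHopfH_coleHopfC {v : L2I} (hv : v ∈ Pplus) :
    coleHopfH (coleHopfC v) = (1 / mean v) • v := by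
  obtain ⟨p, hp, rfl⟩ := mem_Pplus_iff.1 hv
  have h1 := hp.fst_pos.ne'
  have h2 := (mean_pos hv).ne'
  rw [coleHopfC_toL2_J hp, coleHopfH_eq, expPrim_pairC hp, map_smul, mean_smul, smul_smul]
  congr 1
  field_simp

/-! ### Global flows -/

/-- The solution chosen in `flow` may vary with $t$ and have a finite life span, but uniqueness on
every $[0,T)$ makes its value at $t$ equal to `Y t`. Since this holds only for $t\ge0$, the notion
of solution must ignore negative times, which is the role of `hcongr`. -/
theorem isGlobalFlowOn_of {Sol : EReal → L2I → (ℝ → L2I) → Prop} {S : Set L2I}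
    (hcongr : ∀ y₀ y z, (∀ t, 0 ≤ t → y t = z t) → Sol ⊤ y₀ y → Sol ⊤ y₀ z)
    (h : ∀ y₀ ∈ S, ∃ Y, Sol ⊤ y₀ Y ∧ (∀ t, 0 ≤ t → Y t ∈ S) ∧
      ∀ T : EReal, 0 < T → ∀ y, Sol T y₀ y → ∀ t ∈ timeSpan T, y t = Y t) :
    IsGlobalFlowOn Sol S := by
  intro y₀ hy₀
  obtain ⟨Y, hY, hS, huniq⟩ := h y₀ hy₀
  have hflow : ∀ t, 0 ≤ t → flow Sol t y₀ = Y t := by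
    intro t ht
    have hex : ∃ y, ∃ T : EReal, (t : EReal) < T ∧ Sol T y₀ y :=
      ⟨Y, ⊤, EReal.coe_lt_top t, hY⟩
    rw [flow, dif_pos hex]
    obtain ⟨T, hT, hsol⟩ := hex.choose_spec
    exact huniq T ((EReal.coe_nonneg.2 ht).trans_lt hT) _ hsol t ⟨ht, hT⟩
  refine ⟨hcongr y₀ Y _ (fun t ht => (hflow t ht).symm) hY, fun t ht => ?_, fun T hT y hy t ht => ?_⟩
  · rw [hflow t ht]; exact hS t ht
  · rw [huniq T hT y hy t ht, hflow t ht.1]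

theorem IsGlobalFlowOn.flow_eq {Sol : EReal → L2I → (ℝ → L2I) → Prop} {S : Set L2I}
    (h : IsGlobalFlowOn Sol S) {y₀ : L2I} (hy₀ : y₀ ∈ S) {Y : ℝ → L2I} (hY : Sol ⊤ y₀ Y) {t : ℝ}
    (ht : 0 ≤ t) : flow Sol t y₀ = Y t :=
  ((h y₀ hy₀).2.2 ⊤ EReal.zero_lt_top Y hY t (by rwa [timeSpan_top])).symm

/-! #### The linear heat equation -/

theorem exists_pos_heatCurve (hV : ContDiffOn ℝ 1 V (Icc 0 1))
    (hpos : ∀ x ∈ Icc (0 : ℝ) 1, 0 < V x) {v₀ : L2I} (hv₀ : v₀ ∈ Pplus) :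
    ∃ p f ft fx fxt, HeatCurve V p f ft fx fxt ∧ toL2 ℝ (J ℝ (p 0)) = v₀ ∧
      ∀ t, 0 ≤ t → PosPair (p t) := by
  obtain ⟨q, hq, rfl⟩ := mem_Pplus_iff.1 hv₀
  obtain ⟨p, f, ft, fx, fxt, h, h0⟩ := exists_heatCurve hV hpos q
  refine ⟨p, f, ft, fx, fxt, h, by rw [h0], fun t ht x => ?_⟩
  have := h.pos hV.continuousOn hpos (fun x _ => by rw [h.eq_ext, h0]; exact hq.ext_pos x) ht x x.2
  rwa [h.eq_ext, ext_of_mem _ x.2] at this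

theorem isGlobalFlowOn_heat (hV : ContDiffOn ℝ 1 V (Icc 0 1))
    (hpos : ∀ x ∈ Icc (0 : ℝ) 1, 0 < V x) : IsGlobalFlowOn (IsHeatSolution V) Pplus := by
  refine isGlobalFlowOn_of ?_ ?_
  · rintro y₀ y z hyz ⟨hc, h0, w, wt, wx, wxx, hC, hw⟩
    refine ⟨?_, by rw [← hyz 0 le_rfl, h0], w, wt, wx, wxx, hC, fun t ht => ?_⟩
    · exact hc.congr fun t ht => (hyz t ht.1).symm
    · rw [← hyz t ht.1.le]; exact hw t ht
  · intro v₀ hv₀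
    obtain ⟨p, f, ft, fx, fxt, h, h0, hp⟩ := exists_pos_heatCurve hV hpos hv₀
    have hs := h.isHeatSolution
    rw [h0] at hs
    exact ⟨_, hs, fun t ht => mem_Pplus_iff.2 ⟨p t, hp t ht, rfl⟩, fun T hT y hy t ht =>
      hy.unique hV.continuousOn hpos (hs.mono le_top) ht⟩

/-! #### The nonlinear heat equation -/

/-- The derivative of the mean along the heat flow. -/
theorem HeatCurve.hasDerivAt_mean {p : ℝ → ℝ × L2 ℝ} {f ft fx fxt : ℝ → ℝ → ℝ}
    (h : HeatCurve V p f ft fx fxt) (hV : ContinuousOn V (Icc 0 1)) {t : ℝ} (ht : 0 < t) :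
    HasDerivAt (fun t => mean (toL2 ℝ (J ℝ (p t)))) (-∫ x in (0 : ℝ)..1, V x * f t x) t := by
  have hC := h.isC12
  have ht' : t ∈ posTimes ⊤ := by rwa [posTimes_top]
  have hd := hasDerivAt_parametric_integral (isOpen_posTimes ⊤) hC.deriv_t
    (fun t ht => (hC.cont_slice ht).1) hC.cont_t ht' (y := 1) (by simp)
  obtain ⟨c0, c1, c2, c3⟩ := hC.cont_slice ht'
  have e1 := integral_deriv_eq_sub (hC.deriv_xx t ht') c3 (x := 1) (by simp)
  have i2 : IntervalIntegrable (fun x => V x * f t x) volume 0 1 :=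
    (hV.mul c0).intervalIntegrable_of_Icc zero_le_one
  rw [(h.bdry t ht).1, (h.bdry t ht).2, intervalIntegral.integral_add
    (c1.intervalIntegrable_of_Icc zero_le_one) i2] at e1
  refine (hd.congr_of_eventuallyEq (Filter.Eventually.of_forall fun s => ?_)).congr_deriv
    (by linarith)
  simp only [mean_toL2, h.eq_ext]

/-- As $g'=-\int Vf$, the factor $1/g$ has derivative $(\int Vf)/g^2$, which produces the nonlocal
term for $f/g$. The hypothesis of mean one only serves the initial value. -/
theorem HeatCurve.isNonlinearHeatSolution {p : ℝ → ℝ × L2 ℝ} {f ft fx fxt : ℝ → ℝ → ℝ}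
    (h : HeatCurve V p f ft fx fxt) (hV : ContinuousOn V (Icc 0 1))
    (hp : ∀ t, 0 ≤ t → PosPair (p t)) (h1 : mean (toL2 ℝ (J ℝ (p 0))) = 1) :
    IsNonlinearHeatSolution V ⊤ (toL2 ℝ (J ℝ (p 0)))
      fun t => (1 / mean (toL2 ℝ (J ℝ (p t)))) • toL2 ℝ (J ℝ (p t)) := by
  have hs := h.isHeatSolution
  have hC := h.isC12
  set g : ℝ → ℝ := fun t => mean (toL2 ℝ (J ℝ (p t))) with hg
  have hgpos : ∀ t, 0 ≤ t → 0 < g t := fun t ht => mean_toL2_pos (hp t ht)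
  have hgc : ContinuousOn g (timeSpan ⊤) := by
    simp only [hg, mean_eq_meanL]
    exact meanL.continuous.comp_continuousOn hs.cont
  have hVf : ContinuousOn (fun t => ∫ x in (0 : ℝ)..1, V x * f t x) (posTimes ⊤) :=
    continuousOn_parametric_integral (w := fun t x => V x * f t x)
      ((hV.comp continuousOn_snd fun z hz => hz.2).mul hC.cont)
  have hd : ∀ t ∈ posTimes ⊤, HasDerivAt (fun t => 1 / g t)
      ((∫ x in (0 : ℝ)..1, V x * f t x) / g t ^ 2) t := by
    intro t ht
    refine (((hasDerivAt_const t (1 : ℝ)).div (h.hasDerivAt_mean hV ht.1)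
      (hgpos t ht.1.le).ne')).congr_deriv ?_
    simp only [hg]; ring
  have hcd : ContinuousOn (fun t => (∫ x in (0 : ℝ)..1, V x * f t x) / g t ^ 2) (posTimes ⊤) :=
    hVf.div ((hgc.mono (posTimes_subset_timeSpan ⊤)).pow 2) fun t ht =>
      (pow_pos (hgpos t ht.1.le) 2).ne'
  refine ⟨(continuousOn_const.div hgc fun t ht => (hgpos t ht.1).ne').smul hs.cont,
    by simp only [h1, div_one, one_smul], _, _, _, _, hC.time_mul hd hcd, fun t ht =>
    ⟨?_, fun x hx => ?_, ?_, ?_⟩⟩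
  · filter_upwards [Lp.coeFn_smul (1 / g t) (toL2 ℝ (J ℝ (p t))), coeFn_toL2 (J ℝ (p t))]
      with x e1 e2
    rw [e1, Pi.smul_apply, e2, h.eq_ext, smul_eq_mul]
  · have e : ∫ ξ in (0 : ℝ)..1, V ξ * (1 / g t * f t ξ) =
        1 / g t * ∫ ξ in (0 : ℝ)..1, V ξ * f t ξ := by
      rw [← intervalIntegral.integral_const_mul]
      congr 1; funext ξ; ring
    rw [e]
    have := (hgpos t ht.1.le).ne'
    field_simp
    ring
  · rw [(h.bdry t ht.1).1, mul_zero]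
  · rw [(h.bdry t ht.1).2, mul_zero]

theorem exists_integrating_factor {T : EReal} (hT : 0 < T) {h : ℝ → ℝ}
    (hc : ContinuousOn h (timeSpan T)) :
    ∃ a : ℝ → ℝ, a 0 = 1 ∧ ContinuousOn a (timeSpan T) ∧ (∀ t, 0 < a t) ∧
      ∀ t ∈ posTimes T, HasDerivAt a (-h t * a t) t := by
  set U : Set ℝ := {t | (t : EReal) < T} with hU
  have hUo : IsOpen U := isOpen_Iio.preimage continuous_coe_real_ereal
  have h0U : (0 : ℝ) ∈ U := hT
  -- Extending `h` by the constant `h 0` to negative times gives a continuous function on an open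
  -- set containing $0$, so the fundamental theorem of calculus also covers $t=0$.
  have hk : ContinuousOn (fun t => h (max t 0)) U :=
    hc.comp (Continuous.continuousOn (by fun_prop)) fun t ht =>
      ⟨le_max_right _ _, by rcases max_choice t 0 with e | e <;> rw [e] <;> assumption⟩
  have hA : ∀ t ∈ U, HasDerivAt (fun t => ∫ s in (0 : ℝ)..t, h (max s 0)) (h (max t 0)) t := by
    intro t ht
    have hsub : uIcc 0 t ⊆ U := fun s hs => by
      have h1 : s ≤ max 0 t := hs.2
      have h2 : max 0 t ∈ U := by rcases max_choice 0 t with e | e <;> rw [e] <;> assumption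
      exact (EReal.coe_le_coe_iff.2 h1).trans_lt h2
    exact intervalIntegral.integral_hasDerivAt_right (hk.mono hsub).intervalIntegrable
      (hk.stronglyMeasurableAtFilter hUo t ht) (hk.continuousAt (hUo.mem_nhds ht))
  refine ⟨fun t => Real.exp (-∫ s in (0 : ℝ)..t, h (max s 0)), by simp, fun t ht => ?_,
    fun t => Real.exp_pos _, fun t ht => ?_⟩
  · exact (hA t ht.2).neg.exp.continuousAt.continuousWithinAt
  · refine (hA t ht.2).neg.exp.congr_deriv ?_
    rw [max_eq_left ht.1.le, mul_comm]; rfl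

theorem integral_mul_eq_inner {a : CI ℝ} {y : L2I} {w : ℝ → ℝ} (h : y =ᵐ[muI] w) :
    inner ℝ (toL2 ℝ a) y = ∫ x in (0 : ℝ)..1, ext a x * w x := by
  rw [L2.inner_def, ← integral_muI]
  refine integral_congr_ae ?_
  filter_upwards [h, coeFn_toL2 a] with x h1 h2
  rw [h1, h2]
  exact mul_comm _ _

/-- The factor $a$ with $a'=-(\int Vy)a$, $a(0)=1$, cancels the nonlocal term, so $ay$ is the linear
solution by uniqueness. Neither positivity nor unit mean of $y$ at later times is assumed. -/
theorem IsNonlinearHeatSolution.eq_normalized (hV : ContinuousOn V (Icc 0 1))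
    (hpos : ∀ x ∈ Icc (0 : ℝ) 1, 0 < V x)
    {p : ℝ → ℝ × L2 ℝ} {f ft fx fxt : ℝ → ℝ → ℝ}
    (h : HeatCurve V p f ft fx fxt) (h1 : mean (toL2 ℝ (J ℝ (p 0))) = 1)
    {T : EReal} (hT : 0 < T) {y : ℝ → L2I}
    (hy : IsNonlinearHeatSolution V T (toL2 ℝ (J ℝ (p 0))) y) {t : ℝ} (ht : t ∈ timeSpan T) :
    y t = (1 / mean (toL2 ℝ (J ℝ (p t)))) • toL2 ℝ (J ℝ (p t)) := by
  let VI : CI ℝ := ⟨fun x => V x, continuousOn_iff_continuous_domRestrict.1 hV⟩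
  have hVI : ∀ {y : L2I} {w : ℝ → ℝ}, y =ᵐ[muI] w →
      inner ℝ (toL2 ℝ VI) y = ∫ x in (0 : ℝ)..1, V x * w x := by
    intro y w h
    rw [integral_mul_eq_inner h]
    refine intervalIntegral.integral_congr fun x hx => ?_
    rw [uIcc_of_le zero_le_one] at hx
    simp only [ext_of_mem VI hx]
    rfl
  obtain ⟨w, wt, wx, wxx, hC, hw⟩ := hy.eqn
  have hhc : ContinuousOn (fun t => inner ℝ (toL2 ℝ VI) (y t)) (timeSpan T) :=
    (innerSL ℝ (toL2 ℝ VI)).continuous.comp_continuousOn hy.cont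
  obtain ⟨a, a0, ac, apos, ad⟩ := exists_integrating_factor hT hhc
  have hsol : IsHeatSolution V T (toL2 ℝ (J ℝ (p 0))) fun t => a t • y t := by
    refine ⟨ac.smul hy.cont, by rw [a0, one_smul, hy.init], _, _, _, _, hC.time_mul ad
      (((hhc.neg).mul ac).mono (posTimes_subset_timeSpan T)), fun t ht => ?_⟩
    obtain ⟨e1, e2, e3, e4⟩ := hw t ht
    refine ⟨?_, fun x hx => ?_, by rw [e3, mul_zero], by rw [e4, mul_zero]⟩
    · filter_upwards [Lp.coeFn_smul (a t) (y t), e1] with x k1 k2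
      rw [k1, Pi.smul_apply, k2, smul_eq_mul]
    · rw [e2 x hx, hVI e1]; ring
  have heq : ∀ s ∈ timeSpan T, a s • y s = toL2 ℝ (J ℝ (p s)) := fun s hs =>
    hsol.unique hV hpos (h.isHeatSolution.mono le_top) hs
  set g : ℝ → ℝ := fun t => mean (toL2 ℝ (J ℝ (p t))) with hg
  have hgc : ContinuousOn g (Icc 0 t) := by
    simp only [hg, mean_eq_meanL]
    refine meanL.continuous.comp_continuousOn (h.isHeatSolution.cont.mono ?_)
    rw [timeSpan_top]
    exact Icc_subset_Ici_self
  -- Both derivatives equal $-\int Vf$, because $f=ay$ gives $a\int Vy=\int Vf$. As $g(0)=a(0)=1$,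
  -- the two agree.
  have hgd : ∀ s ∈ Ioo 0 t, HasDerivAt (fun s => g s - a s) 0 s := by
    intro s hs
    have hs' := Ioo_subset_posTimes ht hs
    refine ((h.hasDerivAt_mean hV hs.1).sub (ad s hs')).congr_deriv ?_
    have e1 : inner ℝ (toL2 ℝ VI) (toL2 ℝ (J ℝ (p s))) = ∫ x in (0 : ℝ)..1, V x * f s x :=
      hVI (by rw [h.eq_ext]; exact coeFn_toL2 _)
    rw [← e1, ← heq s (posTimes_subset_timeSpan T hs'), inner_smul_right]
    ring
  have hac : ContinuousOn a (Icc 0 t) := ac.mono (Icc_subset_timeSpan ht)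
  have l1 := le_of_energy ht.1 (hgc.sub hac) hgd fun _ _ => le_rfl
  have l2 := le_of_energy (e := fun s => -(g s - a s)) (e' := fun _ => 0) ht.1 (hgc.sub hac).neg
    (fun s hs => (hgd s hs).neg.congr_deriv neg_zero) fun _ _ => le_rfl
  have hg0 : g 0 = 1 := h1
  simp only [Pi.sub_apply, hg0, a0] at l1 l2
  have hga : g t = a t := by linarith
  change y t = (1 / g t) • _
  rw [hga, ← heq t ht, smul_smul, one_div, inv_mul_cancel₀ (apos t).ne', one_smul]

theorem isGlobalFlowOn_nonlinearHeat (hV : ContDiffOn ℝ 1 V (Icc 0 1))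
    (hpos : ∀ x ∈ Icc (0 : ℝ) 1, 0 < V x) : IsGlobalFlowOn (IsNonlinearHeatSolution V) Pone := by
  refine isGlobalFlowOn_of ?_ ?_
  · rintro y₀ y z hyz ⟨hc, h0, w, wt, wx, wxx, hC, hw⟩
    refine ⟨?_, by rw [← hyz 0 le_rfl, h0], w, wt, wx, wxx, hC, fun t ht => ?_⟩
    · exact hc.congr fun t ht => (hyz t ht.1).symm
    · rw [← hyz t ht.1.le]; exact hw t ht
  · rintro v₀ ⟨hv₀, hm⟩
    obtain ⟨p, f, ft, fx, fxt, h, rfl, hp⟩ := exists_pos_heatCurve hV hpos hv₀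
    exact ⟨_, h.isNonlinearHeatSolution hV.continuousOn hp hm, fun t ht =>
      inv_mean_smul_mem_Pone (mem_Pplus_iff.2 ⟨p t, hp t ht, rfl⟩), fun T hT y hy t ht =>
      hy.eq_normalized hV.continuousOn hpos h hm hT ht⟩

/-! #### The Burgers equation -/

/-- The quotient rule. Two space derivatives of $f_x/f$ use three of $f$, and its time derivative
uses $f_{xt}$, hence the separate regularity hypothesis on $f_x$. -/
theorem isC12_logDeriv {T : EReal} {f ft fx fxx fxt fxxx : ℝ → ℝ → ℝ} (hf : IsC12 T f ft fx fxx)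
    (hfx : IsC12 T fx fxt fxx fxxx) (hne : ∀ t ∈ posTimes T, ∀ x ∈ Icc (0 : ℝ) 1, f t x ≠ 0) :
    IsC12 T (fun t x => -2 * (fx t x / f t x))
      (fun t x => -2 * (fxt t x / f t x - fx t x * ft t x / f t x ^ 2))
      (fun t x => -2 * (fxx t x / f t x - fx t x ^ 2 / f t x ^ 2))
      (fun t x => -2 * (fxxx t x / f t x - 3 * fx t x * fxx t x / f t x ^ 2 +
        2 * fx t x ^ 3 / f t x ^ 3)) := by
  have hne' : ∀ z ∈ posTimes T ×ˢ Icc (0 : ℝ) 1, Function.uncurry f z ≠ 0 :=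
    fun z hz => hne z.1 hz.1 z.2 hz.2
  have hne2 : ∀ z ∈ posTimes T ×ˢ Icc (0 : ℝ) 1, Function.uncurry f z ^ 2 ≠ 0 :=
    fun z hz => pow_ne_zero 2 (hne' z hz)
  have hne3 : ∀ z ∈ posTimes T ×ˢ Icc (0 : ℝ) 1, Function.uncurry f z ^ 3 ≠ 0 :=
    fun z hz => pow_ne_zero 3 (hne' z hz)
  have c2 : ContinuousOn (fun _ : ℝ × ℝ => (-2 : ℝ)) (posTimes T ×ˢ Icc (0 : ℝ) 1) :=
    continuousOn_const
  have c3 : ContinuousOn (fun _ : ℝ × ℝ => (3 : ℝ)) (posTimes T ×ˢ Icc (0 : ℝ) 1) :=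
    continuousOn_const
  have c4 : ContinuousOn (fun _ : ℝ × ℝ => (2 : ℝ)) (posTimes T ×ˢ Icc (0 : ℝ) 1) :=
    continuousOn_const
  refine ⟨fun t ht x hx => ?_, fun t ht x hx => ?_, fun t ht x hx => ?_, ?_, ?_, ?_, ?_⟩
  · have hn := hne t ht x hx
    refine (((hfx.deriv_t t ht x hx).div (hf.deriv_t t ht x hx) hn).const_mul (-2)).congr_deriv ?_
    field_simp
  · have hn := hne t ht x hx
    refine (((hfx.deriv_x t ht x hx).div (hf.deriv_x t ht x hx) hn).const_mul (-2)).congr_deriv ?_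
    field_simp
  · have hn := hne t ht x hx
    have h1 := (hfx.deriv_xx t ht x hx).div (hf.deriv_x t ht x hx) hn
    have h2 := ((hfx.deriv_x t ht x hx).pow 2).div ((hf.deriv_x t ht x hx).pow 2)
      (pow_ne_zero 2 hn)
    refine ((h1.sub h2).const_mul (-2)).congr_deriv ?_
    simp only [Pi.pow_apply]
    field_simp
    push_cast
    ring
  · exact c2.mul (hfx.cont.div hf.cont hne')
  · exact c2.mul ((hfx.cont_t.div hf.cont hne').sub
      ((hfx.cont.mul hf.cont_t).div (hf.cont.pow 2) hne2))
  · exact c2.mul ((hf.cont_xx.div hf.cont hne').sub ((hf.cont_x.pow 2).div (hf.cont.pow 2) hne2))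
  · exact c2.mul (((hfx.cont_xx.div hf.cont hne').sub
      (((c3.mul hf.cont_x).mul hf.cont_xx).div (hf.cont.pow 2) hne2)).add
      ((c4.mul (hf.cont_x.pow 3)).div (hf.cont.pow 3) hne3))

/-- The Cole–Hopf cancellation: the forcing $2V'$ comes from the term $V'f$ in $f_{xxx}$, and the
Neumann condition for $f$ becomes the Dirichlet condition for $-2f_x/f$. -/
theorem HeatCurve.isBurgersSolution {p : ℝ → ℝ × L2 ℝ} {f ft fx fxt : ℝ → ℝ → ℝ}
    (h : HeatCurve V p f ft fx fxt) (hp : ∀ t, 0 ≤ t → PosPair (p t)) :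
    IsBurgersSolution V ⊤ (pairC (p 0)) fun t => pairC (p t) := by
  have hfpos : ∀ t, 0 ≤ t → ∀ x, 0 < f t x := fun t ht x => by
    rw [h.eq_ext]; exact (hp t ht).ext_pos x
  refine ⟨?_, rfl, _, _, _, _, isC12_logDeriv h.isC12 h.isC12_deriv
    (fun t ht x _ => (hfpos t ht.1.le x).ne'), fun t ht => ⟨?_, fun x hx => ?_, ?_, ?_⟩⟩
  · rw [timeSpan_top]
    exact fun t ht => (continuousAt_pairC (hp t ht)).comp_continuousWithinAt (h.cont t ht)
  · filter_upwards [coeFn_pairC (hp t ht.1.le), h.ae_eq t ht.1] with x h1 h2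
    rw [h1, h2, h.eq_ext]
  · have hV' : derivWithin V (Icc 0 1) x = deriv V x :=
      derivWithin_of_mem_nhds (Icc_mem_nhds hx.1 hx.2)
    have := (hfpos t ht.1.le x).ne'
    rw [hV']
    field_simp
    ring
  · rw [(h.bdry t ht.1).1]; simp
  · rw [(h.bdry t ht.1).2]; simp

/-- The unnormalized Cole-Hopf transform of a solution of the Burgers equation. -/
theorem isC12_exp_primitive {T : EReal} {w wt wx wxx : ℝ → ℝ → ℝ} (hC : IsC12 T w wt wx wxx) :
    IsC12 T (fun t x => Real.exp (-(1 / 2) * ∫ s in (0 : ℝ)..x, w t s))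
      (fun t x => Real.exp (-(1 / 2) * ∫ s in (0 : ℝ)..x, w t s) *
        (-(1 / 2) * ∫ s in (0 : ℝ)..x, wt t s))
      (fun t x => Real.exp (-(1 / 2) * ∫ s in (0 : ℝ)..x, w t s) * (-(1 / 2) * w t x))
      (fun t x => Real.exp (-(1 / 2) * ∫ s in (0 : ℝ)..x, w t s) *
        (-(1 / 2) * wx t x + (-(1 / 2) * w t x) ^ 2)) := by
  have c : ContinuousOn (fun _ : ℝ × ℝ => (-(1 / 2) : ℝ)) (posTimes T ×ˢ Icc (0 : ℝ) 1) :=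
    continuousOn_const
  have hP := Real.continuous_exp.comp_continuousOn
    (c.mul (continuousOn_parametric_primitive hC.cont))
  have hPx : ∀ t ∈ posTimes T, ∀ x ∈ Icc (0 : ℝ) 1, HasDerivWithinAt
      (fun x => Real.exp (-(1 / 2) * ∫ s in (0 : ℝ)..x, w t s))
      (Real.exp (-(1 / 2) * ∫ s in (0 : ℝ)..x, w t s) * (-(1 / 2) * w t x)) (Icc 0 1) x :=
    fun t ht x hx => ((hasDerivWithinAt_primitive (hC.cont_slice ht).1 hx).const_mul _).exp
  refine ⟨fun t ht x hx => ?_, hPx, fun t ht x hx => ?_, hP, ?_, ?_, ?_⟩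
  · exact ((hasDerivAt_parametric_integral (isOpen_posTimes T) hC.deriv_t
      (fun t ht => (hC.cont_slice ht).1) hC.cont_t ht hx).const_mul _).exp
  · exact ((hPx t ht x hx).mul ((hC.deriv_x t ht x hx).const_mul (-(1 / 2)))).congr_deriv
      (by ring)
  · exact hP.mul (c.mul (continuousOn_parametric_primitive hC.cont_t))
  · exact hP.mul (c.mul hC.cont)
  · exact hP.mul ((c.mul hC.cont_x).add ((c.mul hC.cont).pow 2))

/-- For $P=\exp(-\frac12\int_0^xw)$, integrating the Burgers equation from $0$ gives
$P_t=P_{xx}-VP+\kappa(t)P$ with $\kappa(t)=\frac12w_x(t,0)+V(0)$. A coefficient depending on time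
alone disappears on division by $\int P$, and the normalization replaces it by the nonlocal term. -/
theorem IsBurgersSolution.coleHopfH (hV : ContDiffOn ℝ 1 V (Icc 0 1)) {T : EReal} {u₀ : L2I}
    {y : ℝ → L2I} (hy : IsBurgersSolution V T u₀ y) :
    IsNonlinearHeatSolution V T (coleHopfH u₀) fun t => coleHopfH (y t) := by
  obtain ⟨w, wt, wx, wxx, hC, hw⟩ := hy.eqn
  have hP := isC12_exp_primitive hC
  set P : ℝ → ℝ → ℝ := fun t x => Real.exp (-(1 / 2) * ∫ s in (0 : ℝ)..x, w t s) with hPdef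
  have hPpos : ∀ t x, 0 < P t x := fun t x => Real.exp_pos _
  set Pt : ℝ → ℝ → ℝ := fun t x => P t x * (-(1 / 2) * ∫ s in (0 : ℝ)..x, wt t s) with hPt
  set Pxx : ℝ → ℝ → ℝ := fun t x => P t x * (-(1 / 2) * wx t x + (-(1 / 2) * w t x) ^ 2) with hPxx
  set I : ℝ → ℝ := fun t => ∫ x in (0 : ℝ)..1, P t x with hI
  set It : ℝ → ℝ := fun t => ∫ x in (0 : ℝ)..1, Pt t x with hIt
  have hIpos : ∀ t ∈ posTimes T, 0 < I t := fun t ht =>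
    intervalIntegral.intervalIntegral_pos_of_pos
      ((hP.cont_slice ht).1.intervalIntegrable_of_Icc zero_le_one) (hPpos t) zero_lt_one
  have hId : ∀ t ∈ posTimes T, HasDerivAt I (It t) t := fun t ht =>
    hasDerivAt_parametric_integral (isOpen_posTimes T) hP.deriv_t
      (fun t ht => (hP.cont_slice ht).1) hP.cont_t ht (by simp)
  have hItc : ContinuousOn It (posTimes T) := continuousOn_parametric_integral hP.cont_t
  have hIc : ContinuousOn I (posTimes T) := fun t ht => (hId t ht).continuousAt.continuousWithinAt
  have had : ∀ t ∈ posTimes T, HasDerivAt (fun t => 1 / I t) (-It t / I t ^ 2) t := fun t ht =>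
    ((hasDerivAt_const t (1 : ℝ)).div (hId t ht) (hIpos t ht).ne').congr_deriv (by ring)
  have hadc : ContinuousOn (fun t => -It t / I t ^ 2) (posTimes T) :=
    hItc.neg.div (hIc.pow 2) fun t ht => (pow_pos (hIpos t ht) 2).ne'
  have hVd : ∀ x ∈ Ioo (0 : ℝ) 1, HasDerivAt V (deriv V x) x := fun x hx =>
    ((hV.differentiableOn (by norm_num) x (Ioo_subset_Icc_self hx)).differentiableAt
      (Icc_mem_nhds hx.1 hx.2)).hasDerivAt
  -- The integral of $w_t$ from $0$ to $x$ is the increment of $w_x-\frac12w^2+2V$; the condition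
  -- $w(t,0)=0$ removes the square at the lower end.
  have hPeq : ∀ t ∈ posTimes T, ∀ x ∈ Icc (0 : ℝ) 1,
      Pt t x = Pxx t x - V x * P t x + (wx t 0 / 2 + V 0) * P t x := by
    intro t ht x hx
    obtain ⟨-, e2, e3, -⟩ := hw t ht
    obtain ⟨c0, c1, c2, -⟩ := hC.cont_slice ht
    have hs : Icc 0 x ⊆ Icc (0 : ℝ) 1 := Icc_subset_Icc_right hx.2
    have hG : ContinuousOn (fun x => wx t x - w t x ^ 2 / 2 + 2 * V x) (Icc 0 x) :=
      ((c2.sub ((c0.pow 2).div_const 2)).add (continuousOn_const.mul hV.continuousOn)).mono hs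
    have h := intervalIntegral.integral_eq_sub_of_hasDerivAt_of_le hx.1 hG (f' := wt t)
      (fun z hz => by
        have hz' : z ∈ Ioo (0 : ℝ) 1 := ⟨hz.1, hz.2.trans_le hx.2⟩
        have hn := Icc_mem_nhds hz'.1 hz'.2
        have hzI := Ioo_subset_Icc_self hz'
        have d1 := (hC.deriv_x t ht z hzI).hasDerivAt hn
        have d2 := (hC.deriv_xx t ht z hzI).hasDerivAt hn
        refine ((d2.sub ((d1.pow 2).div_const 2)).add ((hVd z hz').const_mul 2)).congr_deriv ?_
        have := e2 z hz'
        push_cast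
        linarith)
      ((c1.mono hs).intervalIntegrable_of_Icc hx.1)
    simp only [hPt, hPxx, h, e3]
    ring
  -- $P_x=-\frac12wP$ vanishes at both ends, so $P_{xx}$ integrates to zero.
  have hIteq : ∀ t ∈ posTimes T, It t =
      -(∫ x in (0 : ℝ)..1, V x * P t x) + (wx t 0 / 2 + V 0) * I t := by
    intro t ht
    obtain ⟨-, e2, e3, e4⟩ := hw t ht
    obtain ⟨c0, c1, c2, c3⟩ := hP.cont_slice ht
    have h1 := integral_deriv_eq_sub (hP.deriv_xx t ht) c3 (x := 1) (by simp)
    rw [e3, e4] at h1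
    have i1 : IntervalIntegrable (Pxx t) volume 0 1 := c3.intervalIntegrable_of_Icc zero_le_one
    have i2 : IntervalIntegrable (fun x => V x * P t x) volume 0 1 :=
      (hV.continuousOn.mul c0).intervalIntegrable_of_Icc zero_le_one
    have i3 : IntervalIntegrable (fun x => (wx t 0 / 2 + V 0) * P t x) volume 0 1 :=
      (continuousOn_const.mul c0).intervalIntegrable_of_Icc zero_le_one
    have h2 : It t = ∫ x in (0 : ℝ)..1,
        (Pxx t x - V x * P t x + (wx t 0 / 2 + V 0) * P t x) := by
      refine intervalIntegral.integral_congr fun x hx => ?_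
      rw [uIcc_of_le zero_le_one] at hx
      exact hPeq t ht x hx
    rw [h2, intervalIntegral.integral_add (i1.sub i2) i3, intervalIntegral.integral_sub i1 i2,
      intervalIntegral.integral_const_mul]
    have h3 : ∫ x in (0 : ℝ)..1, Pxx t x = 0 := by rw [h1]; ring
    rw [h3, zero_sub]
  refine ⟨continuous_coleHopfH.comp_continuousOn hy.cont, by rw [hy.init], _, _, _, _,
    hP.time_mul had hadc, fun t ht => ⟨?_, fun x hx => ?_, ?_, ?_⟩⟩
  · obtain ⟨e1, -⟩ := hw t ht
    have hE : ∀ x ∈ Icc (0 : ℝ) 1, expPrimitive (y t) x = P t x := fun x hx => by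
      rw [expPrimitive, intervalIntegral_congr_L2 e1 hx]
    have hEI : ∫ x, expPrimitive (y t) x ∂muI = I t := by
      simp only [hI]
      rw [← integral_muI]
      exact integral_congr_ae (ae_muI_of_forall hE)
    filter_upwards [(memLp_coleHopfH (y t)).coeFn_toLp, ae_restrict_mem measurableSet_Icc]
      with x h1 h2
    rw [ColeHopf.coleHopfH, h1, hE x h2, hEI]
    ring
  · have e : ∫ ξ in (0 : ℝ)..1, V ξ * (1 / I t * P t ξ) =
        1 / I t * ∫ ξ in (0 : ℝ)..1, V ξ * P t ξ := by
      rw [← intervalIntegral.integral_const_mul]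
      congr 1; funext ξ; ring
    have h1 := hPeq t ht x (Ioo_subset_Icc_self hx)
    have h2 := hIteq t ht
    have h3 := (hIpos t ht).ne'
    simp only [e, h2]
    simp only [hPt, hPxx] at h1 ⊢
    rw [h1]
    field_simp
    ring
  · simp only [(hw t ht).2.2.1, mul_zero]
  · simp only [(hw t ht).2.2.2, mul_zero]

theorem isGlobalFlowOn_burgers (hV : ContDiffOn ℝ 1 V (Icc 0 1))
    (hpos : ∀ x ∈ Icc (0 : ℝ) 1, 0 < V x) : IsGlobalFlowOn (IsBurgersSolution V) univ := by
  refine isGlobalFlowOn_of ?_ ?_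
  · rintro y₀ y z hyz ⟨hc, h0, w, wt, wx, wxx, hC, hw⟩
    refine ⟨?_, by rw [← hyz 0 le_rfl, h0], w, wt, wx, wxx, hC, fun t ht => ?_⟩
    · exact hc.congr fun t ht => (hyz t ht.1).symm
    · rw [← hyz t ht.1.le]; exact hw t ht
  · intro u₀ _
    obtain ⟨hmem, hm⟩ := coleHopfH_mem u₀
    obtain ⟨p, f, ft, fx, fxt, h, h0, hp⟩ := exists_pos_heatCurve hV hpos hmem
    have hu₀ : pairC (p 0) = u₀ := by
      rw [← coleHopfC_toL2_J (hp 0 le_rfl), h0, coleHopfC_coleHopfH]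
    have hs := h.isBurgersSolution hp
    rw [hu₀] at hs
    refine ⟨_, hs, fun _ _ => mem_univ _, fun T hT y hy t ht => ?_⟩
    -- Uniqueness is pulled back through $H$: the transform of any solution is the normalized heat
    -- curve, and applying $C$ recovers the solution.
    have hn := hy.coleHopfH hV
    rw [← h0] at hn hm
    have key := hn.eq_normalized hV.continuousOn hpos h hm hT ht
    have hpt := hp t ht.1
    have hmemt : toL2 ℝ (J ℝ (p t)) ∈ Pplus := mem_Pplus_iff.2 ⟨p t, hpt, rfl⟩
    rw [← coleHopfC_coleHopfH (y t), key, coleHopfC_smul hmemt (one_div_pos.2 (mean_pos hmemt)),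
      coleHopfC_toL2_J hpt]

/-- The three flows in terms of one solution of the linear heat equation. -/
theorem exists_flow_formulas (hV : ContDiffOn ℝ 1 V (Icc 0 1))
    (hpos : ∀ x ∈ Icc (0 : ℝ) 1, 0 < V x) {v₀ : L2I} (hv₀ : v₀ ∈ Pone) {t : ℝ} (ht : 0 ≤ t) :
    heatFlow V t v₀ ∈ Pplus ∧
    nonlinearHeatFlow V t v₀ = (1 / mean (heatFlow V t v₀)) • heatFlow V t v₀ ∧
    burgersFlow V t (coleHopfC v₀) = coleHopfC (heatFlow V t v₀) := by
  obtain ⟨hmem, hm⟩ := hv₀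
  obtain ⟨p, f, ft, fx, fxt, h, rfl, hp⟩ := exists_pos_heatCurve hV hpos hmem
  have e1 : heatFlow V t (toL2 ℝ (J ℝ (p 0))) = toL2 ℝ (J ℝ (p t)) :=
    (isGlobalFlowOn_heat hV hpos).flow_eq hmem h.isHeatSolution ht
  have e2 := (isGlobalFlowOn_nonlinearHeat hV hpos).flow_eq ⟨hmem, hm⟩
    (h.isNonlinearHeatSolution hV.continuousOn hp hm) ht
  have e3 := (isGlobalFlowOn_burgers hV hpos).flow_eq (mem_univ _) (h.isBurgersSolution hp) ht
  refine ⟨e1 ▸ mem_Pplus_iff.2 ⟨p t, hp t ht, rfl⟩, by rw [e1]; exact e2, ?_⟩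
  rw [e1, coleHopfC_toL2_J (hp 0 le_rfl), coleHopfC_toL2_J (hp t ht)]
  exact e3

/-- Linearity and uniqueness. It carries the statements on $\mathcal P_1$ over to $\mathcal P_+$. -/
theorem heatFlow_smul (hV : ContDiffOn ℝ 1 V (Icc 0 1))
    (hpos : ∀ x ∈ Icc (0 : ℝ) 1, 0 < V x) {v₀ : L2I} (hv₀ : v₀ ∈ Pplus) {c : ℝ} (hc : 0 < c)
    {t : ℝ} (ht : 0 ≤ t) : heatFlow V t (c • v₀) = c • heatFlow V t v₀ :=
  (isGlobalFlowOn_heat hV hpos).flow_eq (smul_mem_Pplus hv₀ hc)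
    ((isGlobalFlowOn_heat hV hpos v₀ hv₀).1.const_smul c) ht

end ColeHopf

end

theorem mainTheorem8 (V : ℝ → ℝ) (hV : ContDiffOn ℝ 1 V (Set.Icc 0 1))
    (hVpos : ∀ x ∈ Set.Icc (0 : ℝ) 1, 0 < V x) :
    -- the three equations generate global flows on their phase spaces
    ColeHopf.IsGlobalFlowOn (ColeHopf.IsHeatSolution V) ColeHopf.Pplus ∧
    ColeHopf.IsGlobalFlowOn (ColeHopf.IsNonlinearHeatSolution V) ColeHopf.Pone ∧
    ColeHopf.IsGlobalFlowOn (ColeHopf.IsBurgersSolution V) Set.univ ∧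
    ∀ t : ℝ, 0 ≤ t →
      -- intertwining of the Burgers flow and the nonlinear heat flow
      (∀ u₀ : ColeHopf.L2I, ColeHopf.coleHopfH u₀ ∈ ColeHopf.Pone ∧
        ColeHopf.coleHopfH (ColeHopf.burgersFlow V t u₀) =
          ColeHopf.nonlinearHeatFlow V t (ColeHopf.coleHopfH u₀)) ∧
      (∀ v₀ ∈ ColeHopf.Pone,
        ColeHopf.coleHopfC (ColeHopf.nonlinearHeatFlow V t v₀) =
          ColeHopf.burgersFlow V t (ColeHopf.coleHopfC v₀)) ∧
      -- the nonlinear heat flow is the linear one divided by its spatial mean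
      (∀ v₀ ∈ ColeHopf.Pone,
        0 < ColeHopf.mean (ColeHopf.heatFlow V t v₀) ∧
        ColeHopf.nonlinearHeatFlow V t v₀ =
          (1 / ColeHopf.mean (ColeHopf.heatFlow V t v₀)) • ColeHopf.heatFlow V t v₀) ∧
      -- the Burgers flow is the projection of the heat flows
      (∀ v₀ ∈ ColeHopf.Pone,
        ColeHopf.coleHopfC (ColeHopf.nonlinearHeatFlow V t v₀) =
          ColeHopf.coleHopfC (ColeHopf.heatFlow V t v₀)) ∧
      (∀ v₀ ∈ ColeHopf.Pplus,
        ColeHopf.coleHopfC (ColeHopf.heatFlow V t v₀) =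
          ColeHopf.burgersFlow V t (ColeHopf.coleHopfC v₀)) ∧
      (∀ u₀ : ColeHopf.L2I,
        ColeHopf.burgersFlow V t u₀ =
          ColeHopf.coleHopfC (ColeHopf.heatFlow V t (ColeHopf.coleHopfH u₀))) := by
  open ColeHopf in
  refine ⟨isGlobalFlowOn_heat hV hVpos, isGlobalFlowOn_nonlinearHeat hV hVpos,
    isGlobalFlowOn_burgers hV hVpos, fun t ht => ?_⟩
  have key : ∀ v₀ ∈ Pone, _ := fun v₀ hv₀ => exists_flow_formulas hV hVpos hv₀ ht
  have hCN : ∀ v₀ ∈ Pone,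
      coleHopfC (nonlinearHeatFlow V t v₀) = coleHopfC (heatFlow V t v₀) := fun v₀ hv₀ => by
    obtain ⟨h1, h2, -⟩ := key v₀ hv₀
    rw [h2, coleHopfC_smul h1 (one_div_pos.2 (mean_pos h1))]
  have hB : ∀ u₀, burgersFlow V t u₀ = coleHopfC (heatFlow V t (coleHopfH u₀)) := fun u₀ => by
    rw [← (key _ (coleHopfH_mem u₀)).2.2, coleHopfC_coleHopfH]
  refine ⟨fun u₀ => ⟨coleHopfH_mem u₀, ?_⟩, fun v₀ hv₀ => ?_, fun v₀ hv₀ => ?_, hCN,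
    fun v₀ hv₀ => ?_, hB⟩
  · obtain ⟨h1, h2, -⟩ := key _ (coleHopfH_mem u₀)
    rw [hB, coleHopfH_coleHopfC h1, h2]
  · rw [hCN v₀ hv₀, (key v₀ hv₀).2.2]
  · exact ⟨mean_pos (key v₀ hv₀).1, (key v₀ hv₀).2.1⟩
  -- The datum is divided by its mean to land in $\mathcal P_1$; the factor commutes with the heat
  -- flow and is invisible to $C$.
  · have hc := one_div_pos.2 (mean_pos hv₀)
    have h1 := (key _ (inv_mean_smul_mem_Pone hv₀)).2.2
    rw [coleHopfC_smul hv₀ hc, heatFlow_smul hV hVpos hv₀ hc ht] at h1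
    rw [h1]
    exact (coleHopfC_smul ((isGlobalFlowOn_heat hV hVpos v₀ hv₀).2.1 t ht) hc).symm
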